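/- Planar maps are connected multigraphs drawn on the 2-sphere without crossings, viewed modulo orientation-preserving homeomorphisms; a rooted map has a distinguished oriented edge (the root). A planar triangulation is a planar map all of whose faces have degree three. An Apollonian triangulation is a planar triangulation obtained from the unique loopless triangulation with two triangles by repeated star division, i.e. by repeatedly choosing a triangle, placing a new vertex in it and joining this vertex to the three corners of the triangle. For $n\ge 0$ let $\mathcal{A}_n$ be the (finite) set of rooted Apollonian triangulations with $n+1$ vertices together with a distinguished spanning tree that contains the root edge, and let $A(z)=\sum_{n}|\mathcal{A}_n|\,z^n = 2z^2+8z^3+\cdots$ be the generating function. (The sets $\mathcal{A}_0$ and $\mathcal{A}_1$ are empty.) Proposition. The power series $A(z)$ is algebraic, i.e. there is a nonzero polynomial $P(z,y)\in\mathbb{Q}[z,y]$ with $P(z,A(z))=0$. Moreover, as $n\to\infty$, $$|\mathcal{A}_n| \sim \frac{C^n}{c\,n^{3/2}},$$ where $c = 1752.101\ldots$ (that is, $1752.101\le c<1752.102$) and $C = 28.43330\ldots$ (that is, $28.43330\le C<28.43331$) is the largest real solution of $$1296\,C^6+363232\,C^5-16927248\,C^4+438097032\,C^3-8977010004\,C^2+28680825384\,C-24111675=0.$$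 -/

import Mathlib

open Filter Asymptotics

/-- A combinatorial map (rotation system) with set of darts `D`, encoding a graph drawn on a closed
oriented surface, up to orientation-preserving homeomorphism, such that all faces are discs.
A dart is an edge (possibly a loop, possibly one of several parallel edges) with a direction.
`rev` reverses the direction of a dart, and `next d` is the dart that follows `d` on the contour of
the face incident to the side of `d` singled out by the fixed orientation convention. -/
structure CombMap (D : Type) where
  rev : Equiv.Perm D
  next : Equiv.Perm D
  rev_rev : ∀ d, rev (rev d) = d
  rev_ne : ∀ d, rev d ≠ d

namespace CombMap

variable {D D' : Type}

/-- Rotation around the origin of a dart: `rev d` ends at the origin of `d`, so `next (rev d)`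
starts there. -/
def rot (M : CombMap D) : Equiv.Perm D := M.next * M.rev

/-- Vertices, edges and faces are the cycles of `rot`, `rev` and `next`. -/
def Vertex (M : CombMap D) : Type := Quotient (Equiv.Perm.SameCycle.setoid M.rot)

def Edge (M : CombMap D) : Type := Quotient (Equiv.Perm.SameCycle.setoid M.rev)

def Face (M : CombMap D) : Type := Quotient (Equiv.Perm.SameCycle.setoid M.next)

/-- The vertex at which a dart starts. -/
def origin (M : CombMap D) (d : D) : M.Vertex :=
  Quotient.mk (Equiv.Perm.SameCycle.setoid M.rot) d

/-- The vertex at which a dart ends. -/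
def target (M : CombMap D) (d : D) : M.Vertex := M.origin (M.rev d)

/-- The edge underlying a dart. -/
def edge (M : CombMap D) (d : D) : M.Edge :=
  Quotient.mk (Equiv.Perm.SameCycle.setoid M.rev) d

/-- The face whose contour contains a dart. -/
def face (M : CombMap D) (d : D) : M.Face :=
  Quotient.mk (Equiv.Perm.SameCycle.setoid M.next) d

/-- The adjacency relation on the vertices that is given by a set of edges. -/
def graph (M : CombMap D) (T : Set M.Edge) : SimpleGraph M.Vertex :=
  SimpleGraph.fromRel fun u v => ∃ d, M.edge d ∈ T ∧ M.origin d = u ∧ M.target d = v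

/-- Finite connected maps on the sphere, the surface being identified by its Euler
characteristic. -/
def IsPlanar (M : CombMap D) : Prop :=
  Finite D ∧ (M.graph Set.univ).Connected ∧
    (Nat.card M.Vertex : ℤ) - Nat.card M.Edge + Nat.card M.Face = 2

/-- The degree of a face is the number of sides of edges on its contour. -/
noncomputable def faceDegree (M : CombMap D) (f : M.Face) : ℕ := {d : D | M.face d = f}.ncard

/-- All faces have degree three. -/
def IsTriangulation (M : CombMap D) : Prop := ∀ f : M.Face, M.faceDegree f = 3

/-- The edges in `T` form a tree that visits all vertices: `T` contains neither loops nor two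
parallel edges (if `d` is a loop then `d` and `rev d` have the same ends), and the resulting simple
graph on the set of all vertices is a tree. -/
def IsSpanningTree (M : CombMap D) (T : Set M.Edge) : Prop :=
  (∀ d d' : D, M.edge d ∈ T → M.edge d' ∈ T →
    M.origin d = M.origin d' → M.target d = M.target d' → d = d') ∧
  (M.graph T).IsTree

/-- `M` is the loopless triangulation with two triangles (two triangles glued along their
boundaries). With the three vertices labelled by `Fin 3`, the darts `e (i, true)` and
`e (i, false)` go from `i` to `i + 1` and from `i + 1` to `i`, respectively. -/
def IsDoubleTriangle (M : CombMap D) : Prop :=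
  ∃ e : Fin 3 × Bool ≃ D, ∀ i : Fin 3,
    M.rev (e (i, true)) = e (i, false) ∧
    M.next (e (i, true)) = e (i + 1, true) ∧
    M.next (e (i + 1, false)) = e (i, false)

/-- `M'` is obtained from `M` by a star division of a face of degree three, i.e. by placing a new
vertex `v` in the face and joining it to the three corners of the face.
`f 0, f 1, f 2` are the darts on the contour of the face, in cyclic order, and the new darts
`(i, true)` and `(i, false)` go from the origin of `f i` to `v` and back.
The face is replaced by the three faces with contours `f i, (i + 1, true), (i, false)`. -/
def IsStarDivision (M : CombMap D) (M' : CombMap D') : Prop :=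
  ∃ (f : Fin 3 → D) (e : D ⊕ (Fin 3 × Bool) ≃ D'),
    Function.Injective f ∧ (∀ i, M.next (f i) = f (i + 1)) ∧
    (∀ d, M'.rev (e (Sum.inl d)) = e (Sum.inl (M.rev d))) ∧
    (∀ i, M'.rev (e (Sum.inr (i, true))) = e (Sum.inr (i, false))) ∧
    (∀ d, d ∉ Set.range f → M'.next (e (Sum.inl d)) = e (Sum.inl (M.next d))) ∧
    (∀ i, M'.next (e (Sum.inl (f i))) = e (Sum.inr (i + 1, true))) ∧
    (∀ i, M'.next (e (Sum.inr (i + 1, true))) = e (Sum.inr (i, false))) ∧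
    (∀ i, M'.next (e (Sum.inr (i, false))) = e (Sum.inl (f i)))

/-- Apollonian triangulations: obtained from the loopless triangulation with two triangles by
repeated star division of triangles. -/
inductive IsApollonian : ∀ {D : Type}, CombMap D → Prop
  | base {D : Type} (M : CombMap D) : M.IsDoubleTriangle → IsApollonian M
  | star {D D' : Type} (M : CombMap D) (M' : CombMap D') :
      IsApollonian M → M.IsStarDivision M' → IsApollonian M'

end CombMap

/-- A rooted planar triangulation with `n + 1` vertices, together with a distinguished spanning tree
that includes the root edge. -/
structure TreeDecorated (n : ℕ) where
  Dart : Type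
  map : CombMap Dart
  root : Dart
  tree : Set map.Edge
  planar : map.IsPlanar
  triangulation : map.IsTriangulation
  card_vertex : Nat.card map.Vertex = n + 1
  spanning : map.IsSpanningTree tree
  root_mem : map.edge root ∈ tree

namespace TreeDecorated

/-- Isomorphism of rooted tree-decorated triangulations (preserving the orientation). -/
def Iso {n : ℕ} (s t : TreeDecorated n) : Prop :=
  ∃ e : s.Dart ≃ t.Dart,
    (∀ d, e (s.map.rev d) = t.map.rev (e d)) ∧
    (∀ d, e (s.map.next d) = t.map.next (e d)) ∧
    e s.root = t.root ∧
    (∀ d, s.map.edge d ∈ s.tree ↔ t.map.edge (e d) ∈ t.tree)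

theorem iso_equivalence (n : ℕ) : Equivalence (Iso (n := n)) where
  refl s := ⟨Equiv.refl _, fun _ => rfl, fun _ => rfl, rfl, fun _ => Iff.rfl⟩
  symm := by
    rintro s t ⟨e, h1, h2, h3, h4⟩
    refine ⟨e.symm, fun d => ?_, fun d => ?_, ?_, fun d => ?_⟩
    · rw [Equiv.symm_apply_eq, h1, Equiv.apply_symm_apply]
    · rw [Equiv.symm_apply_eq, h2, Equiv.apply_symm_apply]
    · rw [Equiv.symm_apply_eq, h3]
    · rw [h4, Equiv.apply_symm_apply]
  trans := by
    rintro s t u ⟨e, h1, h2, h3, h4⟩ ⟨e', h1', h2', h3', h4'⟩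
    refine ⟨e.trans e', fun d => ?_, fun d => ?_, ?_, fun d => ?_⟩
    · simp only [Equiv.trans_apply, h1, h1']
    · simp only [Equiv.trans_apply, h2, h2']
    · simp only [Equiv.trans_apply, h3, h3']
    · simp only [Equiv.trans_apply, h4, h4']

instance isoSetoid (n : ℕ) : Setoid (TreeDecorated n) := ⟨Iso, iso_equivalence n⟩

end TreeDecorated

/-- The set of rooted tree-decorated triangulations with `n + 1` vertices, viewed modulo
isomorphism. -/
def TreeDecoratedTriangulation (n : ℕ) : Type 1 := Quotient (TreeDecorated.isoSetoid n)

/-- The set of rooted tree-decorated Apollonian triangulations with `n + 1` vertices. -/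
def apollonian (n : ℕ) : Set (TreeDecoratedTriangulation n) :=
  {q | ∃ t : TreeDecorated n,
    t.map.IsApollonian ∧ (Quotient.mk (TreeDecorated.isoSetoid n) t : Quotient _) = q}

/-- The generating function of the tree-decorated Apollonian triangulations. -/
noncomputable def apollonianSeries : PowerSeries ℚ :=
  PowerSeries.mk fun n => ((apollonian n).ncard : ℚ)

/-!
The proof has a combinatorial and an analytic half.

*Combinatorics.* A rooted Apollonian triangulation is obtained from two triangles, glued along
their boundaries, by subdividing one of them; the root is on the boundary and the other triangle
is not subdivided. The subdivision is described by a ternary tree. Every rooted Apollonian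
triangulation arises in this way (`exists_hom_of_isApollonian`, `isApollonian_glue`), and from one
tree only, since the first vertex placed in a triangle is its only interior vertex that is
adjacent to all three corners (`eq_of_hom`); moreover there are no nontrivial automorphisms
(`hom_eq_refl`). A spanning tree restricts to a forest in the subdivided triangle in which each
component has a corner, and such forests are built recursively from the forests in the three
children, if one keeps track of the partition of the corners that they induce
(`forestCount_node`). Up to symmetry there are three partitions, hence the generating functions
satisfy a system of three polynomial equations. Eliminating one of the three unknowns leads to a
parametrization by two series `r` and `s` in `z` with

  `s = r + r² + 3 r s²`, `r (1 - 2 s) = z (1 + 3 r)³`, `A = 2 z² (1 + 3 r) (1 - s) / (1 - 2 s)`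

(`exists_parametrization`), from which algebraicity is read off.

*Asymptotics.* In the parametrization `s` is a power series in `r` with nonnegative coefficients,
so that `r = z φ(r)` with `φ = (1 + 3 x)³ / (1 - 2 s)`, and Lagrange inversion
(`PowerSeries.coeff_of_subst_eq`) expresses `n |𝒜ₙ₊₂|` as the coefficient of `xⁿ` in `x h'(x)
φ(x)ⁿ`, where `A = z² h(r)`. At the saddle point `τ`, where `τ φ'(τ) = φ(τ)`, the coefficients of
`φ(τ x) / φ(τ)` form a probability distribution with mean one, and a local limit theorem for its
powers (`tendsto_sqrt_mul_coeff`), proved with Fourier integrals and dominated convergence, yields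

  `|𝒜ₙ| ~ Cⁿ / (c n ^ (3 / 2))`, `C = φ(τ) / τ`, `c = C² √(2 π v) / (τ h'(τ))`, `v = τ² φ''(τ) / φ(τ)`.

The saddle point lies inside the disc of convergence because the equation for `s` has a finite
supersolution at `1 / 5` (`sum_branch_le`). The saddle point equation is linear in `s`, so that
`τ` is a root of an explicit polynomial of degree six and `C` is a rational function of `τ`
(`exists_saddle_point`, `growthRate_isRoot`).
-/


/-! ### Subdivided triangles -/

/-- Ternary trees. A tree describes an iterated star division of a triangle: a leaf is a triangle
that is not divided, a node is a triangle with a new vertex in its interior, and the child `c i` is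
the triangle spanned by the corners `i`, `i + 1` and the new vertex. -/
inductive TernaryTree : Type
  | leaf : TernaryTree
  | node (c : Fin 3 → TernaryTree) : TernaryTree

namespace TernaryTree

/-- The number of nodes, i.e. of interior vertices of the subdivided triangle. -/
def size : TernaryTree → ℕ
  | leaf => 0
  | node c => 1 + ∑ i, (c i).size

/-- The darts of the subdivided triangle whose incident face lies inside: every dart is recorded as
a face (a leaf of the tree) with a position on the contour of that face. -/
def Dart : TernaryTree → Type
  | leaf => Fin 3
  | node c => Σ i, (c i).Dart

/-- The contour of each inner face. -/
def next : ∀ t : TernaryTree, Equiv.Perm t.Dart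
  | leaf => (Equiv.addRight (1 : Fin 3) : Equiv.Perm (Fin 3))
  | node c => (Equiv.sigmaCongrRight fun i => (c i).next : Equiv.Perm (Σ i, (c i).Dart))

/-- The three boundary darts, seen from inside; `side i` goes from corner `i` to corner `i + 1`. -/
def side : ∀ t : TernaryTree, Fin 3 → t.Dart
  | leaf => fun i => i
  | node c => fun i => ⟨i, (c i).side 0⟩

/-- Reversal of darts that crosses no boundary edge: `inl i` stands for leaving the triangle
through the side `i`. Inside a node, side `1` of the child `i` is glued to side `2` of the child
`i + 1`, both being the edge between the corner `i + 1` and the new vertex. -/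
def opp : ∀ t : TernaryTree, t.Dart → Fin 3 ⊕ t.Dart
  | leaf => fun i => Sum.inl i
  | node c => fun d =>
    match (c d.1).opp d.2 with
    | Sum.inl 0 => Sum.inl d.1
    | Sum.inl 1 => Sum.inr ⟨d.1 + 1, (c (d.1 + 1)).side 2⟩
    | Sum.inl 2 => Sum.inr ⟨d.1 + 2, (c (d.1 + 2)).side 1⟩
    | Sum.inr d' => Sum.inr ⟨d.1, d'⟩

/-- The interior vertices. -/
def Inner : TernaryTree → Type
  | leaf => Empty
  | node c => Option (Σ i, (c i).Inner)

/-- All vertices: the three corners and the interior vertices. -/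
abbrev Vertex (t : TernaryTree) : Type := Fin 3 ⊕ t.Inner

/-- The vertices of the child `i` as vertices of the node: the corners `0`, `1`, `2` of the child
are the corners `i`, `i + 1` and the new vertex. -/
def embed (c : Fin 3 → TernaryTree) (i : Fin 3) : (c i).Vertex → (node c).Vertex
  | Sum.inl 0 => Sum.inl i
  | Sum.inl 1 => Sum.inl (i + 1)
  | Sum.inl 2 => Sum.inr (none : Option _)
  | Sum.inr x => Sum.inr (some ⟨i, x⟩ : Option _)

/-- The vertex at which a dart starts. -/
def org : ∀ t : TernaryTree, t.Dart → t.Vertex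
  | leaf => fun i => Sum.inl i
  | node c => fun d => embed c d.1 ((c d.1).org d.2)

/-- The edges in the interior; in a node, the edge `inl i` joins the corner `i` to the new
vertex. -/
def InnerEdge : TernaryTree → Type
  | leaf => Empty
  | node c => Fin 3 ⊕ Σ i, (c i).InnerEdge

/-- The edge of a dart, `inl i` being the side `i` of the triangle. -/
def edgeOf : ∀ t : TernaryTree, t.Dart → Fin 3 ⊕ t.InnerEdge
  | leaf => fun i => Sum.inl i
  | node c => fun d =>
    match (c d.1).edgeOf d.2 with
    | Sum.inl 0 => Sum.inl d.1
    | Sum.inl 1 => Sum.inr (Sum.inl (d.1 + 1) : Fin 3 ⊕ Σ i, (c i).InnerEdge)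
    | Sum.inl 2 => Sum.inr (Sum.inl d.1 : Fin 3 ⊕ Σ i, (c i).InnerEdge)
    | Sum.inr e => Sum.inr (Sum.inr ⟨d.1, e⟩ : Fin 3 ⊕ Σ i, (c i).InnerEdge)

/-- The two ends of an interior edge. -/
def ends : ∀ t : TernaryTree, t.InnerEdge → t.Vertex × t.Vertex
  | leaf => fun e => nomatch (e : Empty)
  | node c => fun e =>
    match (e : Fin 3 ⊕ Σ i, (c i).InnerEdge) with
    | Sum.inl i => (Sum.inl i, Sum.inr (none : Option _))
    | Sum.inr e => (embed c e.1 ((c e.1).ends e.2).1, embed c e.1 ((c e.1).ends e.2).2)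

instance finite_dart : ∀ t : TernaryTree, Finite t.Dart
  | leaf => inferInstanceAs (Finite (Fin 3))
  | node c =>
    have := fun i => finite_dart (c i)
    inferInstanceAs (Finite (Σ i, (c i).Dart))

instance finite_inner : ∀ t : TernaryTree, Finite t.Inner
  | leaf => inferInstanceAs (Finite Empty)
  | node c =>
    have := fun i => finite_inner (c i)
    inferInstanceAs (Finite (Option (Σ i, (c i).Inner)))

instance finite_innerEdge : ∀ t : TernaryTree, Finite t.InnerEdge
  | leaf => inferInstanceAs (Finite Empty)
  | node c =>
    have := fun i => finite_innerEdge (c i)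
    inferInstanceAs (Finite (Fin 3 ⊕ Σ i, (c i).InnerEdge))

theorem card_inner (t : TernaryTree) : Nat.card t.Inner = t.size := by
  induction t with
  | leaf => exact Nat.card_of_isEmpty (α := Empty)
  | node c ih =>
    have h : Nat.card (node c).Inner = Nat.card (Option (Σ i, (c i).Inner)) := rfl
    rw [h, Finite.card_option, Nat.card_sigma]
    simp [ih, size, add_comm]

theorem card_dart (t : TernaryTree) : Nat.card t.Dart = 3 + 6 * t.size := by
  induction t with
  | leaf =>
    have h : Nat.card leaf.Dart = Nat.card (Fin 3) := rfl
    rw [h]; simp [size]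
  | node c ih =>
    have h : Nat.card (node c).Dart = Nat.card (Σ i, (c i).Dart) := rfl
    rw [h, Nat.card_sigma]
    simp only [ih, size, Fin.sum_univ_three]
    ring

theorem card_innerEdge (t : TernaryTree) : Nat.card t.InnerEdge = 3 * t.size := by
  induction t with
  | leaf => exact Nat.card_of_isEmpty (α := Empty)
  | node c ih =>
    have h : Nat.card (node c).InnerEdge = Nat.card (Fin 3 ⊕ Σ i, (c i).InnerEdge) := rfl
    rw [h, Nat.card_sum, Nat.card_sigma]
    simp only [ih, size, Fin.sum_univ_three, Nat.card_eq_fintype_card, Fintype.card_fin]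
    ring

@[simp] theorem next_node (c : Fin 3 → TernaryTree) (i : Fin 3) (d : (c i).Dart) :
    (node c).next ⟨i, d⟩ = ⟨i, (c i).next d⟩ := rfl

@[simp] theorem side_node (c : Fin 3 → TernaryTree) (i : Fin 3) :
    (node c).side i = ⟨i, (c i).side 0⟩ := rfl

@[simp] theorem org_node (c : Fin 3 → TernaryTree) (i : Fin 3) (d : (c i).Dart) :
    (node c).org ⟨i, d⟩ = embed c i ((c i).org d) := rfl

@[simp] theorem embed_zero (c : Fin 3 → TernaryTree) (i : Fin 3) :
    embed c i (Sum.inl 0) = Sum.inl i := rfl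

@[simp] theorem embed_one (c : Fin 3 → TernaryTree) (i : Fin 3) :
    embed c i (Sum.inl 1) = Sum.inl (i + 1) := rfl

/-- The four cases of reversal in a node. -/
theorem opp_node_zero {c : Fin 3 → TernaryTree} {i : Fin 3} {d : (c i).Dart}
    (h : (c i).opp d = Sum.inl 0) : (node c).opp ⟨i, d⟩ = Sum.inl i := by
  simp only [opp, h]

theorem opp_node_one {c : Fin 3 → TernaryTree} {i : Fin 3} {d : (c i).Dart}
    (h : (c i).opp d = Sum.inl 1) :
    (node c).opp ⟨i, d⟩ = Sum.inr ⟨i + 1, (c (i + 1)).side 2⟩ := by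
  simp only [opp, h]

theorem opp_node_two {c : Fin 3 → TernaryTree} {i : Fin 3} {d : (c i).Dart}
    (h : (c i).opp d = Sum.inl 2) :
    (node c).opp ⟨i, d⟩ = Sum.inr ⟨i + 2, (c (i + 2)).side 1⟩ := by
  simp only [opp, h]

theorem opp_node_inr {c : Fin 3 → TernaryTree} {i : Fin 3} {d d' : (c i).Dart}
    (h : (c i).opp d = Sum.inr d') : (node c).opp ⟨i, d⟩ = Sum.inr ⟨i, d'⟩ := by
  simp only [opp, h]

theorem edgeOf_node_zero {c : Fin 3 → TernaryTree} {i : Fin 3} {d : (c i).Dart}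
    (h : (c i).edgeOf d = Sum.inl 0) : (node c).edgeOf ⟨i, d⟩ = Sum.inl i := by
  simp only [edgeOf, h]

theorem edgeOf_node_one {c : Fin 3 → TernaryTree} {i : Fin 3} {d : (c i).Dart}
    (h : (c i).edgeOf d = Sum.inl 1) :
    (node c).edgeOf ⟨i, d⟩ = Sum.inr (Sum.inl (i + 1) : Fin 3 ⊕ Σ i, (c i).InnerEdge) := by
  simp only [edgeOf, h]
  rfl

theorem edgeOf_node_two {c : Fin 3 → TernaryTree} {i : Fin 3} {d : (c i).Dart}
    (h : (c i).edgeOf d = Sum.inl 2) :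
    (node c).edgeOf ⟨i, d⟩ = Sum.inr (Sum.inl i : Fin 3 ⊕ Σ i, (c i).InnerEdge) := by
  simp only [edgeOf, h]
  rfl

theorem edgeOf_node_inr {c : Fin 3 → TernaryTree} {i : Fin 3} {d : (c i).Dart}
    {e : (c i).InnerEdge} (h : (c i).edgeOf d = Sum.inr e) :
    (node c).edgeOf ⟨i, d⟩ = Sum.inr (Sum.inr ⟨i, e⟩ : Fin 3 ⊕ Σ i, (c i).InnerEdge) := by
  simp only [edgeOf, h]
  rfl

@[simp] theorem opp_side (t : TernaryTree) (i : Fin 3) : t.opp (t.side i) = Sum.inl i := by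
  induction t generalizing i with
  | leaf => rfl
  | node c ih => exact opp_node_zero (ih i 0)

@[simp] theorem org_side (t : TernaryTree) (i : Fin 3) : t.org (t.side i) = Sum.inl i := by
  induction t generalizing i with
  | leaf => rfl
  | node c ih => rw [side_node, org_node, ih, embed_zero]

@[simp] theorem org_next_side (t : TernaryTree) (i : Fin 3) :
    t.org (t.next (t.side i)) = Sum.inl (i + 1) := by
  induction t generalizing i with
  | leaf => rfl
  | node c ih => rw [side_node, next_node, org_node, ih, zero_add, embed_one]

@[simp] theorem edgeOf_side (t : TernaryTree) (i : Fin 3) : t.edgeOf (t.side i) = Sum.inl i := by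
  induction t generalizing i with
  | leaf => rfl
  | node c ih => exact edgeOf_node_zero (ih i 0)

/-- Case distinction on whether a dart is on the boundary, for `opp`. -/
theorem opp_cases (t : TernaryTree) (d : t.Dart) :
    (∃ i, t.opp d = Sum.inl i) ∨ ∃ d', t.opp d = Sum.inr d' := by
  rcases t.opp d with i | d'
  · exact Or.inl ⟨i, rfl⟩
  · exact Or.inr ⟨d', rfl⟩

theorem eq_side_of_opp {t : TernaryTree} {d : t.Dart} {i : Fin 3} (h : t.opp d = Sum.inl i) :
    d = t.side i := by
  induction t generalizing i with
  | leaf => exact Sum.inl.inj h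
  | node c ih =>
    obtain ⟨j, d⟩ := d
    rcases (c j).opp_cases d with ⟨k, hk⟩ | ⟨d', hd⟩
    · have hd := ih j hk
      fin_cases k
      · rw [opp_node_zero hk] at h
        cases h
        rw [side_node, hd]; rfl
      · rw [opp_node_one hk] at h; cases h
      · rw [opp_node_two hk] at h; cases h
    · rw [opp_node_inr hd] at h; cases h

theorem side_injective (t : TernaryTree) : Function.Injective t.side := fun i j h => by
  simpa using congrArg t.opp h

theorem opp_node_side_one (c : Fin 3 → TernaryTree) (i : Fin 3) :
    (node c).opp ⟨i, (c i).side 1⟩ = Sum.inr ⟨i + 1, (c (i + 1)).side 2⟩ :=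
  opp_node_one (opp_side _ _)

theorem opp_node_side_two (c : Fin 3 → TernaryTree) (i : Fin 3) :
    (node c).opp ⟨i, (c i).side 2⟩ = Sum.inr ⟨i + 2, (c (i + 2)).side 1⟩ :=
  opp_node_two (opp_side _ _)

theorem sigma_side_eq (c : Fin 3 → TernaryTree) {i j : Fin 3} (h : i = j) (k : Fin 3) :
    (⟨i, (c i).side k⟩ : Σ i, (c i).Dart) = ⟨j, (c j).side k⟩ := by subst h; rfl

theorem opp_opp {t : TernaryTree} {d d' : t.Dart} (h : t.opp d = Sum.inr d') :
    t.opp d' = Sum.inr d ∧ d' ≠ d := by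
  induction t with
  | leaf => cases h
  | node c ih =>
    obtain ⟨j, d⟩ := d
    rcases (c j).opp_cases d with ⟨k, hk⟩ | ⟨e, he⟩
    · obtain rfl := eq_side_of_opp hk
      fin_cases k
      · rw [opp_node_zero hk] at h; cases h
      · rw [opp_node_one hk] at h; cases h
        refine ⟨?_, fun h => ?_⟩
        · rw [opp_node_side_two]
          exact congrArg Sum.inr (sigma_side_eq c (by rw [add_assoc]; exact add_zero j) 1)
        · exact absurd (congrArg Sigma.fst h) ((by decide : ∀ j : Fin 3, j + 1 ≠ j) j)
      · rw [opp_node_two hk] at h; cases h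
        refine ⟨?_, fun h => ?_⟩
        · rw [opp_node_side_one]
          exact congrArg Sum.inr (sigma_side_eq c (by rw [add_assoc]; exact add_zero j) 2)
        · exact absurd (congrArg Sigma.fst h) ((by decide : ∀ j : Fin 3, j + 2 ≠ j) j)
    · rw [opp_node_inr he] at h; cases h
      obtain ⟨h1, h2⟩ := ih j he
      refine ⟨opp_node_inr h1, fun h => h2 ?_⟩
      exact eq_of_heq (Sigma.mk.inj_iff.1 h).2

theorem next_next_next (t : TernaryTree) (d : t.Dart) : t.next (t.next (t.next d)) = d := by
  induction t with
  | leaf => exact (by decide : ∀ i : Fin 3, i + 1 + 1 + 1 = i) d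
  | node c ih => obtain ⟨j, d⟩ := d; rw [next_node, next_node, next_node, ih]

theorem next_ne (t : TernaryTree) (d : t.Dart) : t.next d ≠ d := by
  induction t with
  | leaf => exact (by decide : ∀ i : Fin 3, i + 1 ≠ i) d
  | node c ih =>
    obtain ⟨j, d⟩ := d
    rw [next_node]
    intro h
    exact ih j d (eq_of_heq (Sigma.mk.inj_iff.1 h).2)

/-- Reversal exchanges the two ends of a dart, the end of `d` being the origin of `next d`. -/
theorem org_opp {t : TernaryTree} {d d' : t.Dart} (h : t.opp d = Sum.inr d') :
    t.org (t.next d') = t.org d ∧ t.org d' = t.org (t.next d) := by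
  induction t with
  | leaf => cases h
  | node c ih =>
    obtain ⟨j, d⟩ := d
    rcases (c j).opp_cases d with ⟨k, hk⟩ | ⟨e, he⟩
    · obtain rfl := eq_side_of_opp hk
      fin_cases k
      · rw [opp_node_zero hk] at h; cases h
      · rw [opp_node_one hk] at h; cases h
        simp only [next_node, org_node, org_side, org_next_side]
        exact ⟨rfl, rfl⟩
      · rw [opp_node_two hk] at h; cases h
        simp only [next_node, org_node, org_side, org_next_side]
        refine ⟨rfl, ?_⟩
        change Sum.inl (j + 2 + 1) = Sum.inl j
        rw [add_assoc]; exact congrArg Sum.inl (add_zero j)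
    · rw [opp_node_inr he] at h; cases h
      simp only [next_node, org_node, (ih j he).1, (ih j he).2, and_self]

theorem embed_injective (c : Fin 3 → TernaryTree) (i : Fin 3) : Function.Injective (embed c i) := by
  have key : ∀ k l : Fin 3, embed c i (Sum.inl k) = embed c i (Sum.inl l) → k = l := by
    intro k l h
    fin_cases k <;> fin_cases l <;> first
      | rfl
      | exact absurd h (by simp [embed])
  rintro (k | x) (l | y) h
  · rw [key k l h]
  · fin_cases k <;> cases h
  · fin_cases l <;> cases h
  · cases h; rfl

/-- A vertex of a node that is a corner is one of the first two corners of the child. -/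
theorem embed_eq_inl {c : Fin 3 → TernaryTree} {j m : Fin 3} {x : (c j).Vertex}
    (hx : embed c j x = Sum.inl m) : (x = Sum.inl 0 ∧ m = j) ∨ (x = Sum.inl 1 ∧ m = j + 1) := by
  rcases x with x | x
  · fin_cases x
    · cases hx; exact Or.inl ⟨rfl, rfl⟩
    · cases hx; exact Or.inr ⟨rfl, rfl⟩
    · cases hx
  · cases hx

theorem embed_eq_none {c : Fin 3 → TernaryTree} {j : Fin 3} {x : (c j).Vertex}
    (hx : embed c j x = Sum.inr (none : Option _)) : x = Sum.inl 2 := by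
  rcases x with x | x
  · fin_cases x
    · cases hx
    · cases hx
    · rfl
  · cases hx

theorem embed_eq_some {c : Fin 3 → TernaryTree} {j k : Fin 3} {x : (c j).Vertex}
    {y : (c k).Inner} (hx : embed c j x = Sum.inr (some ⟨k, y⟩ : Option _)) : j = k := by
  rcases x with x | x
  · fin_cases x <;> cases hx
  · cases hx; rfl

/-- A dart from a corner to a corner is one of the three sides. -/
theorem eq_side_of_org {t : TernaryTree} {d : t.Dart} {k l : Fin 3} (h : t.org d = Sum.inl k)
    (h' : t.org (t.next d) = Sum.inl l) : l = k + 1 ∧ d = t.side k := by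
  induction t generalizing k l with
  | leaf => cases h; cases h'; exact ⟨rfl, rfl⟩
  | node c ih =>
    obtain ⟨j, d⟩ := d
    rw [next_node, org_node] at h'
    rw [org_node] at h
    rcases embed_eq_inl h with ⟨h1, rfl⟩ | ⟨h1, rfl⟩ <;>
    rcases embed_eq_inl h' with ⟨h2, rfl⟩ | ⟨h2, rfl⟩
    · exact absurd (ih _ h1 h2).1 (by decide)
    · exact ⟨rfl, by rw [(ih _ h1 h2).2]; rfl⟩
    · exact absurd (ih _ h1 h2).1 (by decide)
    · exact absurd (ih _ h1 h2).1 (by decide)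

/-- A set of darts that contains a side and is closed under the moves inside the triangle contains
all darts. -/
theorem mem_of_closed {t : TernaryTree} {S : Set t.Dart} {i : Fin 3} (hi : t.side i ∈ S)
    (hnext : ∀ d ∈ S, t.next d ∈ S) (hopp : ∀ d ∈ S, ∀ d', t.opp d = Sum.inr d' → d' ∈ S)
    (d : t.Dart) : d ∈ S := by
  induction t generalizing i with
  | leaf =>
    have h1 : (i + 1 : Fin 3) ∈ S := hnext _ hi
    have h2 : (i + 1 + 1 : Fin 3) ∈ S := hnext _ h1
    rcases (by decide : ∀ i d : Fin 3, d = i ∨ d = i + 1 ∨ d = i + 1 + 1) i d with h | h | h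
    · exact h ▸ hi
    · exact h ▸ h1
    · exact h ▸ h2
  | node c ih =>
    have child : ∀ j k, (⟨j, (c j).side k⟩ : Σ i, (c i).Dart) ∈ S →
        ∀ d : (c j).Dart, (⟨j, d⟩ : Σ i, (c i).Dart) ∈ S := by
      intro j k hk d
      refine ih j (S := {d | (⟨j, d⟩ : Σ i, (c i).Dart) ∈ S}) hk
        (fun d hd => hnext _ hd) (fun d hd d' h => hopp _ hd _ (opp_node_inr h)) d
    have h0 := child i 0 hi
    have h1 := child (i + 1) 2 (hopp _ (h0 _) _ (opp_node_side_one c i))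
    have h2 := child (i + 1 + 1) 2 (hopp _ (h1 _) _ (opp_node_side_one c (i + 1)))
    obtain ⟨j, d⟩ := d
    rcases (by decide : ∀ i d : Fin 3, d = i ∨ d = i + 1 ∨ d = i + 1 + 1) i j with h | h | h
    · subst h; exact h0 d
    · subst h; exact h1 d
    · subst h; exact h2 d

/-- One step of the rotation around the origin of a dart, inside the triangle. -/
def Turn (t : TernaryTree) (a b : t.Dart) : Prop := ∃ a', t.opp a = Sum.inr a' ∧ t.next a' = b

/-- Darts that are linked by rotating around their origin without leaving the triangle. -/
def Linked (t : TernaryTree) : t.Dart → t.Dart → Prop := Relation.EqvGen t.Turn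

theorem Linked.node {c : Fin 3 → TernaryTree} {i : Fin 3} {a b : (c i).Dart}
    (h : (c i).Linked a b) : (TernaryTree.node c).Linked ⟨i, a⟩ ⟨i, b⟩ := by
  induction h with
  | rel a b h =>
    obtain ⟨a', h1, rfl⟩ := h
    exact Relation.EqvGen.rel _ _ ⟨_, opp_node_inr h1, rfl⟩
  | refl => exact Relation.EqvGen.refl _
  | symm _ _ _ ih => exact ih.symm
  | trans _ _ _ _ _ ih1 ih2 => exact ih1.trans _ _ _ ih2

theorem Linked.org_eq {t : TernaryTree} {d d' : t.Dart} (h : t.Linked d d') :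
    t.org d = t.org d' := by
  induction h with
  | rel a b h => obtain ⟨a', h1, rfl⟩ := h; exact (org_opp h1).1.symm
  | refl => rfl
  | symm _ _ _ ih => exact ih.symm
  | trans _ _ _ _ _ ih1 ih2 => exact ih1.trans ih2

/-- The converse of `Linked.org_eq`: the darts around a vertex form a single fan. -/
theorem linked_of_org_eq {t : TernaryTree} {d d' : t.Dart} (h : t.org d = t.org d') :
    t.Linked d d' := by
  induction t with
  | leaf => cases h; exact Relation.EqvGen.refl _
  | node c ih =>
    have corner : ∀ j (d : (c j).Dart) i, (node c).org ⟨j, d⟩ = Sum.inl i →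
        (node c).Linked ⟨j, d⟩ ((node c).side i) := by
      intro j d i h
      rcases embed_eq_inl h with ⟨h1, rfl⟩ | ⟨h1, rfl⟩
      · exact (ih _ (h1.trans (org_side _ 0).symm)).node
      · refine (ih _ (h1.trans (org_side _ 1).symm)).node.trans _ _ _ ?_
        refine (Relation.EqvGen.rel _ _ ⟨_, opp_node_side_one c j, rfl⟩).trans _ _ _ ?_
        exact (ih (j + 1) ((org_next_side _ 2).trans (org_side _ 0).symm)).node
    have step : ∀ j, (node c).Linked ⟨j, (c j).side 2⟩ ⟨j + 2, (c (j + 2)).side 2⟩ := fun j =>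
      (Relation.EqvGen.rel _ _ ⟨_, opp_node_side_two c j, rfl⟩).trans _ _ _
        (ih (j + 2) ((org_next_side _ 1).trans (org_side _ 2).symm)).node
    have centre : ∀ j (d : (c j).Dart), (node c).org ⟨j, d⟩ = Sum.inr (none : Option _) →
        (node c).Linked ⟨j, d⟩ ⟨0, (c 0).side 2⟩ := by
      intro j d h
      have h1 := embed_eq_none h
      refine (ih _ (h1.trans (org_side _ 2).symm)).node.trans _ _ _ ?_
      fin_cases j
      · exact Relation.EqvGen.refl _
      · exact (step 1)
      · exact (step 2).trans _ _ _ (step 1)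
    obtain ⟨j, d⟩ := d
    obtain ⟨k, d'⟩ := d'
    rcases hx : (node c).org ⟨j, d⟩ with i | (_ | ⟨i, y⟩)
    · exact (corner j d i hx).trans _ _ _ (corner k d' i (h ▸ hx)).symm
    · exact (centre j d hx).trans _ _ _ (centre k d' (h ▸ hx)).symm
    · obtain rfl := embed_eq_some hx
      obtain rfl := embed_eq_some (h ▸ hx : embed c k _ = _)
      exact (ih _ (embed_injective c _ h)).node

end TernaryTree

namespace TernaryTree

theorem org_surjective (t : TernaryTree) : Function.Surjective t.org := by
  rintro (i | x)
  · exact ⟨t.side i, org_side t i⟩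
  · induction t with
    | leaf => exact nomatch (x : Empty)
    | node c ih =>
      rcases x with _ | ⟨i, x⟩
      · exact ⟨⟨0, (c 0).side 2⟩, by rw [org_node, org_side]; rfl⟩
      · obtain ⟨d, hd⟩ := ih i x
        exact ⟨⟨i, d⟩, by rw [org_node, hd]; rfl⟩

theorem edgeOf_surjective (t : TernaryTree) : Function.Surjective t.edgeOf := by
  rintro (i | x)
  · exact ⟨t.side i, edgeOf_side t i⟩
  · induction t with
    | leaf => exact nomatch (x : Empty)
    | node c ih =>
      rcases x with j | ⟨i, x⟩
      · exact ⟨⟨j, (c j).side 2⟩, edgeOf_node_two (edgeOf_side _ _)⟩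
      · obtain ⟨d, hd⟩ := ih i x
        exact ⟨⟨i, d⟩, edgeOf_node_inr hd⟩

theorem eq_side_of_edgeOf {t : TernaryTree} {d : t.Dart} {i : Fin 3}
    (h : t.edgeOf d = Sum.inl i) : d = t.side i := by
  induction t generalizing i with
  | leaf => exact Sum.inl.inj h
  | node c ih =>
    obtain ⟨j, d⟩ := d
    rcases hd : (c j).edgeOf d with k | e
    · have hd' := ih j hd
      fin_cases k
      · rw [edgeOf_node_zero hd] at h; cases h; rw [side_node, hd']; rfl
      · rw [edgeOf_node_one hd] at h; cases h
      · rw [edgeOf_node_two hd] at h; cases h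
    · rw [edgeOf_node_inr hd] at h; cases h

theorem edgeOf_opp {t : TernaryTree} {d d' : t.Dart} (h : t.opp d = Sum.inr d') :
    t.edgeOf d' = t.edgeOf d := by
  induction t with
  | leaf => cases h
  | node c ih =>
    obtain ⟨j, d⟩ := d
    rcases (c j).opp_cases d with ⟨k, hk⟩ | ⟨e, he⟩
    · obtain rfl := eq_side_of_opp hk
      fin_cases k
      · rw [opp_node_zero hk] at h; cases h
      · rw [opp_node_one hk] at h; cases h
        exact (edgeOf_node_two (edgeOf_side _ _)).trans (edgeOf_node_one (edgeOf_side _ _)).symm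
      · rw [opp_node_two hk] at h; cases h
        rw [edgeOf_node_one (edgeOf_side _ _)]
        refine Eq.trans ?_ (edgeOf_node_two (edgeOf_side _ _)).symm
        rw [add_assoc]; exact congrArg (fun i => Sum.inr (Sum.inl i)) (add_zero j)
    · rw [opp_node_inr he] at h; cases h
      have := ih j he
      rcases hd : (c j).edgeOf d with k | e'
      · obtain rfl := eq_side_of_edgeOf hd
        rw [opp_side] at he; cases he
      · rw [edgeOf_node_inr hd, edgeOf_node_inr (this.trans hd)]

/-- Two darts have the same edge only if they agree or are reverses of each other. -/
theorem eq_or_opp_of_edgeOf_eq {t : TernaryTree} {d d' : t.Dart} (h : t.edgeOf d = t.edgeOf d') :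
    d = d' ∨ t.opp d = Sum.inr d' := by
  induction t with
  | leaf => exact Or.inl (Sum.inl.inj h)
  | node c ih =>
    obtain ⟨j, d⟩ := d
    obtain ⟨j', d'⟩ := d'
    rcases hd : (c j).edgeOf d with k | e <;> rcases hd' : (c j').edgeOf d' with k' | e'
    · obtain rfl := eq_side_of_edgeOf hd
      obtain rfl := eq_side_of_edgeOf hd'
      fin_cases k <;> fin_cases k' <;>
        simp only [edgeOf, edgeOf_side] at h
      · cases h; exact Or.inl rfl
      · cases h
      · cases h
      · cases h
      · obtain rfl : j = j' := add_right_cancel (Sum.inl.inj (Sum.inr.inj h))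
        exact Or.inl rfl
      · obtain rfl : j + 1 = j' := Sum.inl.inj (Sum.inr.inj h)
        exact Or.inr (opp_node_side_one c j)
      · cases h
      · obtain rfl : j = j' + 1 := Sum.inl.inj (Sum.inr.inj h)
        exact Or.inr (opp_opp (opp_node_side_one c j')).1
      · obtain rfl : j = j' := Sum.inl.inj (Sum.inr.inj h)
        exact Or.inl rfl
    · rw [edgeOf_node_inr hd'] at h
      fin_cases k
      · rw [edgeOf_node_zero hd] at h; cases h
      · rw [edgeOf_node_one hd] at h; cases h
      · rw [edgeOf_node_two hd] at h; cases h
    · rw [edgeOf_node_inr hd] at h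
      fin_cases k'
      · rw [edgeOf_node_zero hd'] at h; cases h
      · rw [edgeOf_node_one hd'] at h; cases h
      · rw [edgeOf_node_two hd'] at h; cases h
    · rw [edgeOf_node_inr hd, edgeOf_node_inr hd'] at h
      cases h
      rcases ih j (hd.trans hd'.symm) with h | h
      · exact Or.inl (by rw [h])
      · exact Or.inr (opp_node_inr h)

theorem ends_spoke (c : Fin 3 → TernaryTree) (i : Fin 3) :
    (node c).ends (Sum.inl i : Fin 3 ⊕ Σ i, (c i).InnerEdge) =
      (Sum.inl i, Sum.inr (none : Option _)) := by
  simp only [ends]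
  rfl

theorem ends_inr (c : Fin 3 → TernaryTree) (i : Fin 3) (e : (c i).InnerEdge) :
    (node c).ends (Sum.inr ⟨i, e⟩ : Fin 3 ⊕ Σ i, (c i).InnerEdge) =
      (embed c i ((c i).ends e).1, embed c i ((c i).ends e).2) := by
  simp only [ends]

/-- The ends of the edge of a dart are the origins of the dart and of its successor. -/
theorem ends_edgeOf {t : TernaryTree} {d : t.Dart} {e : t.InnerEdge} (h : t.edgeOf d = Sum.inr e) :
    t.ends e = (t.org d, t.org (t.next d)) ∨ t.ends e = (t.org (t.next d), t.org d) := by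
  induction t with
  | leaf => cases h
  | node c ih =>
    obtain ⟨j, d⟩ := d
    rcases hd : (c j).edgeOf d with k | e'
    · obtain rfl := eq_side_of_edgeOf hd
      fin_cases k
      · rw [edgeOf_node_zero hd] at h; cases h
      · rw [edgeOf_node_one hd] at h; cases h
        left
        simp only [next_node, org_node, org_side, org_next_side]
        exact ends_spoke c (j + 1)
      · rw [edgeOf_node_two hd] at h; cases h
        right
        simp only [next_node, org_node, org_side, org_next_side]
        exact ends_spoke c j
    · rw [edgeOf_node_inr hd] at h; cases h
      rcases ih j hd with h | h
      · exact Or.inl (by rw [ends_inr, next_node, org_node, org_node, h])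
      · exact Or.inr (by rw [ends_inr, next_node, org_node, org_node, h])

end TernaryTree

/-! ### Gluing two subdivided triangles along their boundaries -/

namespace CombMap

/-- An isomorphism of combinatorial maps. -/
structure Hom {D D' : Type} (M : CombMap D) (M' : CombMap D') (e : D ≃ D') : Prop where
  rev : ∀ d, e (M.rev d) = M'.rev (e d)
  next : ∀ d, e (M.next d) = M'.next (e d)

end CombMap

namespace TernaryTree

/-- Reversal in the glued map: side `i` of the first triangle is side `-i` of the second one. -/
def glueRev (s t : TernaryTree) : s.Dart ⊕ t.Dart → s.Dart ⊕ t.Dart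
  | Sum.inl d => Sum.elim (fun i => Sum.inr (t.side (-i))) Sum.inl (s.opp d)
  | Sum.inr d => Sum.elim (fun i => Sum.inl (s.side (-i))) Sum.inr (t.opp d)

theorem glueRev_glueRev (s t : TernaryTree) (d : s.Dart ⊕ t.Dart) :
    glueRev s t (glueRev s t d) = d ∧ glueRev s t d ≠ d := by
  rcases d with d | d
  · rcases s.opp_cases d with ⟨i, h⟩ | ⟨d', h⟩
    · simp [glueRev, h, ← eq_side_of_opp h]
    · simp [glueRev, h, (opp_opp h).1, (opp_opp h).2]
  · rcases t.opp_cases d with ⟨i, h⟩ | ⟨d', h⟩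
    · simp [glueRev, h, ← eq_side_of_opp h]
    · simp [glueRev, h, (opp_opp h).1, (opp_opp h).2]

/-- The triangulation of the sphere obtained by gluing two subdivided triangles along their
boundaries. -/
def glue (s t : TernaryTree) : CombMap (s.Dart ⊕ t.Dart) where
  rev := (glueRev_glueRev s t · |>.1) |> Function.Involutive.toPerm _
  next := Equiv.sumCongr s.next t.next
  rev_rev d := (glueRev_glueRev s t d).1
  rev_ne d := (glueRev_glueRev s t d).2

theorem glue_rev (s t : TernaryTree) (d) : (glue s t).rev d = glueRev s t d := rfl

@[simp] theorem glue_next_inr (s t : TernaryTree) (d) :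
    (glue s t).next (Sum.inr d) = Sum.inr (t.next d) := rfl

theorem glue_rev_inl (s t : TernaryTree) {d d'} (h : s.opp d = Sum.inr d') :
    (glue s t).rev (Sum.inl d) = Sum.inl d' := by simp [glue_rev, glueRev, h]

theorem glue_rev_inr (s t : TernaryTree) {d d'} (h : t.opp d = Sum.inr d') :
    (glue s t).rev (Sum.inr d) = Sum.inr d' := by simp [glue_rev, glueRev, h]

@[simp] theorem glue_rev_side_left (s t : TernaryTree) (i : Fin 3) :
    (glue s t).rev (Sum.inl (s.side i)) = Sum.inr (t.side (-i)) := by simp [glue_rev, glueRev]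

@[simp] theorem glue_rev_side_right (s t : TernaryTree) (i : Fin 3) :
    (glue s t).rev (Sum.inr (t.side i)) = Sum.inl (s.side (-i)) := by simp [glue_rev, glueRev]

end TernaryTree

namespace CombMap

variable {D D' D'' : Type} {M : CombMap D} {M' : CombMap D'} {M'' : CombMap D''}

theorem Hom.symm {e : D ≃ D'} (h : Hom M M' e) : Hom M' M e.symm :=
  ⟨fun d => by rw [Equiv.symm_apply_eq, h.rev, Equiv.apply_symm_apply],
    fun d => by rw [Equiv.symm_apply_eq, h.next, Equiv.apply_symm_apply]⟩

theorem Hom.trans {e : D ≃ D'} {e' : D' ≃ D''} (h : Hom M M' e) (h' : Hom M' M'' e') :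
    Hom M M'' (e.trans e') :=
  ⟨fun d => by simp only [Equiv.trans_apply, h.rev, h'.rev],
    fun d => by simp only [Equiv.trans_apply, h.next, h'.next]⟩

end CombMap

namespace TernaryTree

/-- Exchanging the two sides of the glued map. -/
theorem hom_swap (s t : TernaryTree) : CombMap.Hom (glue s t) (glue t s) (Equiv.sumComm _ _) where
  rev := by
    rintro (d | d)
    · rcases s.opp_cases d with ⟨i, h⟩ | ⟨d', h⟩ <;> simp [glue_rev, glueRev, h]
    · rcases t.opp_cases d with ⟨i, h⟩ | ⟨d', h⟩ <;> simp [glue_rev, glueRev, h]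
  next := by rintro (d | d) <;> rfl

/-- Rotation of a subdivided triangle: the corner `i + k` becomes the corner `i`. -/
def rotate (k : Fin 3) : TernaryTree → TernaryTree
  | leaf => leaf
  | node c => node fun i => c (i + k)

/-- The darts of the rotated triangle. -/
def rotateDart (k : Fin 3) : ∀ t : TernaryTree, (rotate k t).Dart ≃ t.Dart
  | leaf => (Equiv.addRight k : Fin 3 ≃ Fin 3)
  | node c => ((Equiv.addRight k).sigmaCongrLeft (β := fun i => (c i).Dart) :
      (Σ i, (c (i + k)).Dart) ≃ Σ i, (c i).Dart)

theorem rotateDart_node (k : Fin 3) (c : Fin 3 → TernaryTree) (i : Fin 3) (d : (c (i + k)).Dart) :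
    rotateDart k (node c) ⟨i, d⟩ = ⟨i + k, d⟩ := rfl

theorem rotateDart_next (k : Fin 3) (t : TernaryTree) (d : (rotate k t).Dart) :
    rotateDart k t ((rotate k t).next d) = t.next (rotateDart k t d) := by
  cases t with
  | leaf => exact (by decide : ∀ d k : Fin 3, d + 1 + k = d + k + 1) d k
  | node c => rfl

theorem rotateDart_side (k : Fin 3) (t : TernaryTree) (i : Fin 3) :
    rotateDart k t ((rotate k t).side i) = t.side (i + k) := by
  cases t with
  | leaf => rfl
  | node c => rfl

theorem rotateDart_opp (k : Fin 3) (t : TernaryTree) (d : (rotate k t).Dart) :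
    t.opp (rotateDart k t d) = ((rotate k t).opp d).map (· + k) (rotateDart k t) := by
  cases t with
  | leaf => rfl
  | node c =>
    obtain ⟨j, d⟩ := d
    rw [rotateDart_node]
    rcases (c (j + k)).opp_cases d with ⟨i, h⟩ | ⟨d', h⟩
    · obtain rfl := eq_side_of_opp h
      have hd : (rotate k (node c)).Dart = (node fun i => c (i + k)).Dart := rfl
      change _ = ((node fun i => c (i + k)).opp ⟨j, _⟩).map _ _
      fin_cases i
      · rw [opp_node_zero h, opp_node_zero (c := fun i => c (i + k)) h]; rfl
      · rw [opp_node_one h, opp_node_one (c := fun i => c (i + k)) h]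
        exact congrArg Sum.inr (sigma_side_eq c (add_right_comm j k 1) 2)
      · rw [opp_node_two h, opp_node_two (c := fun i => c (i + k)) h]
        exact congrArg Sum.inr (sigma_side_eq c (add_right_comm j k 2) 1)
    · change _ = ((node fun i => c (i + k)).opp ⟨j, _⟩).map _ _
      rw [opp_node_inr h, opp_node_inr (c := fun i => c (i + k)) h]; rfl

/-- Rotating both sides of the glued map in opposite directions does not change it. -/
theorem hom_rotate (k : Fin 3) (s t : TernaryTree) :
    CombMap.Hom (glue (rotate k s) (rotate (-k) t)) (glue s t)
      (Equiv.sumCongr (rotateDart k s) (rotateDart (-k) t)) where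
  rev := by
    rintro (d | d)
    · rcases (rotate k s).opp_cases d with ⟨i, h⟩ | ⟨d', h⟩ <;>
        simp [glue_rev, glueRev, h, rotateDart_opp, rotateDart_side, add_comm]
    · rcases (rotate (-k) t).opp_cases d with ⟨i, h⟩ | ⟨d', h⟩ <;>
        simp [glue_rev, glueRev, h, rotateDart_opp, rotateDart_side, add_comm]
  next := by
    rintro (d | d)
    · exact congrArg Sum.inl (rotateDart_next k s d)
    · exact congrArg Sum.inr (rotateDart_next (-k) t d)

/-- The children of the node that surrounds the first child of `node c` in `glue (node c) t`. -/
def shiftChildren (c : Fin 3 → TernaryTree) (t : TernaryTree) : Fin 3 → TernaryTree :=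
  ![t, rotate 1 (c 2), rotate 2 (c 1)]

/-- The map `glue (node c) t` is glued from four subdivided triangles arranged as the faces of a
tetrahedron, the new vertex being its apex; this regroups them around the first child of `c`. -/
def shiftDart (c : Fin 3 → TernaryTree) (t : TernaryTree) :
    (node c).Dart ⊕ t.Dart ≃ (c 0).Dart ⊕ (node (shiftChildren c t)).Dart where
  toFun
    | Sum.inl ⟨0, d⟩ => Sum.inl d
    | Sum.inl ⟨1, d⟩ => Sum.inr ⟨2, (rotateDart 2 (c 1)).symm d⟩
    | Sum.inl ⟨2, d⟩ => Sum.inr ⟨1, (rotateDart 1 (c 2)).symm d⟩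
    | Sum.inr d => Sum.inr ⟨0, d⟩
  invFun
    | Sum.inl d => Sum.inl ⟨0, d⟩
    | Sum.inr ⟨0, d⟩ => Sum.inr d
    | Sum.inr ⟨1, d⟩ => Sum.inl ⟨2, rotateDart 1 (c 2) d⟩
    | Sum.inr ⟨2, d⟩ => Sum.inl ⟨1, rotateDart 2 (c 1) d⟩
  left_inv := by
    rintro (⟨i, d⟩ | d)
    · fin_cases i
      · rfl
      · exact congrArg (fun d => Sum.inl (⟨1, d⟩ : Σ i, (c i).Dart)) (Equiv.apply_symm_apply _ d)
      · exact congrArg (fun d => Sum.inl (⟨2, d⟩ : Σ i, (c i).Dart)) (Equiv.apply_symm_apply _ d)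
    · rfl
  right_inv := by
    rintro (d | ⟨i, d⟩)
    · rfl
    · fin_cases i
      · rfl
      · exact congrArg (fun d => Sum.inr (⟨1, d⟩ : Σ i, (shiftChildren c t i).Dart))
          (Equiv.symm_apply_apply _ d)
      · exact congrArg (fun d => Sum.inr (⟨2, d⟩ : Σ i, (shiftChildren c t i).Dart))
          (Equiv.symm_apply_apply _ d)

end TernaryTree

namespace TernaryTree

theorem rotateDart_symm_side (k : Fin 3) (t : TernaryTree) (i : Fin 3) :
    (rotateDart k t).symm (t.side i) = (rotate k t).side (i - k) := by
  rw [Equiv.symm_apply_eq, rotateDart_side, sub_add_cancel]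

theorem rotateDart_symm_next (k : Fin 3) (t : TernaryTree) (d : t.Dart) :
    (rotateDart k t).symm (t.next d) = (rotate k t).next ((rotateDart k t).symm d) := by
  rw [Equiv.symm_apply_eq, rotateDart_next, Equiv.apply_symm_apply]

theorem rotateDart_symm_opp {k : Fin 3} {t : TernaryTree} {d d' : t.Dart}
    (h : t.opp d = Sum.inr d') :
    (rotate k t).opp ((rotateDart k t).symm d) = Sum.inr ((rotateDart k t).symm d') := by
  have := rotateDart_opp k t ((rotateDart k t).symm d)
  rw [Equiv.apply_symm_apply, h] at this
  rcases (rotate k t).opp_cases ((rotateDart k t).symm d) with ⟨i, h'⟩ | ⟨e, h'⟩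
  · rw [h'] at this; cases this
  · rw [h'] at this ⊢
    rw [Sum.inr.inj this, Equiv.symm_apply_apply]

theorem hom_shift (c : Fin 3 → TernaryTree) (t : TernaryTree) :
    CombMap.Hom (glue (node c) t) (glue (c 0) (node (shiftChildren c t))) (shiftDart c t) where
  next := by
    rintro (⟨i, d⟩ | d)
    · fin_cases i
      · rfl
      · exact congrArg (fun d => Sum.inr (⟨2, d⟩ : Σ i, (shiftChildren c t i).Dart))
          (rotateDart_symm_next _ _ _)
      · exact congrArg (fun d => Sum.inr (⟨1, d⟩ : Σ i, (shiftChildren c t i).Dart))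
          (rotateDart_symm_next _ _ _)
    · rfl
  rev := by
    have e1 : ∀ i, shiftDart c t (Sum.inl ⟨1, (c 1).side i⟩) =
        Sum.inr ⟨2, (shiftChildren c t 2).side (i - 2)⟩ := fun i =>
      congrArg (fun d => Sum.inr (⟨2, d⟩ : Σ i, (shiftChildren c t i).Dart))
        (rotateDart_symm_side 2 (c 1) i)
    have e2 : ∀ i, shiftDart c t (Sum.inl ⟨2, (c 2).side i⟩) =
        Sum.inr ⟨1, (shiftChildren c t 1).side (i - 1)⟩ := fun i =>
      congrArg (fun d => Sum.inr (⟨1, d⟩ : Σ i, (shiftChildren c t i).Dart))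
        (rotateDart_symm_side 1 (c 2) i)
    have e0 : ∀ d, shiftDart c t (Sum.inl ⟨0, d⟩) = Sum.inl d := fun _ => rfl
    have e3 : ∀ d, shiftDart c t (Sum.inr d) = Sum.inr ⟨0, d⟩ := fun _ => rfl
    have out : ∀ i, (glue (node c) t).rev (Sum.inl ⟨i, (c i).side 0⟩) = Sum.inr (t.side (-i)) :=
      fun i => glue_rev_side_left (node c) t i
    have spoke : ∀ i, (glue (node c) t).rev (Sum.inl ⟨i, (c i).side 1⟩) =
        Sum.inl ⟨i + 1, (c (i + 1)).side 2⟩ := fun i => glue_rev_inl _ _ (opp_node_side_one c i)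
    have spoke' : ∀ i, (glue (node c) t).rev (Sum.inl ⟨i, (c i).side 2⟩) =
        Sum.inl ⟨i + 2, (c (i + 2)).side 1⟩ := fun i => glue_rev_inl _ _ (opp_node_side_two c i)
    have left : ∀ i, (glue (c 0) (node (shiftChildren c t))).rev (Sum.inl ((c 0).side i)) =
        Sum.inr ⟨-i, (shiftChildren c t (-i)).side 0⟩ := fun i => glue_rev_side_left _ _ i
    have right0 : ∀ i, (glue (c 0) (node (shiftChildren c t))).rev
        (Sum.inr ⟨i, (shiftChildren c t i).side 0⟩) = Sum.inl ((c 0).side (-i)) :=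
      fun i => glue_rev_side_right _ (node (shiftChildren c t)) i
    have right1 : ∀ i, (glue (c 0) (node (shiftChildren c t))).rev
        (Sum.inr ⟨i, (shiftChildren c t i).side 1⟩) =
          Sum.inr ⟨i + 1, (shiftChildren c t (i + 1)).side 2⟩ :=
      fun i => glue_rev_inr _ _ (opp_node_side_one _ i)
    have right2 : ∀ i, (glue (c 0) (node (shiftChildren c t))).rev
        (Sum.inr ⟨i, (shiftChildren c t i).side 2⟩) =
          Sum.inr ⟨i + 2, (shiftChildren c t (i + 2)).side 1⟩ :=
      fun i => glue_rev_inr _ _ (opp_node_side_two _ i)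
    rintro (⟨i, d⟩ | d)
    · rcases (c i).opp_cases d with ⟨k, h⟩ | ⟨d', h⟩
      · obtain rfl := eq_side_of_opp h
        fin_cases i <;> fin_cases k
        · exact (congrArg _ (out 0)).trans (left 0).symm
        · exact ((congrArg _ (spoke 0)).trans (e1 2)).trans (left 1).symm
        · exact ((congrArg _ (spoke' 0)).trans (e2 1)).trans (left 2).symm
        · exact (congrArg _ (out 1)).trans ((congrArg _ (e1 0)).trans (right1 2)).symm
        · exact ((congrArg _ (spoke 1)).trans (e2 2)).trans
            ((congrArg _ (e1 1)).trans (right2 2)).symm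
        · exact (congrArg _ (spoke' 1)).trans ((congrArg _ (e1 2)).trans (right0 2)).symm
        · exact (congrArg _ (out 2)).trans ((congrArg _ (e2 0)).trans (right2 1)).symm
        · exact (congrArg _ (spoke 2)).trans ((congrArg _ (e2 1)).trans (right0 1)).symm
        · exact ((congrArg _ (spoke' 2)).trans (e1 1)).trans
            ((congrArg _ (e2 2)).trans (right1 1)).symm
      · rw [glue_rev_inl _ _ (opp_node_inr h)]
        fin_cases i
        · exact (glue_rev_inl _ _ h).symm
        · exact (glue_rev_inr _ _ (opp_node_inr (c := shiftChildren c t) (i := 2)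
            (rotateDart_symm_opp h))).symm
        · exact (glue_rev_inr _ _ (opp_node_inr (c := shiftChildren c t) (i := 1)
            (rotateDart_symm_opp h))).symm
    · rcases t.opp_cases d with ⟨k, h⟩ | ⟨d', h⟩
      · obtain rfl := eq_side_of_opp h
        rw [glue_rev_side_right, e3]
        fin_cases k
        · exact (right0 0).symm
        · exact (e2 0).trans (right1 0).symm
        · exact (e1 0).trans (right2 0).symm
      · rw [glue_rev_inr _ _ h, e3, e3]
        exact (glue_rev_inr _ _ (opp_node_inr (c := shiftChildren c t) (i := 0) h)).symm

/-! ### Every rooted Apollonian triangulation comes from a ternary tree -/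

/-- Any dart of a glued map may be taken as the root of a map with one undivided side. -/
theorem exists_hom_glue_leaf (s t : TernaryTree) (d : s.Dart) :
    ∃ (u : TernaryTree) (e : s.Dart ⊕ t.Dart ≃ leaf.Dart ⊕ u.Dart),
      CombMap.Hom (glue s t) (glue leaf u) e ∧ e (Sum.inl d) = Sum.inl (leaf.side 0) := by
  induction s generalizing t with
  | leaf =>
    let k : Fin 3 := d
    refine ⟨rotate (-k) t, _, (hom_rotate k leaf t).symm, ?_⟩
    refine (Equiv.symm_apply_eq _).2 ?_
    exact congrArg Sum.inl (zero_add k).symm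
  | node c ih =>
    obtain ⟨i, d⟩ := d
    obtain ⟨⟨j, d'⟩, h⟩ := (rotateDart i (node c)).surjective ⟨i, d⟩
    rw [rotateDart_node] at h
    obtain rfl : j = 0 := by simpa using congrArg Sigma.fst h
    obtain ⟨u, e, he, hr⟩ := ih (0 + i)
      (node (shiftChildren (fun j => c (j + i)) (rotate (-i) t))) d'
    refine ⟨u, _, ((hom_rotate i (node c) t).symm.trans (hom_shift _ _)).trans he, ?_⟩
    have : (Equiv.sumCongr (rotateDart i (node c)) (rotateDart (-i) t)).symm (Sum.inl ⟨i, d⟩)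
        = Sum.inl (⟨0, d'⟩ : Σ j, (c (j + i)).Dart) :=
      (Equiv.symm_apply_eq _).2 (congrArg Sum.inl h.symm)
    exact (congrArg (fun x => e (shiftDart (fun j => c (j + i)) (rotate (-i) t) x)) this).trans hr

/-- The darts created by a star division of the undivided side. -/
def starDart (t : TernaryTree) :
    (leaf.Dart ⊕ t.Dart) ⊕ (Fin 3 × Bool) ≃ (node fun _ => leaf).Dart ⊕ t.Dart where
  toFun
    | Sum.inl (Sum.inl i) => Sum.inl ⟨i, (0 : Fin 3)⟩
    | Sum.inl (Sum.inr d) => Sum.inr d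
    | Sum.inr (i, true) => Sum.inl ⟨i - 1, (1 : Fin 3)⟩
    | Sum.inr (i, false) => Sum.inl ⟨i, (2 : Fin 3)⟩
  invFun
    | Sum.inl ⟨i, (0 : Fin 3)⟩ => Sum.inl (Sum.inl i)
    | Sum.inl ⟨i, (1 : Fin 3)⟩ => Sum.inr (i + 1, true)
    | Sum.inl ⟨i, (2 : Fin 3)⟩ => Sum.inr (i, false)
    | Sum.inr d => Sum.inl (Sum.inr d)
  left_inv := by
    rintro ((i | d) | ⟨i, b⟩)
    · rfl
    · rfl
    · cases b
      · rfl
      · simp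
  right_inv := by
    rintro (⟨i, (d : Fin 3)⟩ | d)
    · fin_cases d
      · rfl
      · simp
      · rfl
    · rfl

theorem isStarDivision_glue (t : TernaryTree) :
    ∃ e : (leaf.Dart ⊕ t.Dart) ⊕ (Fin 3 × Bool) ≃ (node fun _ => leaf).Dart ⊕ t.Dart,
    (∀ d, (glue (node fun _ => leaf) t).rev (e (Sum.inl d)) = e (Sum.inl ((glue leaf t).rev d))) ∧
    (∀ i, (glue (node fun _ => leaf) t).rev (e (Sum.inr (i, true))) = e (Sum.inr (i, false))) ∧
    (∀ d, d ∉ Set.range (fun i : Fin 3 => (Sum.inl (leaf.side i) : leaf.Dart ⊕ t.Dart)) →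
      (glue (node fun _ => leaf) t).next (e (Sum.inl d)) = e (Sum.inl ((glue leaf t).next d))) ∧
    (∀ i, (glue (node fun _ => leaf) t).next (e (Sum.inl (Sum.inl (leaf.side i)))) =
      e (Sum.inr (i + 1, true))) ∧
    (∀ i, (glue (node fun _ => leaf) t).next (e (Sum.inr (i + 1, true))) = e (Sum.inr (i, false))) ∧
    (∀ i, (glue (node fun _ => leaf) t).next (e (Sum.inr (i, false))) =
      e (Sum.inl (Sum.inl (leaf.side i)))) := by
  refine ⟨starDart t, ?_, ?_, ?_, ?_, ?_, ?_⟩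
  · rintro (i | d)
    · exact (glue_rev_side_left (node fun _ => leaf) t i).trans
        (congrArg (fun d => starDart t (Sum.inl d)) (glue_rev_side_left leaf t i).symm)
    · rcases t.opp_cases d with ⟨i, h⟩ | ⟨d', h⟩
      · obtain rfl := eq_side_of_opp h
        exact (glue_rev_side_right (node fun _ => leaf) t i).trans
          (congrArg (fun d => starDart t (Sum.inl d)) (glue_rev_side_right leaf t i).symm)
      · exact (glue_rev_inr (node fun _ => leaf) t h).trans
          (congrArg (fun d => starDart t (Sum.inl d)) (glue_rev_inr leaf t h).symm)
  · intro i
    refine (glue_rev_inl _ t (opp_node_side_one (fun _ => leaf) (i - 1))).trans ?_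
    rw [sub_add_cancel]; rfl
  · rintro (d | d) h
    · exact absurd ⟨d, rfl⟩ h
    · rfl
  · intro i
    change _ = Sum.inl (⟨i + 1 - 1, (1 : Fin 3)⟩ : Σ _ : Fin 3, Fin 3)
    rw [add_sub_cancel_right]; rfl
  · intro i
    change (glue (node fun _ => leaf) t).next
      (Sum.inl (⟨i + 1 - 1, (1 : Fin 3)⟩ : Σ _ : Fin 3, Fin 3)) = _
    rw [add_sub_cancel_right]; rfl
  · intro i; rfl

end TernaryTree

namespace CombMap

variable {D D' : Type} {M : CombMap D} {M' : CombMap D'}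

theorem IsDoubleTriangle.of_hom {e : D ≃ D'} (h : M.Hom M' e) (hM : M.IsDoubleTriangle) :
    M'.IsDoubleTriangle := by
  obtain ⟨f, hf⟩ := hM
  refine ⟨f.trans e, fun i => ⟨?_, ?_, ?_⟩⟩
  · simp only [Equiv.trans_apply, ← h.rev, (hf i).1]
  · simp only [Equiv.trans_apply, ← h.next, (hf i).2.1]
  · simp only [Equiv.trans_apply, ← h.next, (hf i).2.2]

theorem IsApollonian.of_hom {e : D ≃ D'} (h : M.Hom M' e) (hM : M.IsApollonian) :
    M'.IsApollonian := by
  cases hM with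
  | base _ hM => exact .base _ (hM.of_hom h)
  | star N _ hN hS =>
    refine .star N _ hN ?_
    obtain ⟨f, g, h1, h2, h3, h4, h5, h6, h7, h8⟩ := hS
    refine ⟨f, g.trans e, h1, h2, ?_, ?_, ?_, ?_, ?_, ?_⟩ <;>
      simp only [Equiv.trans_apply, ← h.rev, ← h.next]
    · exact fun d => congrArg e (h3 d)
    · exact fun i => congrArg e (h4 i)
    · exact fun d hd => congrArg e (h5 d hd)
    · exact fun i => congrArg e (h6 i)
    · exact fun i => congrArg e (h7 i)
    · exact fun i => congrArg e (h8 i)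

end CombMap

namespace TernaryTree

open CombMap

/-- The double triangle, in the form of two undivided triangles. -/
theorem isDoubleTriangle_glue : (glue leaf leaf).IsDoubleTriangle := by
  refine ⟨⟨fun p => if p.2 then Sum.inl p.1 else Sum.inr (-p.1), fun d => Sum.elim
    (fun i : Fin 3 => (i, true)) (fun i : Fin 3 => (-i, false)) d, ?_, ?_⟩, fun i => ⟨?_, ?_, ?_⟩⟩
  · rintro ⟨i, b⟩
    cases b
    · exact congrArg (·, false) (neg_neg i)
    · rfl
  · rintro (i | i)
    · rfl
    · exact congrArg Sum.inr ((by decide : ∀ i : Fin 3, - -i = i) i)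
  · exact glue_rev_side_left leaf leaf i
  · rfl
  · exact congrArg Sum.inr ((by decide : ∀ i : Fin 3, -(i + 1) + 1 = -i) i)

/-- A star division is determined by the divided face: if `glue leaf t` is isomorphic to `M` then
dividing the face of `M` that corresponds to the undivided side gives `glue (node leaf³) t`. -/
theorem hom_of_isStarDivision {D D' : Type} {M : CombMap D} {M' : CombMap D'}
    {f : Fin 3 → D} {g : D ⊕ (Fin 3 × Bool) ≃ D'}
    (h3 : ∀ d, M'.rev (g (Sum.inl d)) = g (Sum.inl (M.rev d)))
    (h4 : ∀ i, M'.rev (g (Sum.inr (i, true))) = g (Sum.inr (i, false)))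
    (h5 : ∀ d, d ∉ Set.range f → M'.next (g (Sum.inl d)) = g (Sum.inl (M.next d)))
    (h6 : ∀ i, M'.next (g (Sum.inl (f i))) = g (Sum.inr (i + 1, true)))
    (h7 : ∀ i, M'.next (g (Sum.inr (i + 1, true))) = g (Sum.inr (i, false)))
    (h8 : ∀ i, M'.next (g (Sum.inr (i, false))) = g (Sum.inl (f i)))
    {t : TernaryTree} {e : D ≃ leaf.Dart ⊕ t.Dart} (he : M.Hom (glue leaf t) e)
    (hf : ∀ i, e (f i) = Sum.inl (leaf.side i)) :
    ∃ e', M'.Hom (glue (node fun _ => leaf) t) e' := by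
  obtain ⟨k, k3, k4, k5, k6, k7, k8⟩ := isStarDivision_glue t
  set E := g.symm.trans ((Equiv.sumCongr e (Equiv.refl _)).trans k) with hE
  have E1 : ∀ d, E (g (Sum.inl d)) = k (Sum.inl (e d)) := fun d => by simp [hE]
  have E2 : ∀ d, E (g (Sum.inr d)) = k (Sum.inr d) := fun d => by simp [hE]
  refine ⟨E, fun d => ?_, fun d => ?_⟩
  · obtain ⟨d, rfl⟩ := g.surjective d
    rcases d with d | ⟨i, b⟩
    · rw [h3, E1, E1, k3, he.rev]
    · cases b
      · rw [E2, ← h4, M'.rev_rev, E2, ← k4, CombMap.rev_rev]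
      · rw [h4, E2, E2, k4]
  · obtain ⟨d, rfl⟩ := g.surjective d
    rcases d with d | ⟨i, b⟩
    · by_cases hd : d ∈ Set.range f
      · obtain ⟨i, rfl⟩ := hd
        rw [h6, E2, E1, hf, k6]
      · rw [h5 d hd, E1, E1, k5, he.next]
        rintro ⟨i, hi⟩
        exact hd ⟨i, e.injective (hi ▸ hf i)⟩
    · cases b
      · rw [h8, E1, E2, k8, hf]
      · obtain ⟨j, rfl⟩ : ∃ j, i = j + 1 := ⟨i - 1, by simp⟩
        rw [h7, E2, E2, k7]

/-- Every Apollonian triangulation with a distinguished dart comes from a ternary tree. -/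
theorem exists_hom_of_isApollonian {D : Type} {M : CombMap D} (hM : M.IsApollonian) (d : D) :
    ∃ (u : TernaryTree) (e : D ≃ leaf.Dart ⊕ u.Dart),
      M.Hom (glue leaf u) e ∧ e d = Sum.inl (leaf.side 0) := by
  have reroot : ∀ {D : Type} {M : CombMap D} (d : D) (s t : TernaryTree)
      (e : D ≃ s.Dart ⊕ t.Dart), M.Hom (glue s t) e → ∃ (u : TernaryTree)
      (e : D ≃ leaf.Dart ⊕ u.Dart), M.Hom (glue leaf u) e ∧ e d = Sum.inl (leaf.side 0) := by
    intro D M d s t e he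
    rcases hd : e d with x | x
    · obtain ⟨u, e', he', h⟩ := exists_hom_glue_leaf s t x
      exact ⟨u, _, he.trans he', by simpa [hd] using h⟩
    · obtain ⟨u, e', he', h⟩ := exists_hom_glue_leaf t s x
      exact ⟨u, _, (he.trans (hom_swap s t)).trans he', by simpa [hd] using h⟩
  induction hM with
  | @base D M hM =>
    obtain ⟨f, hf⟩ := hM
    obtain ⟨g, hg⟩ := isDoubleTriangle_glue
    refine reroot d leaf leaf (f.symm.trans g) ⟨fun d => ?_, fun d => ?_⟩
    · obtain ⟨⟨i, b⟩, rfl⟩ := f.surjective d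
      cases b
      · rw [← (hf i).1, M.rev_rev, (hf i).1]
        simp only [Equiv.trans_apply, Equiv.symm_apply_apply]
        rw [← (hg i).1, CombMap.rev_rev]
      · rw [(hf i).1]
        simp only [Equiv.trans_apply, Equiv.symm_apply_apply]
        rw [(hg i).1]
    · obtain ⟨⟨i, b⟩, rfl⟩ := f.surjective d
      cases b
      · obtain ⟨j, rfl⟩ : ∃ j, i = j + 1 := ⟨i - 1, by simp⟩
        rw [(hf j).2.2]
        simp only [Equiv.trans_apply, Equiv.symm_apply_apply]
        rw [(hg j).2.2]
      · rw [(hf i).2.1]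
        simp only [Equiv.trans_apply, Equiv.symm_apply_apply]
        rw [(hg i).2.1]
  | @star D D' M M' hM hS ih =>
    obtain ⟨f, g, h1, h2, h3, h4, h5, h6, h7, h8⟩ := hS
    obtain ⟨u, e, he, h0⟩ := ih (f 0)
    have hf1 : e (f 1) = Sum.inl (leaf.side 1) := by
      rw [show (1 : Fin 3) = 0 + 1 from rfl, ← h2, he.next, h0]; rfl
    have hf2 : e (f 2) = Sum.inl (leaf.side 2) := by
      rw [show (2 : Fin 3) = 1 + 1 from rfl, ← h2, he.next, hf1]; rfl
    have hf : ∀ i, e (f i) = Sum.inl (leaf.side i) := by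
      intro i; fin_cases i
      · exact h0
      · exact hf1
      · exact hf2
    obtain ⟨e', he'⟩ := hom_of_isStarDivision h3 h4 h5 h6 h7 h8 he hf
    exact reroot d _ _ e' he'

theorem isStarDivision_glue_node (t : TernaryTree) :
    (glue leaf t).IsStarDivision (glue (node fun _ => leaf) t) := by
  obtain ⟨k, k3, k4, k5, k6, k7, k8⟩ := isStarDivision_glue t
  refine ⟨fun i => Sum.inl (leaf.side i), k, ?_, fun i => rfl, k3, k4, k5, k6, k7, k8⟩
  exact fun i j h => side_injective leaf (Sum.inl.inj h)

/-- Filling the undivided side of an Apollonian triangulation gives an Apollonian triangulation: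
the children of the new node are filled one after the other, each of them being made the undivided
side by a change of the root. -/
theorem isApollonian_glue_of_leaf (t : TernaryTree) :
    ∀ s, (glue leaf s).IsApollonian → (glue t s).IsApollonian := by
  induction t with
  | leaf => exact fun s h => h
  | node c ih =>
    intro s hs
    have turn : ∀ k s t, (glue (rotate k s) (rotate (-k) t)).IsApollonian →
        (glue s t).IsApollonian := fun k s t h => h.of_hom (hom_rotate k s t)
    have fill : ∀ (c' c'' : Fin 3 → TernaryTree) (s : TernaryTree),
        (∀ s, (glue leaf s).IsApollonian → (glue (c'' 0) s).IsApollonian) → c' 0 = leaf →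
        c'' 1 = c' 1 → c'' 2 = c' 2 →
        (glue (node c') s).IsApollonian → (glue (node c'') s).IsApollonian := by
      intro c' c'' s hu h0 e1 e2 h
      have h1 := h.of_hom (hom_shift c' s)
      rw [h0, show shiftChildren c' s = shiftChildren c'' s by simp [shiftChildren, e1, e2]] at h1
      exact (hu _ h1).of_hom (hom_shift c'' s).symm
    have fill' : ∀ (i : Fin 3) (c' c'' : Fin 3 → TernaryTree), c' i = leaf → c'' i = c i →
        (∀ j, j ≠ i → c'' j = c' j) →
        (glue (node c') s).IsApollonian → (glue (node c'') s).IsApollonian := by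
      intro i c' c'' hi hi' hj h
      refine turn i _ _ (fill (fun j => c' (j + i)) (fun j => c'' (j + i)) (rotate (-i) s) ?_ ?_
        (hj _ ((by decide : ∀ i : Fin 3, 1 + i ≠ i) i))
        (hj _ ((by decide : ∀ i : Fin 3, 2 + i ≠ i) i)) (h.of_hom (hom_rotate i (node c') s).symm))
      · rw [zero_add, hi']; exact ih i
      · simpa only [zero_add] using hi
    have h0 := fill' 0 (fun _ => leaf) ![c 0, leaf, leaf] rfl rfl
      (by intro j hj; fin_cases j <;> first | rfl | exact absurd rfl hj)
      (.star _ _ hs (isStarDivision_glue_node s))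
    have h1 := fill' 1 _ ![c 0, c 1, leaf] rfl rfl
      (by intro j hj; fin_cases j <;> first | rfl | exact absurd rfl hj) h0
    exact fill' 2 _ c rfl rfl
      (by intro j hj; fin_cases j <;> first | rfl | exact absurd rfl hj) h1

theorem isApollonian_glue (t : TernaryTree) : (glue leaf t).IsApollonian :=
  (isApollonian_glue_of_leaf t leaf (.base _ isDoubleTriangle_glue)).of_hom (hom_swap t leaf)

end TernaryTree

/-! ### Uniqueness of the tree and rigidity -/

namespace TernaryTree

/-- An embedding of a subdivided triangle into another one that respects the boundary exists only
if the trees agree. The new vertex of a node is recognised as the only interior vertex that is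
adjacent to all three corners. -/
theorem eq_of_embedding {t t' : TernaryTree} (ε : t.Dart → t'.Dart) (hε : Function.Injective ε)
    (hside : ∀ i, ε (t.side i) = t'.side i) (hnext : ∀ d, ε (t.next d) = t'.next (ε d))
    (hopp : ∀ d d', t.opp d = Sum.inr d' → t'.opp (ε d) = Sum.inr (ε d')) : t = t' := by
  induction t generalizing t' with
  | leaf =>
    cases t' with
    | leaf => rfl
    | node c' =>
      have h : (node c').next ((node c').side 0) = (node c').side 1 := by
        rw [← hside, ← hnext, ← hside]; rfl
      exact absurd (congrArg Sigma.fst h) (by decide : (0 : Fin 3) ≠ 1)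
  | node c ih =>
    cases t' with
    | leaf =>
      have h : (⟨0, (c 0).next ((c 0).side 0)⟩ : Σ i, (c i).Dart) = ⟨1, (c 1).side 0⟩ := by
        refine hε ((hnext ((node c).side 0)).trans ?_)
        rw [hside]; exact (hside 1).symm
      exact absurd (congrArg Sigma.fst h) (by decide : (0 : Fin 3) ≠ 1)
    | node c' =>
      have hlink : ∀ d d', (node c).Linked d d' → (node c').Linked (ε d) (ε d') := by
        intro d d' h
        induction h with
        | rel a b h =>
          obtain ⟨a', h1, rfl⟩ := h
          exact Relation.EqvGen.rel _ _ ⟨_, hopp _ _ h1, (hnext a').symm⟩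
        | refl => exact Relation.EqvGen.refl _
        | symm _ _ _ ih => exact ih.symm
        | trans _ _ _ _ _ ih1 ih2 => exact ih1.trans _ _ _ ih2
      have horg : ∀ d d', (node c).org d = (node c).org d' →
          (node c').org (ε d) = (node c').org (ε d') := fun d d' h =>
        (hlink _ _ (linked_of_org_eq h)).org_eq
      -- the end of the image of the edge from the new vertex to the corner `i`
      have hend : ∀ i, (node c').org ((node c').next (ε ⟨i, (c i).side 2⟩)) = Sum.inl i := by
        intro i
        have h1 := horg ((node c).next ⟨i, (c i).side 2⟩) ((node c).side i) (by
          rw [next_node, org_node, org_next_side, org_side]; rfl)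
        rw [hside, org_side] at h1
        exact (congrArg _ (hnext ⟨i, (c i).side 2⟩)).symm.trans h1
      have hstart : ∀ i, (node c').org (ε ⟨i, (c i).side 2⟩) =
          (node c').org (ε ⟨0, (c 0).side 2⟩) := fun i =>
        horg _ _ (by rw [org_node, org_node, org_side, org_side]; rfl)
      have hspoke : ∀ i, ε ⟨i, (c i).side 2⟩ = ⟨i, (c' i).side 2⟩ := by
        intro i
        rcases hx : (node c').org (ε ⟨0, (c 0).side 2⟩) with k | (_ | ⟨k, x⟩)
        · exact absurd (eq_side_of_org ((hstart k).trans hx) (hend k)).1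
            ((by decide : ∀ k : Fin 3, k ≠ k + 1) k)
        · have h1 := (hstart i).trans hx
          have h2 := hend i
          rcases hd : ε ⟨i, (c i).side 2⟩ with ⟨j, d⟩
          rw [hd, org_node] at h1
          rw [hd, next_node, org_node] at h2
          have h1' := embed_eq_none h1
          rcases embed_eq_inl h2 with ⟨h3, rfl⟩ | ⟨h3, rfl⟩
          · rw [(eq_side_of_org h1' h3).2]
          · exact absurd (eq_side_of_org h1' h3).1 (by decide)
        · have h1 := (hstart (k + 2)).trans hx
          have h2 := hend (k + 2)
          rcases hd : ε ⟨k + 2, (c (k + 2)).side 2⟩ with ⟨j, d⟩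
          rw [hd, org_node] at h1
          rw [hd, next_node, org_node] at h2
          obtain rfl := embed_eq_some h1
          rcases embed_eq_inl h2 with ⟨_, h⟩ | ⟨_, h⟩
          · exact absurd h ((by decide : ∀ j : Fin 3, j + 2 ≠ j) j)
          · exact absurd h ((by decide : ∀ j : Fin 3, j + 2 ≠ j + 1) j)
      have hspoke' : ∀ i, ε ⟨i, (c i).side 1⟩ = ⟨i, (c' i).side 1⟩ := by
        intro i
        have h1 := hopp _ _ (opp_node_side_one c i)
        rw [hspoke] at h1
        have h2 := (opp_opp h1).1
        rw [opp_node_side_two] at h2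
        rw [← Sum.inr.inj h2]
        refine sigma_side_eq c' ?_ 1
        rw [add_assoc]; exact add_zero i
      have hside' : ∀ i k, ε ⟨i, (c i).side k⟩ = ⟨i, (c' i).side k⟩ := by
        intro i k
        fin_cases k
        · exact hside i
        · exact hspoke' i
        · exact hspoke i
      -- the children are mapped to the children
      have hchild : ∀ i (d : (c i).Dart), ∃ d', ε ⟨i, d⟩ = ⟨i, d'⟩ := by
        intro i
        refine mem_of_closed (S := {d : (c i).Dart | ∃ d', ε ⟨i, d⟩ = ⟨i, d'⟩}) (i := 0)
          ⟨_, hside' i 0⟩ ?_ ?_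
        · rintro d ⟨d', h⟩
          exact ⟨(c' i).next d', (hnext ⟨i, d⟩).trans (congrArg (node c').next h)⟩
        · rintro d ⟨d', h⟩ e he
          have h1 := hopp _ _ (opp_node_inr he)
          rw [h] at h1
          rcases (c' i).opp_cases d' with ⟨k, h2⟩ | ⟨e', h2⟩
          · obtain rfl := eq_side_of_opp h2
            rw [← hside'] at h
            have := eq_of_heq (Sigma.mk.inj_iff.1 (hε h)).2
            rw [this, opp_side] at he; cases he
          · rw [opp_node_inr h2] at h1
            exact ⟨e', (Sum.inr.inj h1).symm⟩
      have hc : ∀ i, c i = c' i := by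
        intro i
        choose δ hδ using hchild i
        have inj2 : ∀ {x y : (c' i).Dart}, (⟨i, x⟩ : Σ i, (c' i).Dart) = ⟨i, y⟩ → x = y :=
          fun h => eq_of_heq (Sigma.mk.inj_iff.1 h).2
        have hnext' : ∀ d, δ ((c i).next d) = (c' i).next (δ d) := fun d => by
          exact inj2 ((hδ _).symm.trans ((hnext ⟨i, d⟩).trans (congrArg (node c').next (hδ d))))
        have hopp' : ∀ d d', (c i).opp d = Sum.inr d' → (c' i).opp (δ d) = Sum.inr (δ d') := by
          intro d d' h
          have h1 := hopp _ _ (opp_node_inr h)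
          rw [hδ, hδ] at h1
          rcases (c' i).opp_cases (δ d) with ⟨k, h2⟩ | ⟨e', h2⟩
          · have h3 := eq_side_of_opp h2
            have h4 := hε ((hδ d).trans ((congrArg _ h3).trans (hside' i k).symm))
            rw [eq_of_heq (Sigma.mk.inj_iff.1 h4).2, opp_side] at h; cases h
          · rw [opp_node_inr h2] at h1
            rw [h2, inj2 (Sum.inr.inj h1)]
        refine ih i δ (fun x y h => ?_) (fun k => inj2 ?_) hnext' hopp'
        · have := hε ((hδ x).trans ((congrArg _ h).trans (hδ y).symm))
          exact eq_of_heq (Sigma.mk.inj_iff.1 this).2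
        · rw [← hδ, hside']
      rw [funext hc]

theorem hom_sides {t t' : TernaryTree} {e : leaf.Dart ⊕ t.Dart ≃ leaf.Dart ⊕ t'.Dart}
    (he : CombMap.Hom (glue leaf t) (glue leaf t') e)
    (h0 : e (Sum.inl (leaf.side 0)) = Sum.inl (leaf.side 0)) :
    (∀ d, e (Sum.inl d) = Sum.inl d) ∧ ∀ i, e (Sum.inr (t.side i)) = Sum.inr (t'.side i) := by
  have h1 : e (Sum.inl (leaf.side 1)) = Sum.inl (leaf.side 1) := by
    have := he.next (Sum.inl (leaf.side 0))
    rw [h0] at this; exact this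
  have h2 : e (Sum.inl (leaf.side 2)) = Sum.inl (leaf.side 2) := by
    have := he.next (Sum.inl (leaf.side 1))
    rw [h1] at this; exact this
  have h : ∀ i, e (Sum.inl (leaf.side i)) = Sum.inl (leaf.side i) := by
    intro i; fin_cases i
    exacts [h0, h1, h2]
  refine ⟨h, fun i => ?_⟩
  have := he.rev (Sum.inl (leaf.side (-i)))
  rwa [h, glue_rev_side_left, glue_rev_side_left, neg_neg] at this

/-- The tree of a rooted Apollonian triangulation is unique. -/
theorem eq_of_hom {t t' : TernaryTree} {e : leaf.Dart ⊕ t.Dart ≃ leaf.Dart ⊕ t'.Dart}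
    (he : CombMap.Hom (glue leaf t) (glue leaf t') e)
    (h0 : e (Sum.inl (leaf.side 0)) = Sum.inl (leaf.side 0)) : t = t' := by
  obtain ⟨hl, hs⟩ := hom_sides he h0
  have hr : ∀ d, ∃ d', e (Sum.inr d) = Sum.inr d' := by
    intro d
    rcases h : e (Sum.inr d) with x | x
    · rw [← hl] at h; cases e.injective h
    · exact ⟨x, rfl⟩
  choose ε hε using hr
  refine eq_of_embedding ε (fun x y h => ?_) (fun i => ?_) (fun d => ?_) (fun d d' h => ?_)
  · exact Sum.inr.inj (e.injective ((hε x).trans ((congrArg _ h).trans (hε y).symm)))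
  · exact Sum.inr.inj ((hε _).symm.trans (hs i))
  · refine Sum.inr.inj (β := t'.Dart) (α := leaf.Dart) ?_
    rw [← hε, ← glue_next_inr leaf t, he.next, hε]; rfl
  · have h1 := he.rev (Sum.inr d)
    rw [glue_rev_inr _ _ h, hε, hε] at h1
    rcases t'.opp_cases (ε d) with ⟨i, h2⟩ | ⟨e', h2⟩
    · rw [glue_rev, glueRev, h2] at h1; cases h1
    · rw [glue_rev_inr _ _ h2] at h1
      rw [h2, Sum.inr.inj h1]

/-- A rooted Apollonian triangulation has no nontrivial automorphism. -/
theorem hom_eq_refl {t : TernaryTree} {e : leaf.Dart ⊕ t.Dart ≃ leaf.Dart ⊕ t.Dart}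
    (he : CombMap.Hom (glue leaf t) (glue leaf t) e)
    (h0 : e (Sum.inl (leaf.side 0)) = Sum.inl (leaf.side 0)) : e = Equiv.refl _ := by
  obtain ⟨hl, hs⟩ := hom_sides he h0
  ext d
  rcases d with d | d
  · exact hl d
  · refine mem_of_closed (S := {d : t.Dart | e (Sum.inr d) = Sum.inr d}) (i := 0) (hs 0) ?_ ?_ d
    · intro d hd
      change e _ = _
      rw [← glue_next_inr leaf t, he.next, hd]
    · intro d hd d' h
      change e _ = _
      rw [← glue_rev_inr leaf t h, he.rev, hd]

end TernaryTree

/-! ### Vertices, edges and faces of combinatorial maps -/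

namespace CombMap

variable {D : Type} (M : CombMap D)

theorem eq_of_sameCycle {α β : Type} {σ : Equiv.Perm α} {f : α → β} (hf : ∀ x, f (σ x) = f x)
    {x y : α} (h : σ.SameCycle x y) : f x = f y := by
  obtain ⟨i, rfl⟩ := h
  induction i using Int.induction_on generalizing x with
  | zero => rfl
  | succ n ih => rw [zpow_add_one, Equiv.Perm.mul_apply, ← ih, hf]
  | pred n ih =>
    rw [zpow_sub_one, Equiv.Perm.mul_apply, ← ih, ← hf (σ⁻¹ x), ← Equiv.Perm.mul_apply,
      mul_inv_cancel, Equiv.Perm.one_apply]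

theorem origin_eq_iff {d d' : D} : M.origin d = M.origin d' ↔ M.rot.SameCycle d d' :=
  Quotient.eq (r := Equiv.Perm.SameCycle.setoid M.rot)

theorem face_eq_iff {d d' : D} : M.face d = M.face d' ↔ M.next.SameCycle d d' :=
  Quotient.eq (r := Equiv.Perm.SameCycle.setoid M.next)

theorem edge_eq_iff {d d' : D} : M.edge d = M.edge d' ↔ d = d' ∨ M.rev d = d' := by
  refine (Quotient.eq (r := Equiv.Perm.SameCycle.setoid M.rev)).trans ⟨?_, ?_⟩
  · rintro ⟨i, rfl⟩
    have h2 : M.rev ^ (2 : ℤ) = 1 := by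
      ext d; rw [zpow_two, Equiv.Perm.mul_apply, M.rev_rev]; rfl
    rcases Int.even_or_odd' i with ⟨k, rfl | rfl⟩
    · left; rw [zpow_mul, h2, one_zpow]; rfl
    · right; rw [zpow_add, zpow_mul, h2, one_zpow, one_mul, zpow_one]
  · rintro (rfl | rfl)
    · exact Equiv.Perm.SameCycle.refl _ _
    · exact ⟨1, by rw [zpow_one]⟩

theorem origin_surjective : Function.Surjective M.origin := Quotient.mk_surjective

theorem edge_surjective : Function.Surjective M.edge := Quotient.mk_surjective

theorem face_surjective : Function.Surjective M.face := Quotient.mk_surjective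

@[simp] theorem edge_rev (d : D) : M.edge (M.rev d) = M.edge d :=
  ((M.edge_eq_iff).2 (Or.inr rfl)).symm

@[simp] theorem target_rev (d : D) : M.target (M.rev d) = M.origin d := by
  rw [target, M.rev_rev]

theorem target_eq (d : D) : M.target d = M.origin (M.next d) :=
  (M.origin_eq_iff).2 ⟨1, by rw [zpow_one, rot, Equiv.Perm.mul_apply, M.rev_rev]⟩

theorem graph_adj {T : Set M.Edge} {u v : M.Vertex} : (M.graph T).Adj u v ↔
    u ≠ v ∧ ∃ d, M.edge d ∈ T ∧ M.origin d = u ∧ M.target d = v := by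
  rw [graph, SimpleGraph.fromRel_adj]
  refine and_congr_right fun _ => ⟨?_, Or.inl⟩
  rintro (h | ⟨d, h1, h2, h3⟩)
  · exact h
  · exact ⟨M.rev d, by rwa [edge_rev], h3, by rwa [target_rev]⟩

/-- The unordered pair of ends of an edge. -/
def edgeEnds : M.Edge → Sym2 M.Vertex :=
  Quotient.lift (s := Equiv.Perm.SameCycle.setoid M.rev) (fun d => s(M.origin d, M.target d))
    fun _ _ h => eq_of_sameCycle (f := fun d => s(M.origin d, M.target d))
      (fun d => by rw [target_rev, Sym2.eq_swap]; rfl) h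

theorem edgeEnds_edge (d : D) : M.edgeEnds (M.edge d) = s(M.origin d, M.target d) := rfl

theorem edgeSet_graph (T : Set M.Edge) :
    (M.graph T).edgeSet = (M.edgeEnds '' T) \ Sym2.diagSet := by
  ext x
  induction x with
  | _ u v =>
    rw [SimpleGraph.mem_edgeSet, graph_adj, and_comm, Set.mem_sdiff, Sym2.mem_diagSet,
      Sym2.mk_isDiag_iff]
    refine and_congr_left fun _ => ⟨?_, ?_⟩
    · rintro ⟨d, h1, rfl, rfl⟩
      exact ⟨_, h1, rfl⟩
    · rintro ⟨e, h1, h2⟩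
      obtain ⟨d, rfl⟩ := M.edge_surjective e
      rw [edgeEnds_edge, Sym2.eq_iff] at h2
      rcases h2 with ⟨h2, h3⟩ | ⟨h2, h3⟩
      · exact ⟨d, h1, h2, h3⟩
      · exact ⟨M.rev d, by rwa [edge_rev], h3, by rwa [target_rev]⟩

instance finite_vertex [Finite D] : Finite M.Vertex := Finite.of_surjective _ M.origin_surjective

instance finite_edge [Finite D] : Finite M.Edge := Finite.of_surjective _ M.edge_surjective

instance finite_face [Finite D] : Finite M.Face := Finite.of_surjective _ M.face_surjective

/-- A set of edges is a spanning tree exactly if it connects all vertices and has one edge less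
than there are vertices. -/
theorem isSpanningTree_iff [Finite D] (T : Set M.Edge) :
    M.IsSpanningTree T ↔ (M.graph T).Connected ∧ T.ncard + 1 = Nat.card M.Vertex := by
  have hsub : (M.graph T).edgeSet ⊆ M.edgeEnds '' T := by
    rw [edgeSet_graph]; exact Set.sdiff_subset
  constructor
  · rintro ⟨h1, h2⟩
    have hT := SimpleGraph.isTree_iff_connected_and_card.1 h2
    refine ⟨hT.1, ?_⟩
    have hloop : ∀ d, M.edge d ∈ T → M.origin d ≠ M.target d := fun d hd h =>
      M.rev_ne d (h1 d (M.rev d) hd (by rwa [edge_rev]) h (by rw [target_rev, h])).symm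
    have hinj : Set.InjOn M.edgeEnds T := by
      intro e he e' he' h
      obtain ⟨d, rfl⟩ := M.edge_surjective e
      obtain ⟨d', rfl⟩ := M.edge_surjective e'
      rw [edgeEnds_edge, edgeEnds_edge, Sym2.eq_iff] at h
      rcases h with ⟨h3, h4⟩ | ⟨h3, h4⟩
      · rw [h1 d d' he he' h3 h4]
      · rw [h1 d (M.rev d') he (by rwa [edge_rev]) h3 (by rw [target_rev, h4]), edge_rev]
    have himg : (M.graph T).edgeSet = M.edgeEnds '' T := by
      rw [edgeSet_graph, sdiff_eq_left, Set.disjoint_left]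
      rintro _ ⟨e, he, rfl⟩ hdiag
      obtain ⟨d, rfl⟩ := M.edge_surjective e
      rw [edgeEnds_edge, Sym2.mem_diagSet, Sym2.mk_isDiag_iff] at hdiag
      exact hloop d he hdiag
    rw [← hT.2, himg, Nat.card_coe_set_eq, hinj.ncard_image]
  · rintro ⟨h1, h2⟩
    have hle := h1.card_vert_le_card_edgeSet_add_one
    rw [Nat.card_coe_set_eq] at hle
    have hle1 := Set.ncard_le_ncard hsub
    have hle2 := Set.ncard_image_le (f := M.edgeEnds) (s := T)
    have himg : (M.graph T).edgeSet = M.edgeEnds '' T :=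
      Set.eq_of_subset_of_ncard_le hsub (by omega)
    have hinj : Set.InjOn M.edgeEnds T := Set.injOn_of_ncard_image_eq (by omega)
    refine ⟨fun d d' hd hd' h3 h4 => ?_, SimpleGraph.isTree_iff_connected_and_card.2 ⟨h1, ?_⟩⟩
    · have h := hinj hd hd' (by rw [edgeEnds_edge, edgeEnds_edge, h3, h4])
      rcases (M.edge_eq_iff).1 h with h | h
      · exact h
      · have hmem : M.edgeEnds (M.edge d) ∈ (M.graph T).edgeSet := himg ▸ ⟨_, hd, rfl⟩
        rw [edgeEnds_edge, SimpleGraph.mem_edgeSet] at hmem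
        refine absurd ?_ hmem.ne
        rw [h3, ← h]; rfl
    · rw [Nat.card_coe_set_eq]; omega

theorem faceDegree_eq_three {M : CombMap D} (h3 : ∀ d, M.next (M.next (M.next d)) = d)
    (h1 : ∀ d, M.next d ≠ d) : M.IsTriangulation := by
  intro f
  obtain ⟨d, rfl⟩ := M.face_surjective f
  have hset : {d' | M.face d' = M.face d} = {d, M.next d, M.next (M.next d)} := by
    ext d'
    simp only [Set.mem_ofPred_eq, Set.mem_insert_iff, Set.mem_singleton_iff]
    constructor
    · intro h
      have := eq_of_sameCycle (σ := M.next) (f := fun x => x = d ∨ x = M.next d ∨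
        x = M.next (M.next d)) (fun x => ?_) ((M.face_eq_iff).1 h.symm)
      · rw [← eq_iff_iff.1 this]; exact Or.inl rfl
      · refine propext ⟨?_, ?_⟩
        · rintro (h | h | h)
          · right; right; rw [← h, h3]
          · exact Or.inl (M.next.injective h)
          · exact Or.inr (Or.inl (M.next.injective h))
        · rintro (rfl | rfl | rfl)
          · exact Or.inr (Or.inl rfl)
          · exact Or.inr (Or.inr rfl)
          · exact Or.inl (h3 d)
    · have step : ∀ x, M.face (M.next x) = M.face x := fun x =>
        ((M.face_eq_iff).2 ⟨1, by rw [zpow_one]⟩).symm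
      rintro (rfl | rfl | rfl) <;> simp only [step]
  rw [faceDegree, hset]
  refine Set.ncard_eq_three.2 ⟨_, _, _, (h1 d).symm, fun h => ?_, (h1 _).symm, rfl⟩
  exact h1 (M.next (M.next d)) ((h3 d).trans h)

theorem IsTriangulation.card_face [Finite D] {M : CombMap D} (h : M.IsTriangulation) :
    Nat.card D = 3 * Nat.card M.Face := by
  have := Fintype.ofFinite M.Face
  rw [← Nat.card_congr (Equiv.sigmaFiberEquiv M.face), Nat.card_sigma]
  have : ∀ f, Nat.card {d // M.face d = f} = 3 := h
  simp [this, mul_comm]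

end CombMap

namespace TernaryTree

/-! ### The triangulation of a ternary tree -/

/-- The origin of a dart of the triangulation with one undivided side. -/
def sphereOrg (t : TernaryTree) : leaf.Dart ⊕ t.Dart → t.Vertex
  | Sum.inl i => Sum.inl (1 - (show Fin 3 from i))
  | Sum.inr d => t.org d

/-- The edge of a dart of the triangulation with one undivided side. -/
def sphereEdge (t : TernaryTree) : leaf.Dart ⊕ t.Dart → Fin 3 ⊕ t.InnerEdge
  | Sum.inl i => Sum.inl (-(show Fin 3 from i))
  | Sum.inr d => t.edgeOf d

theorem glue_rev_inl_leaf (t : TernaryTree) (i : Fin 3) :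
    (glue leaf t).rev (Sum.inl (leaf.side i)) = Sum.inr (t.side (-i)) := glue_rev_side_left leaf t i

theorem sphereOrg_eq_iff (t : TernaryTree) {d d' : leaf.Dart ⊕ t.Dart} :
    (glue leaf t).origin d = (glue leaf t).origin d' ↔ t.sphereOrg d = t.sphereOrg d' := by
  have hrot : ∀ d, (glue leaf t).rot d = (glue leaf t).next ((glue leaf t).rev d) := fun _ => rfl
  constructor
  · rw [CombMap.origin_eq_iff]
    refine CombMap.eq_of_sameCycle (f := t.sphereOrg) (fun d => ?_)
    rw [hrot]
    rcases d with i | d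
    · refine (congrArg (fun d => t.sphereOrg ((glue leaf t).next d))
        (glue_rev_inl_leaf t i)).trans ((org_next_side t _).trans ?_)
      exact congrArg Sum.inl ((by decide : ∀ i : Fin 3, -i + 1 = 1 - i) i)
    · rcases t.opp_cases d with ⟨i, h⟩ | ⟨d', h⟩
      · obtain rfl := eq_side_of_opp h
        rw [glue_rev_side_right]
        refine Eq.trans ?_ (org_side t i).symm
        exact congrArg Sum.inl ((by decide : ∀ i : Fin 3, 1 - (-i + 1) = i) i)
      · rw [glue_rev_inr _ _ h]
        exact (org_opp h).1
  · have hlink : ∀ {d d'}, t.Linked d d' →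
        (glue leaf t).origin (Sum.inr d) = (glue leaf t).origin (Sum.inr d') := by
      intro d d' h
      induction h with
      | rel a b h =>
        obtain ⟨a', h1, rfl⟩ := h
        rw [CombMap.origin_eq_iff]
        exact ⟨1, by rw [zpow_one, hrot, glue_rev_inr _ _ h1]; rfl⟩
      | refl => rfl
      | symm _ _ _ ih => exact ih.symm
      | trans _ _ _ _ _ ih1 ih2 => exact ih1.trans ih2
    have hrep : ∀ d, ∃ d' : t.Dart,
        (glue leaf t).origin d = (glue leaf t).origin (Sum.inr d') ∧ t.sphereOrg d = t.org d' := by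
      rintro (i | d)
      · refine ⟨t.next (t.side (-(show Fin 3 from i))), ?_, ?_⟩
        · rw [CombMap.origin_eq_iff]
          refine ⟨1, ?_⟩
          rw [zpow_one, hrot]
          exact congrArg (glue leaf t).next (glue_rev_inl_leaf t i)
        · rw [org_next_side]
          exact congrArg Sum.inl ((by decide : ∀ i : Fin 3, 1 - i = -i + 1) i)
      · exact ⟨d, rfl, rfl⟩
    intro h
    obtain ⟨e, h1, h2⟩ := hrep d
    obtain ⟨e', h3, h4⟩ := hrep d'
    rw [h1, h3]
    exact hlink (linked_of_org_eq (h2.symm.trans (h.trans h4)))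

/-- The vertices of the triangulation of a tree. -/
noncomputable def vertexEquiv (t : TernaryTree) : (glue leaf t).Vertex ≃ t.Vertex :=
  Equiv.ofBijective (Quotient.lift (s := Equiv.Perm.SameCycle.setoid (glue leaf t).rot) t.sphereOrg
    fun _ _ h => (sphereOrg_eq_iff t).1 (Quotient.sound h)) (by
      constructor
      · intro x y h
        obtain ⟨d, rfl⟩ := CombMap.origin_surjective _ x
        obtain ⟨d', rfl⟩ := CombMap.origin_surjective _ y
        exact (sphereOrg_eq_iff t).2 h
      · intro x
        obtain ⟨d, hd⟩ := t.org_surjective x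
        exact ⟨(glue leaf t).origin (Sum.inr d), hd⟩)

theorem vertexEquiv_origin (t : TernaryTree) (d : leaf.Dart ⊕ t.Dart) :
    t.vertexEquiv ((glue leaf t).origin d) = t.sphereOrg d := rfl

theorem sphereEdge_eq_iff (t : TernaryTree) {d d' : leaf.Dart ⊕ t.Dart} :
    (glue leaf t).edge d = (glue leaf t).edge d' ↔ t.sphereEdge d = t.sphereEdge d' := by
  rw [CombMap.edge_eq_iff]
  constructor
  · rintro (rfl | rfl)
    · rfl
    · rcases d with i | d
      · exact ((congrArg t.sphereEdge (glue_rev_inl_leaf t i)).trans (edgeOf_side t _)).symm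
      · rcases t.opp_cases d with ⟨i, h⟩ | ⟨d', h⟩
        · obtain rfl := eq_side_of_opp h
          rw [glue_rev_side_right]
          refine (edgeOf_side t i).trans ?_
          exact congrArg Sum.inl ((by decide : ∀ i : Fin 3, i = - -i) i)
        · rw [glue_rev_inr _ _ h]
          exact (edgeOf_opp h).symm
  · have key : ∀ (i : Fin 3) (d : t.Dart), t.edgeOf d = Sum.inl (-i) →
        (glue leaf t).rev (Sum.inl (leaf.side i)) = Sum.inr d := fun i d h => by
      rw [glue_rev_inl_leaf, eq_side_of_edgeOf h]
    rcases d with i | d <;> rcases d' with i' | d'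
    · intro h
      exact Or.inl (congrArg Sum.inl
        ((by decide : ∀ i j : Fin 3, -i = -j → i = j) i i' (Sum.inl.inj h)))
    · exact fun h => Or.inr (key i d' h.symm)
    · intro h
      right
      rw [← key i' d h]
      exact CombMap.rev_rev _ _
    · intro h
      rcases eq_or_opp_of_edgeOf_eq h with rfl | h
      · exact Or.inl rfl
      · exact Or.inr (glue_rev_inr _ _ h)

/-- The edges of the triangulation of a tree. -/
noncomputable def edgeEquiv (t : TernaryTree) : (glue leaf t).Edge ≃ Fin 3 ⊕ t.InnerEdge :=
  Equiv.ofBijective (Quotient.lift (s := Equiv.Perm.SameCycle.setoid (glue leaf t).rev) t.sphereEdge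
    fun _ _ h => (sphereEdge_eq_iff t).1 (Quotient.sound h)) (by
      constructor
      · intro x y h
        obtain ⟨d, rfl⟩ := CombMap.edge_surjective _ x
        obtain ⟨d', rfl⟩ := CombMap.edge_surjective _ y
        exact (sphereEdge_eq_iff t).2 h
      · intro x
        obtain ⟨d, hd⟩ := t.edgeOf_surjective x
        exact ⟨(glue leaf t).edge (Sum.inr d), hd⟩)

theorem isTriangulation_glue (s t : TernaryTree) : (glue s t).IsTriangulation := by
  refine CombMap.faceDegree_eq_three ?_ ?_
  · rintro (d | d)
    · exact congrArg Sum.inl (next_next_next s d)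
    · exact congrArg Sum.inr (next_next_next t d)
  · rintro (d | d) h
    · exact next_ne s d (Sum.inl.inj h)
    · exact next_ne t d (Sum.inr.inj h)

theorem card_vertex_glue (t : TernaryTree) : Nat.card (glue leaf t).Vertex = t.size + 3 := by
  rw [Nat.card_congr t.vertexEquiv, Nat.card_sum, card_inner]
  simp [add_comm]

theorem card_face_glue (t : TernaryTree) : Nat.card (glue leaf t).Face = 2 * t.size + 2 := by
  have h := (isTriangulation_glue leaf t).card_face
  rw [Nat.card_sum, card_dart, card_dart] at h
  simp only [size] at h
  omega

theorem card_edge_glue (t : TernaryTree) : Nat.card (glue leaf t).Edge = 3 * t.size + 3 := by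
  rw [Nat.card_congr t.edgeEquiv, Nat.card_sum, card_innerEdge]
  simp [add_comm]

theorem isPlanar_glue (t : TernaryTree) : (glue leaf t).IsPlanar := by
  refine ⟨inferInstance, ?_, ?_⟩
  · set M := glue leaf t
    set G := M.graph Set.univ
    have hadj : ∀ d, G.Reachable (M.origin d) (M.target d) := by
      intro d
      by_cases h : M.origin d = M.target d
      · rw [h]
      · exact SimpleGraph.Adj.reachable ((M.graph_adj).2 ⟨h, d, Set.mem_univ _, rfl, rfl⟩)
    have hall : ∀ d : t.Dart,
        G.Reachable (M.origin (Sum.inr (t.side 0))) (M.origin (Sum.inr d)) := by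
      refine mem_of_closed (S := {d : t.Dart | G.Reachable (M.origin (Sum.inr (t.side 0)))
        (M.origin (Sum.inr d))}) (i := 0) (SimpleGraph.Reachable.refl _) (fun d hd => ?_)
        (fun d hd d' h => ?_)
      · have := hadj (Sum.inr d)
        rw [M.target_eq] at this
        exact hd.trans this
      · have := hadj (Sum.inr d)
        rw [CombMap.target, glue_rev_inr _ _ h] at this
        exact hd.trans this
    have hall' : ∀ v, G.Reachable (M.origin (Sum.inr (t.side 0))) v := by
      intro v
      obtain ⟨d, hd⟩ := t.org_surjective (t.vertexEquiv v)
      have : v = M.origin (Sum.inr d) := t.vertexEquiv.injective hd.symm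
      rw [this]; exact hall d
    have : Nonempty M.Vertex := ⟨M.origin (Sum.inr (t.side 0))⟩
    exact ⟨fun u v => (hall' u).symm.trans (hall' v)⟩
  · rw [card_vertex_glue, card_face_glue, card_edge_glue]
    push_cast; ring

end TernaryTree

/-! ### Connectivity in glued graphs -/

open Relation (EqvGen)

theorem Relation.EqvGen.lift {α β : Type*} {r : α → α → Prop} {s : β → β → Prop} {f : α → β}
    (h : ∀ a b, r a b → EqvGen s (f a) (f b)) {a b : α} (hab : EqvGen r a b) :
    EqvGen s (f a) (f b) := by
  induction hab with
  | rel a b hr => exact h a b hr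
  | refl => exact EqvGen.refl _
  | symm _ _ _ ih => exact ih.symm
  | trans _ _ _ _ _ ih1 ih2 => exact ih1.trans _ _ _ ih2

theorem Relation.EqvGen.eq_of_invariant {α β : Type*} {r : α → α → Prop} {f : α → β}
    (h : ∀ a b, r a b → f a = f b) {a b : α} (hab : EqvGen r a b) : f a = f b := by
  induction hab with
  | rel a b hr => exact h a b hr
  | refl => rfl
  | symm _ _ _ ih => exact ih.symm
  | trans _ _ _ _ _ ih1 ih2 => exact ih1.trans ih2

/-- A graph on `V` that is glued from pieces: the piece `j` has vertices `Fin 3 ⊕ I j`, its corner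
`k` being the vertex `κ j k` of a set `Q` of separating vertices, and there may be further edges
`R₀` between vertices in `Q`. -/
structure GluedGraph (V Q J : Type) (I : J → Type) where
  κ : J → Fin 3 → Q
  ι : Q → V
  em : ∀ j, Fin 3 ⊕ I j → V
  coord : V → Q ⊕ Σ j, I j
  em_corner : ∀ j k, em j (Sum.inl k) = ι (κ j k)
  coord_ι : ∀ q, coord (ι q) = Sum.inl q
  coord_em : ∀ j x, coord (em j (Sum.inr x)) = Sum.inr ⟨j, x⟩
  R₀ : Q → Q → Prop
  R : ∀ j, Fin 3 ⊕ I j → Fin 3 ⊕ I j → Prop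

namespace GluedGraph

variable {V Q J : Type} {I : J → Type} (G : GluedGraph V Q J I)

/-- The edges of the glued graph. -/
def Rel (x y : V) : Prop :=
  (∃ q q', G.R₀ q q' ∧ x = G.ι q ∧ y = G.ι q') ∨
    ∃ j a b, G.R j a b ∧ x = G.em j a ∧ y = G.em j b

/-- The graph on the separating vertices in which every piece is replaced by the relation that it
induces on its corners. -/
def Local (q q' : Q) : Prop :=
  G.R₀ q q' ∨ ∃ j k l, EqvGen (G.R j) (Sum.inl k) (Sum.inl l) ∧ q = G.κ j k ∧ q' = G.κ j l

theorem rel_of_piece {j : J} {a b : Fin 3 ⊕ I j} (h : EqvGen (G.R j) a b) :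
    EqvGen G.Rel (G.em j a) (G.em j b) :=
  Relation.EqvGen.lift (f := G.em j)
    (fun _ _ hab => EqvGen.rel _ _ (Or.inr ⟨j, _, _, hab, rfl, rfl⟩)) h

theorem rel_of_local {q q' : Q} (h : EqvGen G.Local q q') : EqvGen G.Rel (G.ι q) (G.ι q') := by
  refine h.lift fun a b hab => ?_
  rcases hab with hab | ⟨j, k, l, hkl, rfl, rfl⟩
  · exact EqvGen.rel _ _ (Or.inl ⟨_, _, hab, rfl, rfl⟩)
  · rw [← G.em_corner, ← G.em_corner]
    exact G.rel_of_piece hkl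

/-- The separating vertices that are reached from a vertex of the piece `j`. -/
def reachPiece (j : J) (a : Fin 3 ⊕ I j) : Set Q :=
  {q | ∃ k, EqvGen (G.R j) a (Sum.inl k) ∧ EqvGen G.Local (G.κ j k) q}

/-- The separating vertices that are reached from a vertex. This is constant on the components of
the glued graph. -/
def reach (x : V) : Set Q :=
  match G.coord x with
  | Sum.inl q => {q' | EqvGen G.Local q q'}
  | Sum.inr ⟨j, y⟩ => G.reachPiece j (Sum.inr y)

theorem reach_ι (q : Q) : G.reach (G.ι q) = {q' | EqvGen G.Local q q'} := by
  simp only [reach, G.coord_ι]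

theorem reach_em (j : J) (a : Fin 3 ⊕ I j) : G.reach (G.em j a) = G.reachPiece j a := by
  rcases a with k | x
  · rw [G.em_corner, reach_ι]
    ext q
    constructor
    · exact fun h => ⟨k, EqvGen.refl _, h⟩
    · rintro ⟨l, h1, h2⟩
      have h3 : G.Local (G.κ j k) (G.κ j l) := Or.inr ⟨j, k, l, h1, rfl, rfl⟩
      exact (EqvGen.rel _ _ h3).trans _ _ _ h2
  · simp only [reach, G.coord_em]

theorem reach_eq {x y : V} (h : EqvGen G.Rel x y) : G.reach x = G.reach y := by
  refine h.eq_of_invariant fun x y hxy => ?_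
  rcases hxy with ⟨q, q', h, rfl, rfl⟩ | ⟨j, a, b, h, rfl, rfl⟩
  · rw [reach_ι, reach_ι]
    have h' : EqvGen G.Local q q' := EqvGen.rel _ _ (Or.inl h)
    ext p
    exact ⟨fun hp => h'.symm.trans _ _ _ hp, fun hp => h'.trans _ _ _ hp⟩
  · rw [reach_em, reach_em]
    have h' := EqvGen.rel _ _ h
    ext p
    exact ⟨fun ⟨k, h1, h2⟩ => ⟨k, h'.symm.trans _ _ _ h1, h2⟩,
      fun ⟨k, h1, h2⟩ => ⟨k, h'.trans _ _ _ h1, h2⟩⟩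

/-- Connections between separating vertices can be computed after replacing each piece by the
relation that it induces on its corners. -/
theorem local_iff {q q' : Q} : EqvGen G.Rel (G.ι q) (G.ι q') ↔ EqvGen G.Local q q' := by
  refine ⟨fun h => ?_, G.rel_of_local⟩
  have h1 := G.reach_eq h
  rw [reach_ι, reach_ι] at h1
  exact (Set.ext_iff.1 h1 q').2 (EqvGen.refl _)

theorem exists_corner {j : J} {a : Fin 3 ⊕ I j} {q : Q} (h : EqvGen G.Rel (G.em j a) (G.ι q)) :
    ∃ k, EqvGen (G.R j) a (Sum.inl k) := by
  have h1 := G.reach_eq h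
  rw [reach_ι, reach_em] at h1
  obtain ⟨k, h3, -⟩ := (Set.ext_iff.1 h1 q).2 (EqvGen.refl _)
  exact ⟨k, h3⟩

end GluedGraph

/-- Merging classes along a list of pairs: two elements get the same label if they are equivalent
under the relation that is generated by the pairs. -/
def mergeLabels {Q : Type} [DecidableEq Q] : List (Q × Q) → Q → Q
  | [] => fun z => z
  | p :: l => fun z =>
    if mergeLabels l z = mergeLabels l p.1 then mergeLabels l p.2 else mergeLabels l z

theorem mergeLabels_eq_iff {Q : Type} [DecidableEq Q] {l : List (Q × Q)} {x y : Q} :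
    mergeLabels l x = mergeLabels l y ↔ EqvGen (fun a b => (a, b) ∈ l) x y := by
  constructor
  · induction l generalizing x y with
    | nil => rintro rfl; exact EqvGen.refl _
    | cons p l ih =>
      have up : ∀ {a b}, mergeLabels l a = mergeLabels l b →
          EqvGen (fun a b => (a, b) ∈ p :: l) a b := fun h =>
        (ih h).mono fun _ _ h => List.mem_cons_of_mem _ h
      have hp : EqvGen (fun a b => (a, b) ∈ p :: l) p.1 p.2 := EqvGen.rel _ _ List.mem_cons_self
      intro h
      simp only [mergeLabels] at h
      split_ifs at h with h1 h2 h2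
      · exact up (h1.trans h2.symm)
      · exact (up h1).trans _ _ _ (hp.trans _ _ _ (up h))
      · exact (up h).trans _ _ _ (hp.symm.trans _ _ _ (up h2.symm))
      · exact up h
  · intro h
    refine h.eq_of_invariant fun a b hab => ?_
    clear h
    induction l generalizing a b with
    | nil => cases hab
    | cons p l ih =>
      rcases List.mem_cons.1 hab with rfl | hab
      · simp only [mergeLabels, if_true]
        split_ifs <;> rfl
      · simp only [mergeLabels, ih a b hab]

/-! ### Spanning trees of the triangulation of a tree -/

namespace TernaryTree

/-- Adjacency of vertices by an edge in a set of interior edges. -/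
def Link (t : TernaryTree) (T : Set t.InnerEdge) (x y : t.Vertex) : Prop :=
  ∃ e ∈ T, t.ends e = (x, y)

/-- Adjacency of vertices by a side in `B` or by an interior edge in `T`. -/
def SphereLink (t : TernaryTree) (B : Set (Fin 3)) (T : Set t.InnerEdge) (x y : t.Vertex) : Prop :=
  (∃ i ∈ B, x = Sum.inl i ∧ y = Sum.inl (i + 1)) ∨ t.Link T x y

theorem sphereOrg_next_inl (t : TernaryTree) (i : Fin 3) :
    t.sphereOrg ((glue leaf t).next (Sum.inl (leaf.side i))) = Sum.inl (-i) :=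
  congrArg Sum.inl ((by decide : ∀ i : Fin 3, 1 - (i + 1) = -i) i)

theorem sphereLink_of_dart {t : TernaryTree} {W : Set (Fin 3 ⊕ t.InnerEdge)}
    {d : leaf.Dart ⊕ t.Dart} (hd : t.sphereEdge d ∈ W) :
    EqvGen (t.SphereLink (Sum.inl ⁻¹' W) (Sum.inr ⁻¹' W)) (t.sphereOrg d)
      (t.sphereOrg ((glue leaf t).next d)) := by
  rcases d with i | d
  · refine (EqvGen.rel _ _ (show t.SphereLink _ _ _ _ from
      Or.inl ⟨-(show Fin 3 from i), hd, sphereOrg_next_inl t i, ?_⟩)).symm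
    exact congrArg Sum.inl ((by decide : ∀ i : Fin 3, 1 - i = -i + 1) i)
  · rcases he : t.edgeOf d with i | e
    · have he' := he
      obtain rfl := eq_side_of_edgeOf he
      have hi : i ∈ Sum.inl ⁻¹' W := by
        rw [Set.mem_preimage, ← he]; exact hd
      exact EqvGen.rel _ _ (Or.inl ⟨i, hi, org_side t i, org_next_side t i⟩)
    · have hi : e ∈ Sum.inr ⁻¹' W := by
        rw [Set.mem_preimage, ← he]; exact hd
      rcases ends_edgeOf he with h | h
      · exact EqvGen.rel _ _ (Or.inr ⟨e, hi, h⟩)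
      · exact (EqvGen.rel _ _ (show t.SphereLink _ _ _ _ from Or.inr ⟨e, hi, h⟩)).symm

theorem exists_dart_of_sphereLink {t : TernaryTree} {W : Set (Fin 3 ⊕ t.InnerEdge)}
    {x y : t.Vertex} (h : t.SphereLink (Sum.inl ⁻¹' W) (Sum.inr ⁻¹' W) x y) :
    ∃ d, t.sphereEdge d ∈ W ∧ ((t.sphereOrg d = x ∧ t.sphereOrg ((glue leaf t).next d) = y) ∨
      (t.sphereOrg d = y ∧ t.sphereOrg ((glue leaf t).next d) = x)) := by
  rcases h with ⟨i, hi, rfl, rfl⟩ | ⟨e, he, h⟩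
  · refine ⟨Sum.inr (t.side i), ?_, Or.inl ⟨org_side t i, org_next_side t i⟩⟩
    have h1 : t.sphereEdge (Sum.inr (t.side i)) = Sum.inl i := edgeOf_side t i
    rw [h1]; exact hi
  · obtain ⟨d, hd⟩ := t.edgeOf_surjective (Sum.inr e)
    refine ⟨Sum.inr d, ?_, ?_⟩
    · have h1 : t.sphereEdge (Sum.inr d) = Sum.inr e := hd
      rw [h1]; exact he
    · rcases ends_edgeOf hd with h' | h' <;> rw [h] at h'
      · exact Or.inl ⟨(Prod.mk.inj h').1.symm, (Prod.mk.inj h').2.symm⟩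
      · exact Or.inr ⟨(Prod.mk.inj h').2.symm, (Prod.mk.inj h').1.symm⟩

/-- Being a spanning tree means connecting all vertices with the right number of edges; here this is
expressed through the sides and the interior edges of the subdivided triangle. -/
theorem isSpanningTree_glue_iff (t : TernaryTree) (W : Set (Fin 3 ⊕ t.InnerEdge)) :
    (glue leaf t).IsSpanningTree (t.edgeEquiv ⁻¹' W) ↔
      (∀ x y, EqvGen (t.SphereLink (Sum.inl ⁻¹' W) (Sum.inr ⁻¹' W)) x y) ∧
        (Sum.inl ⁻¹' W : Set (Fin 3)).ncard + (Sum.inr ⁻¹' W : Set t.InnerEdge).ncard =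
          t.size + 2 := by
  let M := glue leaf t
  have hreach : ∀ u v, (M.graph (t.edgeEquiv ⁻¹' W)).Reachable u v ↔
      EqvGen (t.SphereLink (Sum.inl ⁻¹' W) (Sum.inr ⁻¹' W)) (t.vertexEquiv u)
        (t.vertexEquiv v) := by
    intro u v
    constructor
    · rintro ⟨w⟩
      induction w with
      | nil => exact EqvGen.refl _
      | cons h _ ih =>
        refine EqvGen.trans _ _ _ ?_ ih
        obtain ⟨-, d, h1, rfl, rfl⟩ := (M.graph_adj).1 h
        rw [M.target_eq]
        exact sphereLink_of_dart h1
    · intro h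
      have h' : EqvGen (M.graph (t.edgeEquiv ⁻¹' W)).Reachable
          (t.vertexEquiv.symm (t.vertexEquiv u)) (t.vertexEquiv.symm (t.vertexEquiv v)) := by
        refine h.lift fun x y hxy => EqvGen.rel _ _ ?_
        obtain ⟨d, h1, h2⟩ := exists_dart_of_sphereLink hxy
        have key : (M.graph (t.edgeEquiv ⁻¹' W)).Reachable
            (t.vertexEquiv.symm (t.sphereOrg d))
            (t.vertexEquiv.symm (t.sphereOrg (M.next d))) := by
          rw [← vertexEquiv_origin, ← vertexEquiv_origin, Equiv.symm_apply_apply,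
            Equiv.symm_apply_apply, ← CombMap.target_eq]
          by_cases hd : M.origin d = M.target d
          · rw [← hd]
          · exact SimpleGraph.Adj.reachable ((M.graph_adj).2 ⟨hd, d, h1, rfl, rfl⟩)
        rcases h2 with ⟨rfl, rfl⟩ | ⟨rfl, rfl⟩
        · exact key
        · exact key.symm
      rw [Equiv.symm_apply_apply, Equiv.symm_apply_apply] at h'
      exact (SimpleGraph.reachable_is_equivalence _).eqvGen_iff.1 h'
  have hcard : (t.edgeEquiv ⁻¹' W).ncard = (Sum.inl ⁻¹' W : Set (Fin 3)).ncard +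
      (Sum.inr ⁻¹' W : Set t.InnerEdge).ncard := by
    rw [Set.ncard_preimage_of_injective_subset_range t.edgeEquiv.injective
      (by rw [t.edgeEquiv.surjective.range_eq]; exact Set.subset_univ _)]
    conv_lhs => rw [← Set.image_preimage_inl_union_image_preimage_inr W]
    rw [Set.ncard_union_eq, Set.ncard_image_of_injective _ Sum.inl_injective,
      Set.ncard_image_of_injective _ Sum.inr_injective]
    rw [Set.disjoint_left]
    rintro _ ⟨i, -, rfl⟩ ⟨e, -, h⟩
    cases h
  rw [M.isSpanningTree_iff, card_vertex_glue, hcard]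
  refine and_congr ⟨fun h x y => ?_, fun h => ?_⟩ (by omega)
  · have := (hreach (t.vertexEquiv.symm x) (t.vertexEquiv.symm y)).1 (h.preconnected _ _)
    rwa [Equiv.apply_symm_apply, Equiv.apply_symm_apply] at this
  · have : Nonempty M.Vertex := ⟨M.origin (Sum.inr (t.side 0))⟩
    exact ⟨fun u v => (hreach u v).2 (h _ _)⟩

end TernaryTree

/-! ### Partitions of the corners induced by forests -/

open Relation (EqvGen)

/-- The partitions of the three corners of a triangle; `pair i` has the blocks `{i, i + 1}` and
`{i + 2}`. -/
inductive CornerState : Type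
  | sep : CornerState
  | pair (i : Fin 3) : CornerState
  | full : CornerState
  deriving DecidableEq, Fintype

namespace CornerState

/-- Whether two corners are in the same block. -/
def rel : CornerState → Fin 3 → Fin 3 → Bool
  | sep => fun k l => k = l
  | pair i => fun k l => k = l ∨ (k ≠ i + 2 ∧ l ≠ i + 2)
  | full => fun _ _ => true

/-- Pairs of corners that generate the partition, as few as possible. -/
def pairs : CornerState → List (Fin 3 × Fin 3)
  | sep => []
  | pair i => [(i, i + 1)]
  | full => [(0, 1), (1, 2)]

/-- Three minus the number of blocks. -/
def rank : CornerState → ℕ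
  | sep => 0
  | pair _ => 1
  | full => 2

/-- The partition of the corners given by a labelling. -/
def ofLabels {Q : Type} [DecidableEq Q] (L : Fin 3 → Q) : CornerState :=
  if L 0 = L 1 then if L 1 = L 2 then full else pair 0
  else if L 1 = L 2 then pair 1 else if L 2 = L 0 then pair 2 else sep

theorem rel_ofLabels {Q : Type} [DecidableEq Q] (L : Fin 3 → Q) (k l : Fin 3) :
    (ofLabels L).rel k l ↔ L k = L l := by
  by_cases h01 : L 0 = L 1 <;> by_cases h12 : L 1 = L 2 <;> by_cases h20 : L 2 = L 0 <;>
    fin_cases k <;> fin_cases l <;> simp_all [ofLabels, rel]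
  all_goals first
    | exact fun h => h01 h.symm
    | exact fun h => h12 h.symm
    | exact fun h => h20 h.symm

theorem eq_of_rel : ∀ s s' : CornerState, (∀ k l, s.rel k l = s'.rel k l) → s = s' := by
  decide

theorem length_pairs (s : CornerState) : s.pairs.length = s.rank := by cases s <;> rfl

theorem rel_iff_mergeLabels : ∀ (s : CornerState) (k l : Fin 3),
    s.rel k l ↔ mergeLabels s.pairs k = mergeLabels s.pairs l := by decide

theorem rel_iff (s : CornerState) (k l : Fin 3) :
    s.rel k l ↔ EqvGen (fun a b => (a, b) ∈ s.pairs) k l :=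
  (rel_iff_mergeLabels s k l).trans mergeLabels_eq_iff

/-- Every equivalence relation on the corners is one of the five partitions. -/
theorem exists_rel {r : Fin 3 → Fin 3 → Prop} (h : Equivalence r) :
    ∃ s : CornerState, ∀ k l, s.rel k l ↔ r k l := by
  classical
  refine ⟨ofLabels fun k => {l | r k l}, fun k l => (rel_ofLabels _ k l).trans ⟨fun h1 => ?_, ?_⟩⟩
  · exact (Set.ext_iff.1 h1 l).2 (h.refl l)
  · intro h1
    ext m
    exact ⟨fun h2 => h.trans (h.symm h1) h2, fun h2 => h.trans h1 h2⟩

end CornerState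

open CornerState

/-- The corners of the child `i` among the corners `some j` of the node and the new vertex. -/
def childCorner (i : Fin 3) : Fin 3 → Option (Fin 3)
  | 0 => some i
  | 1 => some (i + 1)
  | 2 => none

/-- The pairs of vertices that are joined by the chosen spokes and by the partitions of the corners
of the children. -/
def nodePairs (b : Fin 3 → Bool) (p : Fin 3 → CornerState) :
    List (Option (Fin 3) × Option (Fin 3)) :=
  (List.finRange 3).flatMap fun i => (if b i then [(some i, none)] else []) ++
    (p i).pairs.map (Prod.map (childCorner i) (childCorner i))

/-- The resulting partition of the corners of the node. -/
def nodeState (b : Fin 3 → Bool) (p : Fin 3 → CornerState) : CornerState :=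
  ofLabels fun k => mergeLabels (nodePairs b p) (some k)

/-- Whether the new vertex is connected to a corner. -/
def nodeAttached (b : Fin 3 → Bool) (p : Fin 3 → CornerState) : Bool :=
  decide (∃ k, mergeLabels (nodePairs b p) none = mergeLabels (nodePairs b p) (some k))

/-- Whether the chosen spokes and forests with partitions `p` in the children form a forest with
partition `s` in which the new vertex is connected to a corner. -/
def nodeOK (s : CornerState) (b : Fin 3 → Bool) (p : Fin 3 → CornerState) : Bool :=
  nodeAttached b p && (nodeState b p == s && (nodePairs b p).length == 1 + s.rank)

set_option maxRecDepth 100000 in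
theorem rank_nodeState_lt : ∀ (b : Fin 3 → Bool) (p : Fin 3 → CornerState),
    nodeAttached b p = true → 1 + (nodeState b p).rank ≤ (nodePairs b p).length := by
  decide +kernel

theorem length_nodePairs (b : Fin 3 → Bool) (p : Fin 3 → CornerState) :
    (nodePairs b p).length = (∑ i, if b i then 1 else 0) + ∑ i, (p i).rank := by
  rw [nodePairs, List.length_flatMap, ← Finset.sum_add_distrib, ← Fin.sum_univ_def]
  refine Finset.sum_congr rfl fun i _ => ?_
  rw [List.length_append, List.length_map, length_pairs]
  split_ifs <;> rfl

theorem mem_nodePairs {b : Fin 3 → Bool} {p : Fin 3 → CornerState} {x y : Option (Fin 3)} :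
    (x, y) ∈ nodePairs b p ↔ (∃ i, b i = true ∧ x = some i ∧ y = none) ∨
      ∃ i k l, (k, l) ∈ (p i).pairs ∧ x = childCorner i k ∧ y = childCorner i l := by
  simp only [nodePairs, List.mem_flatMap, List.mem_finRange, true_and, List.mem_append,
    List.mem_map, Prod.exists, Prod.map_apply, Prod.mk.injEq]
  constructor
  · rintro ⟨i, h | ⟨k, l, h1, h2, h3⟩⟩
    · split_ifs at h with hb
      · left
        simp only [List.mem_singleton, Prod.mk.injEq] at h
        exact ⟨i, hb, h.1, h.2⟩
      · cases h
    · exact Or.inr ⟨i, k, l, h1, h2.symm, h3.symm⟩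
  · rintro (⟨i, h1, rfl, rfl⟩ | ⟨i, k, l, h, rfl, rfl⟩)
    · exact ⟨i, Or.inl (by simp [h1])⟩
    · exact ⟨i, Or.inr ⟨k, l, h, rfl, rfl⟩⟩

namespace TernaryTree

/-- The interior vertices are all connected to corners. -/
def Attached (t : TernaryTree) (T : Set t.InnerEdge) : Prop :=
  ∀ x, ∃ k, EqvGen (t.Link T) x (Sum.inl k)

/-- The set `T` of interior edges is a forest each of whose components has a corner, and `s` is the
partition of the corners into components. That there are no cycles is expressed by the number of
edges. -/
def IsForest (t : TernaryTree) (s : CornerState) (T : Set t.InnerEdge) : Prop :=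
  t.Attached T ∧ (∀ k l, s.rel k l ↔ EqvGen (t.Link T) (Sum.inl k) (Sum.inl l)) ∧
    T.ncard = t.size + s.rank

/-- The set of edges of a node that consists of the spokes in `b` and edges inside the children. -/
def joinSet (c : Fin 3 → TernaryTree) (b : Fin 3 → Bool) (T : ∀ i, Set (c i).InnerEdge) :
    Set (node c).InnerEdge :=
  {e : Fin 3 ⊕ Σ i, (c i).InnerEdge | Sum.elim (fun i => b i = true) (fun e => e.2 ∈ T e.1) e}

theorem ncard_joinSet (c : Fin 3 → TernaryTree) (b : Fin 3 → Bool)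
    (T : ∀ i, Set (c i).InnerEdge) :
    (joinSet c b T).ncard = (∑ i, if b i then 1 else 0) + ∑ i, (T i).ncard := by
  have e : joinSet c b T ≃ {i // b i = true} ⊕ Σ i, T i :=
    { toFun := fun x => match x with
        | ⟨Sum.inl i, h⟩ => Sum.inl ⟨i, h⟩
        | ⟨Sum.inr e, h⟩ => Sum.inr ⟨e.1, e.2, h⟩
      invFun := fun x => match x with
        | Sum.inl i => ⟨Sum.inl i.1, i.2⟩
        | Sum.inr e => ⟨Sum.inr ⟨e.1, e.2.1⟩, e.2.2⟩
      left_inv := by rintro ⟨i | e, h⟩ <;> rfl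
      right_inv := by rintro (i | e) <;> rfl }
  rw [← Nat.card_coe_set_eq, Nat.card_congr e, Nat.card_sum, Nat.card_sigma]
  congr 1
  rw [Nat.card_eq_fintype_card, Fintype.card_subtype, Finset.card_filter]

/-- The forest of a node as a graph glued from the children. -/
def nodeGraph (c : Fin 3 → TernaryTree) (b : Fin 3 → Bool) (T : ∀ i, Set (c i).InnerEdge) :
    GluedGraph (node c).Vertex (Option (Fin 3)) (Fin 3) (fun i => (c i).Inner) where
  κ := childCorner
  ι q := q.elim (Sum.inr (none : Option _)) Sum.inl
  em := embed c
  coord x := match x with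
    | Sum.inl i => Sum.inl (some i)
    | Sum.inr x => Option.elim (show Option (Σ i, (c i).Inner) from x) (Sum.inl none) Sum.inr
  em_corner j k := by fin_cases k <;> rfl
  coord_ι q := by cases q <;> rfl
  coord_em j x := rfl
  R₀ q q' := ∃ i, b i = true ∧ q = some i ∧ q' = none
  R i := (c i).Link (T i)

theorem rel_nodeGraph (c : Fin 3 → TernaryTree) (b : Fin 3 → Bool)
    (T : ∀ i, Set (c i).InnerEdge) : (nodeGraph c b T).Rel = (node c).Link (joinSet c b T) := by
  funext x y
  refine propext ⟨?_, ?_⟩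
  · rintro (⟨_, _, ⟨i, h, rfl, rfl⟩, rfl, rfl⟩ | ⟨j, x, y, ⟨e, he, hx⟩, rfl, rfl⟩)
    · exact ⟨(Sum.inl i : Fin 3 ⊕ Σ i, (c i).InnerEdge), h, ends_spoke c i⟩
    · refine ⟨(Sum.inr ⟨j, e⟩ : Fin 3 ⊕ Σ i, (c i).InnerEdge), he, (ends_inr c j e).trans ?_⟩
      rw [hx]; rfl
  · rintro ⟨i | ⟨j, e⟩, he, h⟩
    · have h' := (ends_spoke c i).symm.trans h
      exact Or.inl ⟨some i, none, ⟨i, he, rfl, rfl⟩, (Prod.mk.inj h').1.symm,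
        (Prod.mk.inj h').2.symm⟩
    · have h' := (ends_inr c j e).symm.trans h
      exact Or.inr ⟨j, _, _, ⟨e, he, rfl⟩, (Prod.mk.inj h').1.symm, (Prod.mk.inj h').2.symm⟩

/-- The relation on the corners and the centre of a node that is induced by a set of edges depends
on the parts in the children only through their states. -/
theorem local_nodeGraph {c : Fin 3 → TernaryTree} {b : Fin 3 → Bool}
    {T : ∀ i, Set (c i).InnerEdge} {p : Fin 3 → CornerState}
    (hp : ∀ i k l, (p i).rel k l ↔ EqvGen ((c i).Link (T i)) (Sum.inl k) (Sum.inl l))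
    (q q' : Option (Fin 3)) : EqvGen (nodeGraph c b T).Local q q' ↔
      mergeLabels (nodePairs b p) q = mergeLabels (nodePairs b p) q' := by
  rw [mergeLabels_eq_iff]
  constructor
  · refine fun h => Relation.EqvGen.lift (f := fun x => x) (fun x y hxy => ?_) h
    rcases hxy with hxy | ⟨i, k, l, hkl, rfl, rfl⟩
    · exact EqvGen.rel _ _ (mem_nodePairs.2 (Or.inl hxy))
    · refine Relation.EqvGen.lift (f := childCorner i) (fun x y hxy => ?_)
        ((rel_iff _ _ _).1 ((hp i k l).2 hkl))
      exact EqvGen.rel _ _ (mem_nodePairs.2 (Or.inr ⟨i, x, y, hxy, rfl, rfl⟩))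
  · refine fun h => Relation.EqvGen.lift (f := fun x => x) (fun x y hxy => ?_) h
    rcases mem_nodePairs.1 hxy with hxy | ⟨i, k, l, hkl, rfl, rfl⟩
    · exact EqvGen.rel _ _ (Or.inl hxy)
    · refine EqvGen.rel _ _ (Or.inr ⟨i, k, l, (hp i k l).1 ?_, rfl, rfl⟩)
      exact (rel_iff _ _ _).2 (EqvGen.rel _ _ hkl)

theorem exists_state (t : TernaryTree) (T : Set t.InnerEdge) : ∃ s : CornerState,
    ∀ k l, s.rel k l ↔ EqvGen (t.Link T) (Sum.inl k) (Sum.inl l) :=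
  exists_rel ⟨fun _ => EqvGen.refl _, fun h => h.symm, fun h h' => h.trans _ _ _ h'⟩

theorem attached_joinSet {c : Fin 3 → TernaryTree} {b : Fin 3 → Bool}
    {T : ∀ i, Set (c i).InnerEdge} {p : Fin 3 → CornerState}
    (hp : ∀ i k l, (p i).rel k l ↔ EqvGen ((c i).Link (T i)) (Sum.inl k) (Sum.inl l)) :
    (node c).Attached (joinSet c b T) ↔ (∀ i, (c i).Attached (T i)) ∧ nodeAttached b p := by
  set G := nodeGraph c b T with hG
  have hnone : nodeAttached b p ↔
      ∃ k, EqvGen ((node c).Link (joinSet c b T)) (Sum.inr (none : Option _)) (Sum.inl k) := by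
    rw [nodeAttached, decide_eq_true_iff]
    refine exists_congr fun k => ?_
    rw [← local_nodeGraph hp, ← G.local_iff, rel_nodeGraph]
    rfl
  constructor
  · intro h
    refine ⟨fun i x => ?_, hnone.2 (h _)⟩
    obtain ⟨k, hk⟩ := h (embed c i x)
    rw [← rel_nodeGraph] at hk
    exact G.exists_corner (j := i) (q := some k) hk
  · rintro ⟨h1, h2⟩
    have hQ : ∀ q, ∃ k, EqvGen ((node c).Link (joinSet c b T)) (G.ι q) (Sum.inl k) := by
      rintro (_ | k)
      · exact hnone.1 h2
      · exact ⟨k, EqvGen.refl _⟩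
    rintro (k | (_ | ⟨i, x⟩))
    · exact ⟨k, EqvGen.refl _⟩
    · exact hQ none
    · obtain ⟨l, hl⟩ := h1 i (Sum.inr x)
      obtain ⟨k, hk⟩ := hQ (childCorner i l)
      have h3 := G.rel_of_piece (j := i) hl
      rw [G.em_corner, rel_nodeGraph] at h3
      exact ⟨k, h3.trans _ _ _ hk⟩

theorem state_joinSet {c : Fin 3 → TernaryTree} {b : Fin 3 → Bool}
    {T : ∀ i, Set (c i).InnerEdge} {p : Fin 3 → CornerState}
    (hp : ∀ i k l, (p i).rel k l ↔ EqvGen ((c i).Link (T i)) (Sum.inl k) (Sum.inl l))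
    (k l : Fin 3) : (nodeState b p).rel k l ↔
      EqvGen ((node c).Link (joinSet c b T)) (Sum.inl k) (Sum.inl l) := by
  rw [nodeState, rel_ofLabels, ← local_nodeGraph hp, ← GluedGraph.local_iff, rel_nodeGraph]
  rfl

theorem exists_joinSet (c : Fin 3 → TernaryTree) (T : Set (node c).InnerEdge) :
    ∃ b T', T = joinSet c b T' := by
  classical
  refine ⟨fun i => decide ((Sum.inl i : Fin 3 ⊕ Σ i, (c i).InnerEdge) ∈ T),
    fun i => {e | (Sum.inr ⟨i, e⟩ : Fin 3 ⊕ Σ i, (c i).InnerEdge) ∈ T}, ?_⟩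
  ext e
  rcases e with i | ⟨i, e⟩
  · exact (decide_eq_true_iff (p := (Sum.inl i : Fin 3 ⊕ Σ i, (c i).InnerEdge) ∈ T)).symm
  · exact Iff.rfl

theorem joinSet_injective {c : Fin 3 → TernaryTree} {b b' : Fin 3 → Bool}
    {T T' : ∀ i, Set (c i).InnerEdge} (h : joinSet c b T = joinSet c b' T') :
    b = b' ∧ T = T' := by
  constructor
  · funext i
    exact Bool.eq_iff_iff.2 (Set.ext_iff.1 h (Sum.inl i : Fin 3 ⊕ Σ i, (c i).InnerEdge))
  · funext i
    ext e
    exact Set.ext_iff.1 h (Sum.inr ⟨i, e⟩ : Fin 3 ⊕ Σ i, (c i).InnerEdge)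

/-- If all interior vertices are connected to corners then there are at least as many edges as in a
forest. -/
theorem size_add_rank_le (t : TernaryTree) {T : Set t.InnerEdge} (h : t.Attached T)
    {s : CornerState} (hs : ∀ k l, s.rel k l ↔ EqvGen (t.Link T) (Sum.inl k) (Sum.inl l)) :
    t.size + s.rank ≤ T.ncard := by
  induction t generalizing s with
  | leaf =>
    have : s = sep := by
      refine eq_of_rel _ _ fun k l => Bool.eq_iff_iff.2 ((hs k l).trans ⟨fun h => ?_, fun h => ?_⟩)
      · have : ∀ x y, EqvGen (leaf.Link T) x y → x = y := fun x y h =>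
          h.eq_of_invariant (f := id) fun _ _ h => nomatch (h.choose : Empty)
        simpa [rel] using this _ _ h
      · have : k = l := by simpa [rel] using h
        rw [this]; exact EqvGen.refl _
    subst this
    exact Nat.zero_le _
  | node c ih =>
    obtain ⟨b, T, rfl⟩ := exists_joinSet c T
    choose p hp using fun i => exists_state (c i) (T i)
    obtain ⟨h1, h2⟩ := (attached_joinSet hp).1 h
    have hs' : s = nodeState b p := eq_of_rel _ _ fun k l =>
      Bool.eq_iff_iff.2 ((hs k l).trans (state_joinSet hp k l).symm)
    have h3 := rank_nodeState_lt b p h2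
    rw [length_nodePairs, ← hs'] at h3
    have h4 : ∑ i, ((c i).size + (p i).rank) ≤ ∑ i, (T i).ncard :=
      Finset.sum_le_sum fun i _ => ih i (h1 i) (hp i)
    rw [Finset.sum_add_distrib] at h4
    rw [ncard_joinSet, size]
    omega

/-- A set of edges of a node is a forest exactly if its parts in the children are forests that fit
together. -/
theorem isForest_joinSet {c : Fin 3 → TernaryTree} {b : Fin 3 → Bool}
    {T : ∀ i, Set (c i).InnerEdge} {s : CornerState} :
    (node c).IsForest s (joinSet c b T) ↔
      ∃ p, nodeOK s b p = true ∧ ∀ i, (c i).IsForest (p i) (T i) := by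
  constructor
  · rintro ⟨h1, h2, h3⟩
    choose p hp using fun i => exists_state (c i) (T i)
    obtain ⟨h4, h5⟩ := (attached_joinSet hp).1 h1
    have hs' : nodeState b p = s := eq_of_rel _ _ fun k l =>
      Bool.eq_iff_iff.2 ((state_joinSet hp k l).trans (h2 k l).symm)
    have h6 := rank_nodeState_lt b p h5
    rw [length_nodePairs, hs'] at h6
    have h7 : ∀ i, (c i).size + (p i).rank ≤ (T i).ncard := fun i =>
      size_add_rank_le _ (h4 i) (hp i)
    have h8 := Finset.sum_le_sum fun i (_ : i ∈ Finset.univ) => h7 i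
    rw [ncard_joinSet, size] at h3
    rw [Finset.sum_add_distrib] at h8
    -- The children satisfy inequalities whose sum is an equality, so that each is an equality.
    have h9 : ∀ i, (c i).size + (p i).rank = (T i).ncard := fun i =>
      (Finset.sum_eq_sum_iff_of_le fun i (_ : i ∈ Finset.univ) => h7 i).1
        (by rw [Finset.sum_add_distrib]; omega) i (Finset.mem_univ i)
    refine ⟨p, ?_, fun i => ⟨h4 i, hp i, (h9 i).symm⟩⟩
    simp only [nodeOK, Bool.and_eq_true, beq_iff_eq]
    exact ⟨h5, hs', by rw [length_nodePairs]; omega⟩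
  · rintro ⟨p, h1, h2⟩
    simp only [nodeOK, Bool.and_eq_true, beq_iff_eq] at h1
    obtain ⟨h3, h4, h5⟩ := h1
    have hp := fun i => (h2 i).2.1
    refine ⟨(attached_joinSet hp).2 ⟨fun i => (h2 i).1, h3⟩, fun k l => ?_, ?_⟩
    · rw [← h4]; exact state_joinSet hp k l
    · rw [ncard_joinSet, size]
      have : ∑ i, (T i).ncard = ∑ i, ((c i).size + (p i).rank) :=
        Finset.sum_congr rfl fun i _ => (h2 i).2.2
      rw [this, Finset.sum_add_distrib]
      rw [length_nodePairs] at h5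
      omega

theorem IsForest.unique {t : TernaryTree} {T : Set t.InnerEdge} {s s' : CornerState}
    (h : t.IsForest s T) (h' : t.IsForest s' T) : s = s' :=
  eq_of_rel _ _ fun k l => Bool.eq_iff_iff.2 ((h.2.1 k l).trans (h'.2.1 k l).symm)

/-- The number of forests that induce a given partition of the corners. -/
noncomputable def forestCount (t : TernaryTree) (s : CornerState) : ℕ :=
  {T | t.IsForest s T}.ncard

theorem forestCount_leaf (s : CornerState) : leaf.forestCount s = if s = sep then 1 else 0 := by
  have hempty : ∀ T : Set leaf.InnerEdge, T = ∅ := fun T =>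
    Set.eq_empty_of_forall_notMem fun e => nomatch (e : Empty)
  have h : leaf.IsForest s ∅ ↔ s = sep := by
    have hl : ∀ x y, EqvGen (leaf.Link ∅) x y → x = y := fun x y h =>
      h.eq_of_invariant (f := id) fun _ _ h => nomatch (h.choose : Empty)
    constructor
    · rintro ⟨-, h, -⟩
      refine eq_of_rel _ _ fun k l => Bool.eq_iff_iff.2 ((h k l).trans ⟨fun h => ?_, fun h => ?_⟩)
      · simpa [rel] using hl _ _ h
      · have : k = l := by simpa [rel] using h
        rw [this]; exact EqvGen.refl _
    · rintro rfl
      refine ⟨fun x => ?_, fun k l => ⟨fun h => ?_, fun h => ?_⟩, ?_⟩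
      · rcases x with k | x
        · exact ⟨k, EqvGen.refl _⟩
        · exact nomatch (x : Empty)
      · have : k = l := by simpa [rel] using h
        rw [this]; exact EqvGen.refl _
      · simpa [rel] using hl _ _ h
      · simp [size, rank]
  have hset : {T | leaf.IsForest s T} = {T | s = sep} := by
    ext T
    rw [Set.mem_ofPred_eq, Set.mem_ofPred_eq, hempty T, h]
  rw [forestCount, hset]
  split_ifs with hs
  · rw [Set.ncard_eq_one]
    refine ⟨∅, ?_⟩
    ext T
    simp [hs, hempty T]
  · simp [hs]

theorem forestCount_node (c : Fin 3 → TernaryTree) (s : CornerState) :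
    (node c).forestCount s =
      ∑ x : (Fin 3 → Bool) × (Fin 3 → CornerState) with nodeOK s x.1 x.2 = true,
        ∏ i, (c i).forestCount (x.2 i) := by
  classical
  let X := {x : (Fin 3 → Bool) × (Fin 3 → CornerState) // nodeOK s x.1 x.2 = true}
  let f : (Σ x : X, ∀ i, {T | (c i).IsForest (x.1.2 i) T}) → {T | (node c).IsForest s T} :=
    fun y => ⟨joinSet c y.1.1.1 fun i => (y.2 i).1,
      isForest_joinSet.2 ⟨y.1.1.2, y.1.2, fun i => (y.2 i).2⟩⟩
  have hf : Function.Bijective f := by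
    constructor
    · rintro ⟨⟨⟨b, p⟩, h⟩, T⟩ ⟨⟨⟨b', p'⟩, h'⟩, T'⟩ hT
      obtain ⟨h1, h2⟩ := joinSet_injective (c := c) (T := fun i => (T i).1)
        (T' := fun i => (T' i).1) (congrArg Subtype.val hT)
      obtain rfl : b = b' := h1
      have h3 : ∀ i, (T i).1 = (T' i).1 := fun i => congrFun h2 i
      obtain rfl : p = p' := funext fun i => (T i).2.unique (by rw [h3 i]; exact (T' i).2)
      obtain rfl : T = T' := funext fun i => Subtype.ext (h3 i)
      rfl
    · rintro ⟨T, hT⟩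
      obtain ⟨b, T, rfl⟩ := exists_joinSet c T
      obtain ⟨p, h1, h2⟩ := isForest_joinSet.1 hT
      exact ⟨⟨⟨(b, p), h1⟩, fun i => ⟨T i, h2 i⟩⟩, rfl⟩
  rw [forestCount, ← Nat.card_coe_set_eq, ← Nat.card_congr (Equiv.ofBijective f hf), Nat.card_sigma,
    Finset.sum_subtype (p := fun x : (Fin 3 → Bool) × (Fin 3 → CornerState) =>
      nodeOK s x.1 x.2 = true) _ (by simp)]
  refine Finset.sum_congr rfl fun x _ => ?_
  rw [Nat.card_pi]
  rfl

end TernaryTree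

/-- The pairs of corners that are joined by the chosen sides and by the forest inside. -/
def spherePairs (b : Fin 3 → Bool) (s : CornerState) : List (Fin 3 × Fin 3) :=
  ((List.finRange 3).flatMap fun i => if b i then [(i, i + 1)] else []) ++ s.pairs

/-- Whether the chosen sides and a forest with partition `s` form a spanning tree. -/
def sphereOK (b : Fin 3 → Bool) (s : CornerState) : Bool :=
  decide (∀ k l, mergeLabels (spherePairs b s) k = mergeLabels (spherePairs b s) l) &&
    (spherePairs b s).length == 2

theorem two_le_length_spherePairs : ∀ (b : Fin 3 → Bool) (s : CornerState),
    (∀ k l, mergeLabels (spherePairs b s) k = mergeLabels (spherePairs b s) l) →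
      2 ≤ (spherePairs b s).length := by
  decide +kernel

theorem mem_spherePairs {b : Fin 3 → Bool} {s : CornerState} {x y : Fin 3} :
    (x, y) ∈ spherePairs b s ↔ (∃ i, b i = true ∧ x = i ∧ y = i + 1) ∨ (x, y) ∈ s.pairs := by
  simp only [spherePairs, List.mem_append, List.mem_flatMap, List.mem_finRange, true_and]
  refine or_congr_left (exists_congr fun i => ?_)
  split_ifs with h <;> simp [h]

theorem length_spherePairs (b : Fin 3 → Bool) (s : CornerState) :
    (spherePairs b s).length = (∑ i, if b i then 1 else 0) + s.rank := by
  rw [spherePairs, List.length_append, length_pairs, List.length_flatMap, ← Fin.sum_univ_def]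
  congr 1
  refine Finset.sum_congr rfl fun i _ => ?_
  split_ifs <;> rfl

namespace TernaryTree

/-- The triangulation of a tree as a graph glued from the triangle and its interior. -/
def sphereGraph (t : TernaryTree) (b : Fin 3 → Bool) (T : Set t.InnerEdge) :
    GluedGraph t.Vertex (Fin 3) Unit (fun _ => t.Inner) where
  κ _ k := k
  ι := Sum.inl
  em _ x := x
  coord x := x.elim Sum.inl fun y => Sum.inr ⟨(), y⟩
  em_corner _ _ := rfl
  coord_ι _ := rfl
  coord_em _ _ := rfl
  R₀ q q' := ∃ i, b i = true ∧ q = i ∧ q' = i + 1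
  R _ := t.Link T

theorem rel_sphereGraph (t : TernaryTree) (b : Fin 3 → Bool) (T : Set t.InnerEdge) :
    (t.sphereGraph b T).Rel = t.SphereLink {i | b i = true} T := by
  funext x y
  refine propext ⟨?_, ?_⟩
  · rintro (⟨_, _, ⟨i, h, rfl, rfl⟩, rfl, rfl⟩ | ⟨_, x, y, h, rfl, rfl⟩)
    · exact Or.inl ⟨_, h, rfl, rfl⟩
    · exact Or.inr h
  · rintro (⟨i, h, rfl, rfl⟩ | h)
    · exact Or.inl ⟨_, _, ⟨i, h, rfl, rfl⟩, rfl, rfl⟩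
    · exact Or.inr ⟨(), x, y, h, rfl, rfl⟩

theorem local_sphereGraph {t : TernaryTree} {b : Fin 3 → Bool} {T : Set t.InnerEdge}
    {s : CornerState} (hs : ∀ k l, s.rel k l ↔ EqvGen (t.Link T) (Sum.inl k) (Sum.inl l))
    (k l : Fin 3) : EqvGen (t.SphereLink {i | b i = true} T) (Sum.inl k) (Sum.inl l) ↔
      mergeLabels (spherePairs b s) k = mergeLabels (spherePairs b s) l := by
  rw [← rel_sphereGraph, mergeLabels_eq_iff]
  refine (t.sphereGraph b T).local_iff.trans ⟨?_, ?_⟩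
  · refine fun h => Relation.EqvGen.lift (f := fun x => x) (fun x y hxy => ?_) h
    rcases hxy with hxy | ⟨_, k, l, hkl, rfl, rfl⟩
    · exact EqvGen.rel _ _ (mem_spherePairs.2 (Or.inl hxy))
    · exact ((rel_iff _ _ _).1 ((hs _ _).2 hkl)).mono fun x y h => mem_spherePairs.2 (Or.inr h)
  · refine fun h => Relation.EqvGen.lift (f := fun x => x) (fun x y hxy => ?_) h
    rcases mem_spherePairs.1 hxy with hxy | hxy
    · exact EqvGen.rel _ _ (Or.inl hxy)
    · refine EqvGen.rel _ _ (Or.inr ⟨(), x, y, (hs x y).1 ?_, rfl, rfl⟩)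
      exact (rel_iff _ _ _).2 (EqvGen.rel _ _ hxy)

/-- A choice of sides together with interior edges is a spanning tree exactly if the interior edges
are a forest that fits to the sides. -/
theorem connected_and_card_iff (t : TernaryTree) (b : Fin 3 → Bool) (T : Set t.InnerEdge) :
    ((∀ x y, EqvGen (t.SphereLink {i | b i = true} T) x y) ∧
      (∑ i, if b i then 1 else 0) + T.ncard = t.size + 2) ↔
    ∃ s, sphereOK b s = true ∧ t.IsForest s T := by
  constructor
  · rintro ⟨h1, h2⟩
    obtain ⟨s, hs⟩ := exists_state t T
    have h3 : ∀ k l, mergeLabels (spherePairs b s) k = mergeLabels (spherePairs b s) l :=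
      fun k l => (local_sphereGraph hs k l).1 (h1 _ _)
    have h4 : t.Attached T := fun x => by
      have := h1 x (Sum.inl 0)
      rw [← rel_sphereGraph] at this
      exact (t.sphereGraph b T).exists_corner (j := ()) (q := (0 : Fin 3)) this
    have h5 := two_le_length_spherePairs b s h3
    have h6 := t.size_add_rank_le h4 hs
    rw [length_spherePairs] at h5
    refine ⟨s, ?_, h4, hs, by omega⟩
    simp only [sphereOK, Bool.and_eq_true, beq_iff_eq, decide_eq_true_eq, length_spherePairs]
    exact ⟨h3, by omega⟩
  · rintro ⟨s, h1, h2, h3, h4⟩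
    simp only [sphereOK, Bool.and_eq_true, beq_iff_eq, decide_eq_true_eq,
      length_spherePairs] at h1
    refine ⟨?_, by omega⟩
    have h5 : ∀ x, EqvGen (t.SphereLink {i | b i = true} T) x (Sum.inl 0) := by
      intro x
      obtain ⟨k, hk⟩ := h2 x
      exact (hk.mono fun _ _ h => Or.inr h).trans _ _ _ ((local_sphereGraph h3 k 0).2 (h1.1 k 0))
    exact fun x y => (h5 x).trans _ _ _ (h5 y).symm

/-- The spanning trees that contain the root edge. -/
def rootedTrees (t : TernaryTree) : Set (Set (glue leaf t).Edge) :=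
  {U | (glue leaf t).IsSpanningTree U ∧ (glue leaf t).edge (Sum.inl (leaf.side 0)) ∈ U}

theorem ncard_rootedTrees (t : TernaryTree) : t.rootedTrees.ncard =
    2 * t.forestCount sep + (t.forestCount (pair 1) + t.forestCount (pair 2)) := by
  classical
  let X := {x : (Fin 3 → Bool) × CornerState // x.1 0 = true ∧ sphereOK x.1 x.2 = true}
  let W : (Fin 3 → Bool) → Set t.InnerEdge → Set (Fin 3 ⊕ t.InnerEdge) := fun b T =>
    {e | Sum.elim (fun i => b i = true) (· ∈ T) e}
  have hW : ∀ b T, (glue leaf t).IsSpanningTree (t.edgeEquiv ⁻¹' W b T) ↔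
      ∃ s, sphereOK b s = true ∧ t.IsForest s T := by
    intro b T
    rw [isSpanningTree_glue_iff, ← connected_and_card_iff]
    have h1 : (Sum.inl ⁻¹' W b T : Set (Fin 3)).ncard = ∑ i, if b i then 1 else 0 := by
      have : (Sum.inl ⁻¹' W b T : Set (Fin 3)) = {i | b i = true} := rfl
      rw [this, Set.ncard_eq_toFinset_card', ← Finset.card_filter]
      simp
    rw [h1]
    rfl
  let f : (Σ x : X, {T | t.IsForest x.1.2 T}) → t.rootedTrees := fun y =>
    ⟨t.edgeEquiv ⁻¹' W y.1.1.1 y.2.1, (hW _ _).2 ⟨_, y.1.2.2, y.2.2⟩, y.1.2.1⟩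
  have hf : Function.Bijective f := by
    constructor
    · rintro ⟨⟨⟨b, s⟩, h⟩, T, hT⟩ ⟨⟨⟨b', s'⟩, h'⟩, T', hT'⟩ he
      have h1 : t.edgeEquiv ⁻¹' W b T = t.edgeEquiv ⁻¹' W b' T' := congrArg Subtype.val he
      have h2 : W b T = W b' T' := (Set.preimage_injective.2 t.edgeEquiv.surjective) h1
      obtain rfl : b = b' := funext fun i =>
        Bool.eq_iff_iff.2 (Set.ext_iff.1 h2 (Sum.inl i))
      obtain rfl : T = T' := Set.ext fun e => Set.ext_iff.1 h2 (Sum.inr e)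
      obtain rfl : s = s' := IsForest.unique hT hT'
      rfl
    · rintro ⟨U, h1, h2⟩
      obtain ⟨b, T, rfl⟩ : ∃ b T, U = t.edgeEquiv ⁻¹' W b T := by
        refine ⟨fun i => decide (t.edgeEquiv.symm (Sum.inl i) ∈ U),
          {e | t.edgeEquiv.symm (Sum.inr e) ∈ U}, ?_⟩
        ext u
        obtain ⟨w, rfl⟩ := t.edgeEquiv.symm.surjective u
        rw [Set.mem_preimage, Equiv.apply_symm_apply]
        rcases w with i | e
        · exact (decide_eq_true_iff (p := t.edgeEquiv.symm (Sum.inl i) ∈ U)).symm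
        · exact Iff.rfl
      obtain ⟨s, h3, h4⟩ := (hW _ _).1 h1
      exact ⟨⟨⟨(b, s), h2, h3⟩, T, h4⟩, rfl⟩
  have hcount : ∑ x : (Fin 3 → Bool) × CornerState with x.1 0 = true ∧ sphereOK x.1 x.2 = true,
      t.forestCount x.2 = (Multiset.map t.forestCount
        {sep, sep, pair 1, pair 2}).sum := by
    rw [Finset.sum_eq_multiset_sum]
    refine Eq.trans (congrArg _ (Multiset.map_map t.forestCount Prod.snd _).symm) ?_
    congr 2
  rw [← Nat.card_coe_set_eq, ← Nat.card_congr (Equiv.ofBijective f hf), Nat.card_sigma]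
  have : ∑ x : X, Nat.card {T | t.IsForest x.1.2 T} = ∑ x : (Fin 3 → Bool) × CornerState with
      x.1 0 = true ∧ sphereOK x.1 x.2 = true, t.forestCount x.2 := by
    rw [Finset.sum_subtype (p := fun x : (Fin 3 → Bool) × CornerState =>
      x.1 0 = true ∧ sphereOK x.1 x.2 = true) _ (by simp)]
    rfl
  rw [this, hcount]
  simp
  ring

end TernaryTree

namespace CombMap

variable {D D' : Type} {M : CombMap D} {M' : CombMap D'} {e : D ≃ D'}

theorem origin_rot (d : D) : M.origin (M.rot d) = M.origin d :=
  (M.origin_eq_iff).2 (Equiv.Perm.sameCycle_apply_left.2 (Equiv.Perm.SameCycle.refl _ _))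

theorem Hom.origin_eq (h : M.Hom M' e) {d d' : D} (hd : M.origin d = M.origin d') :
    M'.origin (e d) = M'.origin (e d') :=
  eq_of_sameCycle (f := fun d => M'.origin (e d))
    (fun d => by rw [rot, Equiv.Perm.mul_apply, h.next, h.rev]; exact origin_rot _)
    ((M.origin_eq_iff).1 hd)

/-- The bijection between the vertices of isomorphic maps. -/
def Hom.vertexEquiv (h : M.Hom M' e) : M.Vertex ≃ M'.Vertex :=
  Quotient.congr e fun d d' => by
    refine (M.origin_eq_iff).symm.trans (Iff.trans ⟨h.origin_eq, fun hd => ?_⟩ M'.origin_eq_iff)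
    simpa using h.symm.origin_eq hd

theorem Hom.vertexEquiv_origin (h : M.Hom M' e) (d : D) :
    h.vertexEquiv (M.origin d) = M'.origin (e d) := rfl

theorem Hom.vertexEquiv_target (h : M.Hom M' e) (d : D) :
    h.vertexEquiv (M.target d) = M'.target (e d) := by
  rw [target, vertexEquiv_origin, h.rev]; rfl

theorem Hom.mem_edges_iff (h : M.Hom M' e) {T : Set M.Edge} (d : D) :
    M'.edge (e d) ∈ {u | ∃ d, M.edge d ∈ T ∧ M'.edge (e d) = u} ↔ M.edge d ∈ T := by
  constructor
  · rintro ⟨d', h1, h2⟩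
    rw [edge_eq_iff, ← h.rev, e.apply_eq_iff_eq, e.apply_eq_iff_eq, ← edge_eq_iff] at h2
    rwa [← h2]
  · exact fun hd => ⟨d, hd, rfl⟩

/-- Isomorphisms of maps transport spanning trees. -/
theorem IsSpanningTree.of_hom {T : Set M.Edge} (hT : M.IsSpanningTree T) (h : M.Hom M' e) :
    M'.IsSpanningTree {u | ∃ d, M.edge d ∈ T ∧ M'.edge (e d) = u} := by
  refine ⟨fun d d' hd hd' h1 h2 => ?_, ?_⟩
  · obtain ⟨d, rfl⟩ := e.surjective d
    obtain ⟨d', rfl⟩ := e.surjective d'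
    rw [← h.vertexEquiv_origin, ← h.vertexEquiv_origin, h.vertexEquiv.apply_eq_iff_eq] at h1
    rw [← h.vertexEquiv_target, ← h.vertexEquiv_target, h.vertexEquiv.apply_eq_iff_eq] at h2
    rw [hT.1 d d' ((h.mem_edges_iff d).1 hd) ((h.mem_edges_iff d').1 hd') h1 h2]
  · refine (SimpleGraph.Iso.isTree_iff ⟨h.vertexEquiv, ?_⟩).1 hT.2
    intro u v
    rw [graph_adj, graph_adj, h.vertexEquiv.apply_eq_iff_eq.ne]
    refine and_congr_right fun _ => ⟨?_, ?_⟩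
    · rintro ⟨d, h1, h2, h3⟩
      obtain ⟨d, rfl⟩ := e.surjective d
      rw [← h.vertexEquiv_origin, h.vertexEquiv.apply_eq_iff_eq] at h2
      rw [← h.vertexEquiv_target, h.vertexEquiv.apply_eq_iff_eq] at h3
      exact ⟨d, (h.mem_edges_iff d).1 h1, h2, h3⟩
    · rintro ⟨d, h1, rfl, rfl⟩
      exact ⟨e d, (h.mem_edges_iff d).2 h1, rfl, (h.vertexEquiv_target d).symm⟩

end CombMap

namespace TernaryTree

/-! ### Counting tree-decorated Apollonian triangulations -/

theorem finite_size_le (n : ℕ) : {t : TernaryTree | t.size ≤ n}.Finite := by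
  induction n with
  | zero =>
    refine (Set.finite_singleton leaf).subset fun t ht => ?_
    cases t with
    | leaf => rfl
    | node c => simp [size] at ht
  | succ n ih =>
    refine ((Set.finite_singleton leaf).union ((Set.Finite.pi' fun _ : Fin 3 => ih).image
      node)).subset fun t ht => ?_
    cases t with
    | leaf => exact Or.inl rfl
    | node c =>
      refine Or.inr ⟨c, fun i => ?_, rfl⟩
      have h1 : (c i).size ≤ ∑ i, (c i).size :=
        Finset.single_le_sum (f := fun i => (c i).size) (fun _ _ => Nat.zero_le _)
          (Finset.mem_univ i)
      have h2 : 1 + ∑ i, (c i).size ≤ n + 1 := ht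
      change (c i).size ≤ n
      omega

theorem finite_size_eq (n : ℕ) : {t : TernaryTree | t.size = n}.Finite :=
  Set.Finite.subset (finite_size_le n) fun t ht => by
    rw [Set.mem_ofPred_eq] at ht ⊢
    exact ht.le

/-- The ternary trees with `n` nodes. -/
noncomputable def ofSize (n : ℕ) : Finset TernaryTree := (finite_size_eq n).toFinset

@[simp] theorem mem_ofSize {n : ℕ} {t : TernaryTree} : t ∈ ofSize n ↔ t.size = n := by
  simp [ofSize]

/-- The rooted triangulation of a tree with a spanning tree. -/
def decorated {n : ℕ} (t : TernaryTree) (h : t.size + 2 = n) (U : t.rootedTrees) :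
    TreeDecorated n where
  Dart := leaf.Dart ⊕ t.Dart
  map := glue leaf t
  root := Sum.inl (leaf.side 0)
  tree := U.1
  planar := isPlanar_glue t
  triangulation := isTriangulation_glue leaf t
  card_vertex := by rw [card_vertex_glue]; omega
  spanning := U.2.1
  root_mem := U.2.2

/-- The class of the rooted triangulation of a tree with a spanning tree. -/
def toClass (n : ℕ) (x : Σ t : {t : TernaryTree // t.size + 2 = n}, t.1.rootedTrees) :
    TreeDecoratedTriangulation n :=
  Quotient.mk (TreeDecorated.isoSetoid n) (decorated x.1.1 x.1.2 x.2)

theorem toClass_injective (n : ℕ) : Function.Injective (toClass n) := by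
  rintro ⟨⟨t, ht⟩, U, hU⟩ ⟨⟨t', ht'⟩, U', hU'⟩ h
  obtain ⟨e, h1, h2, h3, h4⟩ := Quotient.exact h
  have he : CombMap.Hom (glue leaf t) (glue leaf t') e := ⟨h1, h2⟩
  obtain rfl := eq_of_hom he h3
  obtain rfl := hom_eq_refl he h3
  obtain rfl : U = U' := by
    ext u
    obtain ⟨d, rfl⟩ := CombMap.edge_surjective _ u
    exact h4 d
  rfl

theorem range_toClass (n : ℕ) : Set.range (toClass n) = apollonian n := by
  ext q
  constructor
  · rintro ⟨x, rfl⟩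
    exact ⟨_, isApollonian_glue x.1.1, rfl⟩
  · rintro ⟨s, hs, rfl⟩
    obtain ⟨t, e, he, hr⟩ := exists_hom_of_isApollonian hs s.root
    have hS := s.spanning.of_hom he
    set U : Set (glue leaf t).Edge :=
      {u | ∃ d, s.map.edge d ∈ s.tree ∧ (glue leaf t).edge (e d) = u}
      with hU
    have hmem : ∀ d, s.map.edge d ∈ s.tree ↔ (glue leaf t).edge (e d) ∈ U := fun d =>
      (he.mem_edges_iff d).symm
    refine ⟨⟨⟨t, ?_⟩, U, hS, ?_⟩, Quotient.sound ⟨e.symm, he.symm.rev, he.symm.next, ?_, ?_⟩⟩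
    · have h1 := card_vertex_glue t
      rw [← Nat.card_congr he.vertexEquiv, s.card_vertex] at h1
      omega
    · rw [← hr, ← hmem]; exact s.root_mem
    · exact (Equiv.symm_apply_eq _).2 hr.symm
    · intro d
      refine Iff.trans ?_ (hmem (e.symm d)).symm
      exact iff_of_eq (congrArg (fun d => (glue leaf t).edge d ∈ U) (e.apply_symm_apply d).symm)

instance finite_subtype_size (n : ℕ) : Finite {t : TernaryTree // t.size + 2 = n} := by
  have := (finite_size_le n).to_subtype
  refine Finite.of_injective (fun t => (⟨t.1, ?_⟩ : {t : TernaryTree | t.size ≤ n})) ?_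
  · rw [Set.mem_ofPred_eq]; have := t.2; omega
  · exact fun t t' h => Subtype.ext (congrArg (fun x : {t : TernaryTree | t.size ≤ n} => x.1) h)

theorem finite_apollonian (n : ℕ) : (apollonian n).Finite := by
  rw [← range_toClass]
  exact Set.finite_range _

/-- The number of tree-decorated Apollonian triangulations with `n + 3` vertices. -/
theorem ncard_apollonian (n : ℕ) : (apollonian (n + 2)).ncard =
    ∑ t ∈ ofSize n, (2 * t.forestCount sep +
      (t.forestCount (pair 1) + t.forestCount (pair 2))) := by
  rw [← range_toClass, ← Nat.card_coe_set_eq, Nat.card_range_of_injective (toClass_injective _)]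
  have := Fintype.ofFinite {t : TernaryTree // t.size + 2 = n + 2}
  rw [Nat.card_sigma, Finset.sum_subtype (p := fun t : TernaryTree => t.size + 2 = n + 2) (ofSize n)
    (by intro t; rw [mem_ofSize]; omega)]
  exact Finset.sum_congr rfl fun t _ => ncard_rootedTrees t.1

theorem ncard_apollonian_of_lt {n : ℕ} (h : n < 2) : (apollonian n).ncard = 0 := by
  rw [← range_toClass]
  have : IsEmpty {t : TernaryTree // t.size + 2 = n} := ⟨fun t => by have := t.2; omega⟩
  rw [Set.range_eq_empty, Set.ncard_empty]

end TernaryTree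

/-! ### Generating functions -/

namespace TernaryTree

open CornerState PowerSeries

theorem sum_ofSize_succ {R : Type*} [AddCommMonoid R] (n : ℕ) (f : TernaryTree → R) :
    ∑ t ∈ ofSize (n + 1), f t = ∑ l ∈ Finset.univ.finsuppAntidiag n,
      ∑ c ∈ Fintype.piFinset fun i : Fin 3 => ofSize (l i), f (node c) := by
  classical
  rw [Finset.sum_sigma']
  symm
  refine Finset.sum_bij (fun x _ => node x.2) ?_ ?_ ?_ fun _ _ => rfl
  · rintro ⟨l, c⟩ h
    rw [Finset.mem_sigma, Finset.mem_finsuppAntidiag, Fintype.mem_piFinset] at h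
    rw [mem_ofSize, size, ← h.1.1, add_comm]
    exact congrArg (· + 1) (Finset.sum_congr rfl fun i _ => mem_ofSize.1 (h.2 i))
  · rintro ⟨l, c⟩ h ⟨l', c'⟩ h' he
    obtain rfl : c = c' := by simpa using he
    rw [Finset.mem_sigma, Fintype.mem_piFinset] at h h'
    obtain rfl : l = l' := by
      ext i
      exact (mem_ofSize.1 (h.2 i)).symm.trans (mem_ofSize.1 (h'.2 i))
    rfl
  · intro t ht
    rw [mem_ofSize] at ht
    cases t with
    | leaf => simp [size] at ht
    | node c =>
      refine ⟨⟨Finsupp.equivFunOnFinite.symm fun i => (c i).size, c⟩, ?_, rfl⟩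
      rw [Finset.mem_sigma, Finset.mem_finsuppAntidiag, Fintype.mem_piFinset]
      refine ⟨⟨?_, Finset.subset_univ _⟩, fun i => mem_ofSize.2 rfl⟩
      rw [size] at ht
      exact Nat.add_left_cancel ((add_comm 1 n) ▸ ht)

/-- The generating function of the trees, counted by size, with weights `w`. -/
noncomputable def series (w : TernaryTree → ℚ) : ℚ⟦X⟧ := mk fun n => ∑ t ∈ ofSize n, w t

theorem coeff_prod_series (w : Fin 3 → TernaryTree → ℚ) (n : ℕ) :
    coeff n (∏ i, series (w i)) = ∑ l ∈ Finset.univ.finsuppAntidiag n,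
      ∑ c ∈ Fintype.piFinset fun i : Fin 3 => ofSize (l i), ∏ i, w i (c i) := by
  rw [coeff_prod]
  refine Finset.sum_congr rfl fun l _ => ?_
  simp only [series, coeff_mk]
  exact Finset.prod_univ_sum _ _

theorem ofSize_zero : ofSize 0 = {leaf} := by
  ext t
  rw [mem_ofSize, Finset.mem_singleton]
  cases t with
  | leaf => simp [size]
  | node c => simp [size]

/-- The generating function of the spanning forests that induce a given partition of the corners,
counted by the number of interior vertices. -/
noncomputable def forestSeries (s : CornerState) : ℚ⟦X⟧ := series fun t => t.forestCount s

/-- A forest in a node consists of a choice of spokes and of forests in the three children. -/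
theorem forestSeries_eq (s : CornerState) :
    forestSeries s = (if s = sep then 1 else 0) +
      X * ∑ x : (Fin 3 → Bool) × (Fin 3 → CornerState) with nodeOK s x.1 x.2 = true,
        ∏ i, forestSeries (x.2 i) := by
  ext n
  cases n with
  | zero =>
    rw [forestSeries, series, coeff_mk, ofSize_zero, Finset.sum_singleton, forestCount_leaf,
      map_add, coeff_zero_X_mul]
    split_ifs <;> simp
  | succ n =>
    rw [map_add, coeff_succ_X_mul, map_sum, forestSeries, series, coeff_mk, sum_ofSize_succ]
    have h0 : coeff (n + 1) (if s = sep then (1 : ℚ⟦X⟧) else 0) = 0 := by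
      split_ifs <;> simp [coeff_one]
    rw [h0, zero_add]
    simp only [forestSeries, coeff_prod_series, forestCount_node, Nat.cast_sum, Nat.cast_prod]
    rw [Finset.sum_comm]
    refine Finset.sum_congr rfl fun l _ => Finset.sum_comm

/-- The compatibility condition of a node is invariant under rotation. -/
theorem nodeOK_rotate : ∀ (j : Fin 3) (b : Fin 3 → Bool) (p : Fin 3 → CornerState),
    nodeOK (pair j) (fun i => b (i + 1)) (fun i => (match p (i + 1) with
      | sep => sep | pair k => pair k | full => full)) = nodeOK (pair (j + 1)) b p := by
  decide +kernel

/-- By rotational symmetry, the two corners that are joined do not matter. -/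
theorem forestSeries_pair (j : Fin 3) : forestSeries (pair j) = forestSeries (pair 0) := by
  have h : ∀ j, forestSeries (pair j) = forestSeries (pair (j + 1)) := by
    intro j
    rw [forestSeries_eq, forestSeries_eq (pair (j + 1))]
    simp only [reduceCtorEq, if_false, zero_add]
    congr 1
    refine (Finset.sum_equiv ((Equiv.arrowCongr (Equiv.addRight 1).symm (Equiv.refl _)).prodCongr
      (Equiv.arrowCongr (Equiv.addRight 1).symm (Equiv.refl _))) ?_ ?_).symm
    · rintro ⟨b, p⟩
      have := nodeOK_rotate j b p
      simp only [Finset.mem_filter, Finset.mem_univ, true_and]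
      rw [← this]
      refine iff_of_eq (congrArg (· = true) (congrArg (nodeOK _ _) ?_))
      funext i
      simp only [Equiv.prodCongr_apply, Prod.map, Equiv.arrowCongr_apply, Function.comp]
      simp
      cases p (i + 1) <;> rfl
    · rintro ⟨b, p⟩ _
      exact (Fintype.prod_equiv (Equiv.addRight 1) _ _ fun i => by simp).symm
  have h1 := h 0
  have h2 := h 1
  fin_cases j
  · rfl
  · exact h1.symm
  · exact (h1.trans h2).symm

/-- The numbers of children with separate corners and with two corners joined. -/
def profile (p : Fin 3 → CornerState) : ℕ × ℕ :=
  ((List.finRange 3).countP fun i => (p i).rank = 0,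
    (List.finRange 3).countP fun i => (p i).rank = 1)

theorem prod_forestSeries (p : Fin 3 → CornerState) :
    ∏ i, forestSeries (p i) = forestSeries sep ^ (profile p).1 *
      forestSeries (pair 0) ^ (profile p).2 *
      forestSeries full ^ (3 - (profile p).1 - (profile p).2) := by
  rw [Fin.prod_univ_three]
  have hl : List.finRange 3 = [0, 1, 2] := rfl
  simp only [profile, hl]
  cases h0 : p 0 <;> cases h1 : p 1 <;> cases h2 : p 2 <;>
    simp [h0, h1, h2, rank, forestSeries_pair, -mul_eq_mul_left_iff, -mul_eq_mul_right_iff] <;> ring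

/-- The sum over all ways to build a forest, grouped by the profiles of the children. -/
theorem forestSeries_eq_of_profiles (s : CornerState) (m : Multiset (ℕ × ℕ))
    (h : ((Finset.univ.filter fun x : (Fin 3 → Bool) × (Fin 3 → CornerState) =>
      nodeOK s x.1 x.2 = true).val.map fun x => profile x.2) = m) :
    forestSeries s = (if s = sep then 1 else 0) + X * (m.map fun a => forestSeries sep ^ a.1 *
      forestSeries (pair 0) ^ a.2 * forestSeries full ^ (3 - a.1 - a.2)).sum := by
  rw [← h, Multiset.map_map]
  refine (forestSeries_eq s).trans ?_
  congr 2
  exact Finset.sum_congr rfl fun x _ => prod_forestSeries x.2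

theorem forestSeries_sep : forestSeries sep =
    1 + X * (3 * forestSeries sep ^ 3 + 6 * forestSeries sep ^ 2 * forestSeries (pair 0)) := by
  have := forestSeries_eq_of_profiles sep
    (Multiset.replicate 3 (3, 0) + Multiset.replicate 6 (2, 1)) (by decide +kernel)
  simp only [Multiset.map_add, Multiset.map_replicate, Multiset.sum_add, Multiset.sum_replicate,
    nsmul_eq_mul, if_true, Nat.cast_ofNat] at this
  linear_combination this

theorem forestSeries_pair_zero : forestSeries (pair 0) =
    X * (forestSeries sep ^ 3 + 7 * forestSeries sep ^ 2 * forestSeries (pair 0) +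
      7 * forestSeries sep * forestSeries (pair 0) ^ 2 +
      forestSeries sep ^ 2 * forestSeries full) := by
  have := forestSeries_eq_of_profiles (pair 0)
    (Multiset.replicate 1 (3, 0) + Multiset.replicate 7 (2, 1) + Multiset.replicate 7 (1, 2) +
      Multiset.replicate 1 (2, 0)) (by decide +kernel)
  simp only [Multiset.map_add, Multiset.map_replicate, Multiset.sum_add, Multiset.sum_replicate,
    nsmul_eq_mul, reduceCtorEq, if_false, Nat.cast_ofNat, Nat.cast_one] at this
  linear_combination this

theorem forestSeries_full : forestSeries full =
    X * (forestSeries sep ^ 3 + 12 * forestSeries sep ^ 2 * forestSeries (pair 0) +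
      36 * forestSeries sep * forestSeries (pair 0) ^ 2 + 14 * forestSeries (pair 0) ^ 3 +
      3 * forestSeries sep ^ 2 * forestSeries full +
      12 * forestSeries sep * forestSeries (pair 0) * forestSeries full) := by
  have := forestSeries_eq_of_profiles full
    (Multiset.replicate 1 (3, 0) + Multiset.replicate 12 (2, 1) + Multiset.replicate 36 (1, 2) +
      Multiset.replicate 14 (0, 3) + Multiset.replicate 3 (2, 0) + Multiset.replicate 12 (1, 1))
    (by decide +kernel)
  simp only [Multiset.map_add, Multiset.map_replicate, Multiset.sum_add, Multiset.sum_replicate,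
    nsmul_eq_mul, reduceCtorEq, if_false, Nat.cast_ofNat, Nat.cast_one] at this
  linear_combination this

/-- The root edge lies in the spanning tree. Hence, of the three sides, either two are in the tree
(two choices) and the interior forest separates the corners, or only the root is in the tree and the
forest joins the two ends of one of the other sides. -/
theorem apollonianSeries_eq :
    apollonianSeries = X ^ 2 * (2 * forestSeries sep + 2 * forestSeries (pair 0)) := by
  have h1 := forestSeries_pair 1
  have h2 := forestSeries_pair 2
  have h : 2 * forestSeries sep + 2 * forestSeries (pair 0) =
      2 * forestSeries sep + (forestSeries (pair 1) + forestSeries (pair 2)) := by rw [h1, h2]; ring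
  rw [h]
  ext n
  rw [coeff_X_pow_mul']
  split_ifs with hn
  · obtain ⟨n, rfl⟩ := Nat.exists_eq_add_of_le' hn
    rw [Nat.add_sub_cancel]
    have h2' : (2 : ℚ⟦X⟧) = PowerSeries.C 2 := (map_ofNat PowerSeries.C 2).symm
    rw [h2']
    simp [apollonianSeries, ncard_apollonian, forestSeries, series, Finset.sum_add_distrib,
      Finset.mul_sum]
  · rw [apollonianSeries, coeff_mk, ncard_apollonian_of_lt (by omega), Nat.cast_zero]

end TernaryTree

/-! ### Rational parametrization and algebraicity -/

open PowerSeries in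
/-- In terms of `r = (F - 1) / 3` and `s = G / (F + 2 G)`, where `F` and `G` are the generating
functions of the forests that separate all corners and that join two given corners, the system
for the generating functions of forests becomes a parametrization in which the size variable
appears only once. -/
theorem exists_parametrization : ∃ r s B : ℚ⟦X⟧, constantCoeff r = 0 ∧ constantCoeff s = 0 ∧
    s = r + r ^ 2 + 3 * r * s ^ 2 ∧ r * (1 - 2 * s) = X * (1 + 3 * r) ^ 3 ∧
    apollonianSeries = X ^ 2 * B ∧ B * (1 - 2 * s) = 2 * (1 + 3 * r) * (1 - s) := by
  have hA := TernaryTree.apollonianSeries_eq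
  have h1 := TernaryTree.forestSeries_sep
  have h2 := TernaryTree.forestSeries_pair_zero
  have h3 := TernaryTree.forestSeries_full
  set F := TernaryTree.forestSeries .sep
  set G := TernaryTree.forestSeries (.pair 0)
  set H := TernaryTree.forestSeries .full
  have hF0 : constantCoeff F = 1 := by rw [h1]; simp
  have hG0 : constantCoeff G = 0 := by rw [h2]; simp
  have hD0 : constantCoeff (F + 2 * G) ≠ 0 := by simp [hF0, hG0]
  have hF : F ≠ 0 := fun h => by simp [h] at hF0
  have hD : F + 2 * G ≠ 0 := fun h => hD0 (by rw [h]; simp)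
  obtain ⟨r, hr⟩ : ∃ r : ℚ⟦X⟧, r = X * (F ^ 2 * (F + 2 * G)) := ⟨_, rfl⟩
  have hFr : F = 1 + 3 * r := by linear_combination h1 - 3 * hr
  -- The third equation is only used to eliminate `H` from the second one.
  have hK : r * F ^ 2 * H =
      G * F ^ 2 * (F + 2 * G) - r * (F ^ 3 + 7 * F ^ 2 * G + 7 * F * G ^ 2) := by
    linear_combination (F ^ 2 * H + (F ^ 3 + 7 * F ^ 2 * G + 7 * F * G ^ 2)) * hr -
      F ^ 2 * (F + 2 * G) * h2
  have hH : H * F ^ 2 * (F + 2 * G) = r * (F ^ 3 + 12 * F ^ 2 * G + 36 * F * G ^ 2 + 14 * G ^ 3 +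
      3 * F ^ 2 * H + 12 * F * G * H) := by
    linear_combination F ^ 2 * (F + 2 * G) * h3 - (F ^ 3 + 12 * F ^ 2 * G + 36 * F * G ^ 2 +
      14 * G ^ 3 + 3 * F ^ 2 * H + 12 * F * G * H) * hr
  have hT : G * (F + 2 * G) = (r + r ^ 2) * (F + 2 * G) ^ 2 + 3 * r * G ^ 2 := by
    have : F ^ 2 * (F + 2 * G) *
        (G * (F + 2 * G) - ((r + r ^ 2) * (F + 2 * G) ^ 2 + 3 * r * G ^ 2)) = 0 := by
      clear_value F G H
      subst hFr
      linear_combination r * (1 + 3 * r) ^ 2 * hH - ((1 + 3 * r) ^ 2 * (1 + 3 * r + 2 * G) -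
        r * (3 * (1 + 3 * r) ^ 2 + 12 * (1 + 3 * r) * G)) * hK
    refine sub_eq_zero.1 ((mul_eq_zero.1 this).resolve_left ?_)
    exact mul_ne_zero (pow_ne_zero _ hF) hD
  have hi : (F + 2 * G) * (F + 2 * G)⁻¹ = 1 := PowerSeries.mul_inv_cancel _ hD0
  set I := (F + 2 * G)⁻¹
  refine ⟨r, G * I, 2 * F + 2 * G, by rw [hr]; simp, by simp [hG0], ?_, ?_, hA, ?_⟩
  · linear_combination I ^ 2 * hT - (G * I - (r + r ^ 2) * ((F + 2 * G) * I + 1)) * hi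
  · refine mul_right_cancel₀ hD ?_
    rw [← hFr]
    linear_combination F * hr - 2 * r * G * hi
  · refine mul_right_cancel₀ hD ?_
    rw [← hFr]
    linear_combination (- (2 * F + 2 * G) * 2 * G + 2 * F * G) * hi

open Polynomial in
theorem isAlgebraic_apollonianSeries : IsAlgebraic (Polynomial ℚ) apollonianSeries := by
  obtain ⟨r, s, B, hr0, hs0, h1, h2, hA, hB⟩ := exists_parametrization
  have hX : IsAlgebraic ℚ[X] (PowerSeries.X : PowerSeries ℚ) := by
    have h : algebraMap ℚ[X] (PowerSeries ℚ) X = PowerSeries.X := by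
      rw [PowerSeries.algebraMap_apply', Polynomial.coe_X, PowerSeries.map_X]
    rw [← h]
    exact isAlgebraic_algebraMap _
  have hr : IsAlgebraic ℚ[X] r := by
    refine ⟨3 * (X - C X * (1 + 3 * X) ^ 3) ^ 2 - 2 * (X - C X * (1 + 3 * X) ^ 3) + 4 * X ^ 2 +
      4 * X ^ 3, fun h => ?_, ?_⟩
    · have := congrArg (fun p => (p.eval 1).eval 0) h
      norm_num at this
    · have h : algebraMap ℚ[X] (PowerSeries ℚ) X = PowerSeries.X := by
        rw [PowerSeries.algebraMap_apply', Polynomial.coe_X, PowerSeries.map_X]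
      simp only [map_add, map_sub, map_mul, map_pow, aeval_X, aeval_C, h, map_ofNat, map_one]
      linear_combination (-4 * r) * h1 +
        (3 * (r - PowerSeries.X * (1 + 3 * r) ^ 3 + 2 * r * s) - 2) * h2
  have h3 : IsAlgebraic ℚ[X] (3 : PowerSeries ℚ) := by
    rw [← map_ofNat (algebraMap ℚ[X] (PowerSeries ℚ)) 3]
    exact isAlgebraic_algebraMap _
  have hF : IsAlgebraic ℚ[X] ((1 + 3 * r) ^ 2) := (isAlgebraic_one.add (h3.mul hr)).pow 2
  have hF0 : 1 + 3 * r ≠ 0 := fun h => by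
    have := congrArg PowerSeries.constantCoeff h
    simp [hr0] at this
  have hs1 : 1 - 2 * s ≠ 0 := fun h => by
    have := congrArg PowerSeries.constantCoeff h
    simp [hs0] at this
  refine IsAlgebraic.of_mul (mem_nonZeroDivisors_of_ne_zero (pow_ne_zero 2 hF0)) hF ?_
  have : (1 + 3 * r) ^ 2 * apollonianSeries =
      PowerSeries.X * (r + PowerSeries.X * (1 + 3 * r) ^ 3) := by
    refine mul_right_cancel₀ hs1 ?_
    rw [hA]
    linear_combination (1 + 3 * r) ^ 2 * PowerSeries.X ^ 2 * hB - PowerSeries.X * h2 + 0 * h1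
  rw [this]
  exact hX.mul (hr.add (hX.mul ((isAlgebraic_one.add (h3.mul hr)).pow 3)))

/-! ### Lagrange inversion -/

namespace PowerSeries

/-- **Lagrange inversion**: the coefficients of the power series `a` with `a(ψ(x)) = h(x)`,
where `ψ(x) = x / φ(x)`. -/
theorem coeff_of_subst_eq {K : Type*} [Field K] [CharZero K] {a h φ ψ : K⟦X⟧}
    (hψφ : ψ * φ = X) (hψ : constantCoeff ψ = 0) (ha : a.subst ψ = h) (n : ℕ) :
    (n + 1) * coeff (n + 1) a = coeff n (d⁄dX K h * φ ^ (n + 1)) := by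
  have hs : HasSubst ψ := HasSubst.of_constantCoeff_zero' hψ
  have hd : d⁄dX K ψ * φ = 1 - ψ * d⁄dX K φ := by
    have := congrArg (d⁄dX K) hψφ
    rw [Derivation.leibniz, derivative_X, smul_eq_mul, smul_eq_mul] at this
    linear_combination this
  have hpow : ∀ k, ψ ^ k * φ ^ k = X ^ k := fun k => by rw [← mul_pow, hψφ]
  -- The powers of `ψ` are biorthogonal to the powers of `φ`.
  have key : ∀ k ≤ n, coeff n (d⁄dX K (ψ ^ (k + 1)) * φ ^ (n + 1)) =
      if k = n then (n : K) + 1 else 0 := by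
    intro k hk
    have h1 : d⁄dX K (ψ ^ (k + 1)) * φ ^ (n + 1) =
        C ((k : K) + 1) * (X ^ k * (φ ^ (n - k) * (1 - ψ * d⁄dX K φ))) := by
      rw [Derivation.leibniz_pow, Nat.add_sub_cancel, ← hd, ← hpow k]
      obtain ⟨j, rfl⟩ := Nat.exists_eq_add_of_le hk
      rw [Nat.add_sub_cancel_left]
      simp only [nsmul_eq_mul, smul_eq_mul, map_add, map_natCast, map_one, Nat.cast_add,
        Nat.cast_one]
      ring
    rw [h1, coeff_C_mul, coeff_X_pow_mul', if_pos hk]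
    split_ifs with hkn
    · subst hkn
      simp [hψ]
    · obtain ⟨j, rfl⟩ := Nat.exists_eq_add_of_lt (lt_of_le_of_ne hk hkn)
      have hj : k + j + 1 - k = j + 1 := by omega
      rw [hj]
      have h2 : φ ^ (j + 1) * (1 - ψ * d⁄dX K φ) = φ ^ (j + 1) - X * (φ ^ j * d⁄dX K φ) := by
        rw [← hψφ]; ring
      have h3 : ((j : K) + 1) * coeff j (φ ^ j * d⁄dX K φ) =
          ((j : K) + 1) * coeff (j + 1) (φ ^ (j + 1)) := by
        rw [mul_comm _ (coeff (j + 1) _), ← coeff_derivative, Derivation.leibniz_pow,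
          Nat.add_sub_cancel, nsmul_eq_mul, smul_eq_mul, ← map_natCast (C (R := K)), coeff_C_mul]
        push_cast
        rfl
      have h4 := mul_left_cancel₀ (Nat.cast_add_one_ne_zero j) h3
      rw [h2, map_sub, coeff_succ_X_mul, h4, sub_self, mul_zero]
  -- Split off the terms of `a` that do not contribute.
  have hsplit := eq_X_pow_mul_shift_add_trunc (n + 2) a
  set b := mk fun i => coeff (i + (n + 2)) a
  have hh : h = ψ ^ (n + 2) * b.subst ψ + ∑ k ∈ Finset.range (n + 2), C (coeff k a) * ψ ^ k := by
    rw [← ha]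
    conv_lhs => rw [hsplit]
    rw [subst_add hs, subst_mul hs, subst_pow hs, subst_X hs, subst_coe hs, Polynomial.aeval_def]
    congr 1
    exact eval₂_trunc_eq_sum_range ψ (algebraMap K K⟦X⟧) _ a
  rw [hh, map_add, map_sum, add_mul (d⁄dX K _), map_add (coeff n), Finset.sum_mul, map_sum,
    Finset.sum_range_succ']
  have h5 : coeff n (d⁄dX K (ψ ^ (n + 2) * b.subst ψ) * φ ^ (n + 1)) = 0 := by
    have : d⁄dX K (ψ ^ (n + 2) * b.subst ψ) * φ ^ (n + 1) = X ^ (n + 1) *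
        (ψ * d⁄dX K (b.subst ψ) + C ((n : K) + 2) * b.subst ψ * d⁄dX K ψ) := by
      rw [Derivation.leibniz, Derivation.leibniz_pow, ← hpow (n + 1)]
      simp only [nsmul_eq_mul, smul_eq_mul, map_add, map_natCast, map_ofNat, Nat.cast_add,
        Nat.cast_ofNat]
      have : n + 2 - 1 = n + 1 := rfl
      rw [this]
      ring
    rw [this, coeff_X_pow_mul', if_neg (by omega)]
  have h6 : ∀ k ∈ Finset.range (n + 1),
      coeff n (d⁄dX K (C (coeff (k + 1) a) * ψ ^ (k + 1)) * φ ^ (n + 1)) =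
      if k = n then coeff (n + 1) a * ((n : K) + 1) else 0 := by
    intro k hk
    have : d⁄dX K (C (coeff (k + 1) a) * ψ ^ (k + 1)) =
        C (coeff (k + 1) a) * d⁄dX K (ψ ^ (k + 1)) := by
      rw [Derivation.leibniz, derivative_C, smul_zero, add_zero, smul_eq_mul]
    rw [this, mul_assoc, coeff_C_mul, key k (by rw [Finset.mem_range] at hk; omega)]
    split_ifs with h
    · rw [h]
    · rw [mul_zero]
  rw [h5, Finset.sum_congr rfl h6]
  simp [mul_comm]

end PowerSeries

/-! ### The coefficients as coefficients of powers of a fixed series -/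

/-- The coefficients of the power series `s` without constant term with `s = x + x ^ 2 + 3 x s ^ 2`. -/
def branchCoeff : ℕ → ℕ
  | 0 => 0
  | n + 1 => (if n = 0 then 1 else 0) + (if n = 1 then 1 else 0) +
      3 * ∑ i : Fin n.succ, branchCoeff i * branchCoeff (n - i)

open PowerSeries

/-- The power series `s` with `s = x + x ^ 2 + 3 x s ^ 2`. -/
noncomputable def branch : ℝ⟦X⟧ := mk fun n => (branchCoeff n : ℝ)

theorem branch_eq : branch = X + X ^ 2 + 3 * X * branch ^ 2 := by
  ext n
  cases n with
  | zero => simp [branch, branchCoeff]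
  | succ n =>
    have h3 : X + X ^ 2 + 3 * X * branch ^ 2 = X * (1 + X + C 3 * (branch * branch)) := by
      rw [map_ofNat]; ring
    rw [h3, coeff_succ_X_mul, map_add, map_add, coeff_C_mul, coeff_mul, coeff_one, coeff_X,
      Finset.Nat.sum_antidiagonal_eq_sum_range_succ_mk]
    simp only [branch, coeff_mk]
    rw [branchCoeff, ← Fin.sum_univ_eq_sum_range
      (fun i => (branchCoeff i : ℝ) * branchCoeff (n - i)) n.succ]
    push_cast
    rfl

theorem constantCoeff_branch : constantCoeff branch = 0 := by
  rw [branch_eq]; simp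

/-- The inverse of `1 - 2 s`. -/
noncomputable def branchInv : ℝ⟦X⟧ := (1 - 2 * branch)⁻¹

theorem branchInv_mul : branchInv * (1 - 2 * branch) = 1 :=
  PowerSeries.inv_mul_cancel _ (by simp [constantCoeff_branch])

/-- The power series `φ` with `r = z φ(r)`. -/
noncomputable def lagrangeSeries : ℝ⟦X⟧ := (1 + 3 * X) ^ 3 * branchInv

/-- The power series `h` such that `z ^ 2 h(r)` is the generating function of tree-decorated
Apollonian triangulations. -/
noncomputable def outputSeries : ℝ⟦X⟧ := 2 * (1 + 3 * X) * (1 + branch * branchInv)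

/-- The parametrization has only one solution without constant terms. -/
theorem parametrization_unique {z r s r' s' : ℝ⟦X⟧} (hr : constantCoeff r = 0)
    (hs : constantCoeff s = 0) (hr' : constantCoeff r' = 0) (hs' : constantCoeff s' = 0)
    (hz : constantCoeff z = 0)
    (h1 : s = r + r ^ 2 + 3 * r * s ^ 2) (h2 : r * (1 - 2 * s) = z * (1 + 3 * r) ^ 3)
    (h1' : s' = r' + r' ^ 2 + 3 * r' * s' ^ 2) (h2' : r' * (1 - 2 * s') = z * (1 + 3 * r') ^ 3) :
    r = r' ∧ s = s' := by
  have ha : 1 - 3 * r * (s + s') ≠ 0 := fun h => by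
    have := congrArg constantCoeff h
    simp [hr] at this
  have e1 : (s - s') * (1 - 3 * r * (s + s')) = (r - r') * (1 + r + r' + 3 * s' ^ 2) := by
    linear_combination h1 - h1'
  have e2 : (r - r') * (1 - 2 * s - 9 * z * (1 + 3 * (r + r') + 3 * (r ^ 2 + r * r' + r' ^ 2))) =
      2 * r' * (s - s') := by
    linear_combination h2 - h2'
  have e3 : (r - r') * ((1 - 2 * s - 9 * z * (1 + 3 * (r + r') + 3 * (r ^ 2 + r * r' + r' ^ 2))) *
      (1 - 3 * r * (s + s')) - 2 * r' * (1 + r + r' + 3 * s' ^ 2)) = 0 := by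
    linear_combination (1 - 3 * r * (s + s')) * e2 + 2 * r' * e1
  have hr0 : r - r' = 0 := by
    refine (mul_eq_zero.1 e3).resolve_right fun h => ?_
    have := congrArg constantCoeff h
    simp [hr, hs, hr', hs', hz] at this
  rw [hr0, zero_mul] at e1
  exact ⟨sub_eq_zero.1 hr0, sub_eq_zero.1 ((mul_eq_zero.1 e1).resolve_right ha)⟩

/-- Substituting `z = x / φ(x)` turns `r(z)` into `x`, so that Lagrange inversion applies. -/
theorem ncard_apollonian_eq_coeff (n : ℕ) : (n + 1) * ((apollonian (n + 3)).ncard : ℝ) =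
    coeff n (d⁄dX ℝ outputSeries * lagrangeSeries ^ (n + 1)) := by
  obtain ⟨r, s, B, hr0, hs0, h1, h2, hA, hB⟩ := exists_parametrization
  have hcoeff : ((apollonian (n + 3)).ncard : ℝ) =
      coeff (n + 1) (PowerSeries.map (algebraMap ℚ ℝ) B) := by
    have := congrArg (coeff (n + 1 + 2)) hA
    rw [coeff_X_pow_mul, apollonianSeries, coeff_mk] at this
    rw [coeff_map, ← this]
    simp
  rw [hcoeff]
  set φ := PowerSeries.map (algebraMap ℚ ℝ)
  have hI : (1 + 3 * X : ℝ⟦X⟧) * (1 + 3 * X)⁻¹ = 1 := PowerSeries.mul_inv_cancel _ (by simp)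
  set I : ℝ⟦X⟧ := (1 + 3 * X)⁻¹
  have hinv := branchInv_mul
  have hψ : constantCoeff (X * ((1 - 2 * branch) * I ^ 3)) = 0 := by simp
  have hs : HasSubst (X * ((1 - 2 * branch) * I ^ 3)) := HasSubst.of_constantCoeff_zero' hψ
  set ψ := X * ((1 - 2 * branch) * I ^ 3) with hψdef
  refine coeff_of_subst_eq (ψ := ψ) ?_ hψ ?_ n
  · rw [hψdef, lagrangeSeries]
    linear_combination (X * (1 + 3 * X) ^ 3 * I ^ 3) * hinv +
      X * (((1 + 3 * X) * I) ^ 2 + (1 + 3 * X) * I + 1) * hI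
  · let f : ℚ⟦X⟧ →+* ℝ⟦X⟧ := (substAlgHom (R := ℝ) hs : ℝ⟦X⟧ →+* ℝ⟦X⟧).comp φ
    have hf : ∀ a, f a = (φ a).subst ψ := fun a => congrFun (coe_substAlgHom hs) (φ a)
    have hf0 : ∀ a, constantCoeff a = 0 → constantCoeff (f a) = 0 := fun a ha => by
      rw [hf]
      exact constantCoeff_subst_eq_zero hψ _ (by
        rw [← coeff_zero_eq_constantCoeff_apply] at ha ⊢
        rw [coeff_map, ha, map_zero])
    have hX : f X = ψ := by rw [hf]; simp [φ, subst_X hs]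
    have k1 := congrArg f h1
    have k2 := congrArg f h2
    have k3 := congrArg f hB
    simp only [map_add, map_sub, map_mul, map_pow, map_one, map_ofNat, hX] at k1 k2 k3
    obtain ⟨er, es⟩ := parametrization_unique (hf0 r hr0) (hf0 s hs0) constantCoeff_X
      constantCoeff_branch hψ k1 k2 branch_eq (by
        rw [hψdef]
        linear_combination
          (-X * (1 - 2 * branch) * (((1 + 3 * X) * I) ^ 2 + (1 + 3 * X) * I + 1)) * hI)
    rw [er, es] at k3
    rw [← hf, outputSeries]
    linear_combination branchInv * k3 - (f B - 2 * (1 + 3 * X)) * hinv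

/-! ### Values of absolutely summable power series -/

namespace PowerSeries

/-- The ring of power series that converge absolutely at `ρ`. -/
def absConv (ρ : ℝ) : Subring ℝ⟦X⟧ where
  carrier := {f | Summable fun n => ‖coeff n f * ρ ^ n‖}
  zero_mem' := by simp
  one_mem' := by
    refine summable_of_ne_finset_zero (s := {0}) fun n hn => ?_
    simp [coeff_one, Finset.notMem_singleton.1 hn]
  neg_mem' h := by simpa using h
  add_mem' {f g} hf hg := by
    refine Summable.of_nonneg_of_le (fun _ => norm_nonneg _) (fun n => ?_) (hf.add hg)
    rw [map_add, add_mul]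
    exact norm_add_le _ _
  mul_mem' {f g} hf hg := by
    refine (summable_norm_sum_mul_antidiagonal_of_summable_norm hf hg).congr fun n => ?_
    rw [coeff_mul, Finset.sum_mul]
    congr 1
    refine Finset.sum_congr rfl fun kl hkl => ?_
    rw [← Finset.HasAntidiagonal.mem_antidiagonal.1 hkl, pow_add]
    ring

theorem X_mem_absConv (ρ : ℝ) : X ∈ absConv ρ :=
  summable_of_ne_finset_zero (s := {1}) fun n hn => by
    simp [coeff_X, Finset.notMem_singleton.1 hn]

theorem absConv_anti {ρ ρ' : ℝ} (h0 : 0 ≤ ρ) (h : ρ ≤ ρ') : absConv ρ' ≤ absConv ρ := by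
  intro f hf
  refine Summable.of_nonneg_of_le (fun _ => norm_nonneg _) (fun n => ?_) hf
  rw [norm_mul, norm_mul, norm_pow, norm_pow, Real.norm_of_nonneg h0,
    Real.norm_of_nonneg (h0.trans h)]
  gcongr

theorem derivative_mem_absConv {ρ ρ' : ℝ} (h0 : 0 < ρ) (h : ρ < ρ') {f : ℝ⟦X⟧}
    (hf : f ∈ absConv ρ') : d⁄dX ℝ f ∈ absConv ρ := by
  have h0' := h0.trans h
  -- `n ρ ^ n` is bounded by a multiple of `ρ' ^ n`.
  obtain ⟨K, hK⟩ : ∃ K : ℝ, ∀ n : ℕ, (n : ℝ) * (ρ / ρ') ^ n ≤ K := by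
    have hs := summable_pow_mul_geometric_of_norm_lt_one (R := ℝ) 1 (r := ρ / ρ') (by
      rw [Real.norm_of_nonneg (by positivity)]
      exact (div_lt_one h0').2 h)
    refine ⟨_, fun n => (by simpa using hs.le_tsum n fun m _ => by positivity)⟩
  refine Summable.of_nonneg_of_le (fun _ => norm_nonneg _) (fun n => ?_)
    (((summable_nat_add_iff 1).2 hf).mul_left (K / ρ))
  rw [coeff_derivative]
  have h1 := hK (n + 1)
  simp only [norm_mul, norm_pow, Real.norm_of_nonneg h0.le, Real.norm_of_nonneg h0'.le]
  have h2 : ‖(n : ℝ) + 1‖ = n + 1 := Real.norm_of_nonneg (by positivity)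
  rw [h2]
  have h3 : ((n : ℝ) + 1) * ρ ^ n ≤ K / ρ * ρ' ^ (n + 1) := by
    rw [div_pow, ← mul_div_assoc, div_le_iff₀ (by positivity)] at h1
    rw [div_mul_eq_mul_div, le_div_iff₀ h0]
    push_cast at h1
    rw [mul_assoc, ← pow_succ]
    exact h1
  calc ‖coeff (n + 1) f‖ * ((n : ℝ) + 1) * ρ ^ n = ‖coeff (n + 1) f‖ * (((n : ℝ) + 1) * ρ ^ n) := by
        ring
    _ ≤ ‖coeff (n + 1) f‖ * (K / ρ * ρ' ^ (n + 1)) := by gcongr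
    _ = _ := by ring

variable {A : Type*} [NormedField A] [NormedAlgebra ℝ A] {ρ : ℝ} {a : A}

theorem summable_norm_coeff_smul (ha : ‖a‖ ≤ ρ) {f : ℝ⟦X⟧} (hf : f ∈ absConv ρ) :
    Summable fun n => ‖coeff n f • a ^ n‖ := by
  refine Summable.of_nonneg_of_le (fun _ => norm_nonneg _) (fun n => ?_) hf
  rw [norm_smul, norm_mul, norm_pow, norm_pow, Real.norm_of_nonneg ((norm_nonneg a).trans ha)]
  gcongr

variable [CompleteSpace A]

/-- The value of a power series at a point of absolute convergence. -/
noncomputable def value (ρ : ℝ) (a : A) (ha : ‖a‖ ≤ ρ) : absConv ρ →+* A where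
  toFun f := ∑' n, coeff n f.1 • a ^ n
  map_one' := by
    rw [tsum_eq_single 0 fun n hn => by simp [coeff_one, hn]]
    simp
  map_zero' := by simp
  map_add' f g := by
    rw [← (summable_norm_coeff_smul ha f.2).of_norm.tsum_add
      (summable_norm_coeff_smul ha g.2).of_norm]
    simp [add_smul]
  map_mul' f g := by
    rw [tsum_mul_tsum_eq_tsum_sum_antidiagonal_of_summable_norm
      (summable_norm_coeff_smul ha f.2) (summable_norm_coeff_smul ha g.2)]
    refine tsum_congr fun n => ?_
    rw [Subring.coe_mul, coeff_mul, Finset.sum_smul]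
    refine Finset.sum_congr rfl fun kl hkl => ?_
    rw [← Finset.HasAntidiagonal.mem_antidiagonal.1 hkl, pow_add, smul_mul_smul_comm]

theorem hasSum_value (ha : ‖a‖ ≤ ρ) (f : absConv ρ) :
    HasSum (fun n => coeff n f.1 • a ^ n) (value ρ a ha f) :=
  (summable_norm_coeff_smul ha f.2).of_norm.hasSum

theorem value_X (ha : ‖a‖ ≤ ρ) : value ρ a ha ⟨X, X_mem_absConv ρ⟩ = a := by
  refine (hasSum_value ha _).unique ?_
  convert hasSum_single 1 fun n hn => ?_ using 1
  · simp
  · simp [coeff_X, hn]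

end PowerSeries

/-! ### A local limit theorem -/

section

open Complex Topology MeasureTheory

/-- The sum of the Fourier series with coefficients `c`. -/
noncomputable def trigSeries (c : ℕ → ℝ) (θ : ℝ) : ℂ := ∑' n, c n * exp (n * θ * I)

theorem norm_trigSeries_term (c : ℕ → ℝ) (n : ℕ) (θ : ℝ) :
    ‖(c n * exp (n * θ * I) : ℂ)‖ = |c n| := by
  rw [norm_mul, norm_real, Real.norm_eq_abs, ← ofReal_natCast, ← ofReal_mul, norm_exp_ofReal_mul_I,
    mul_one]

theorem hasSum_trigSeries {c : ℕ → ℝ} (hc : Summable fun n => |c n|) (θ : ℝ) :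
    HasSum (fun n => (c n * exp (n * θ * I) : ℂ)) (trigSeries c θ) :=
  Summable.hasSum (.of_norm (by simpa only [norm_trigSeries_term] using hc))

theorem continuous_trigSeries {c : ℕ → ℝ} (hc : Summable fun n => |c n|) :
    Continuous (trigSeries c) :=
  continuous_tsum (fun n => by fun_prop) hc fun n θ => (norm_trigSeries_term c n θ).le

theorem norm_trigSeries_le {c : ℕ → ℝ} (hc : Summable fun n => |c n|) (θ : ℝ) :
    ‖trigSeries c θ‖ ≤ ∑' n, |c n| :=
  tsum_of_norm_bounded hc.hasSum fun n => (norm_trigSeries_term c n θ).le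

theorem integral_exp_int_mul (k : ℤ) : ∫ θ in (-Real.pi)..Real.pi, exp (k * θ * I) =
    if k = 0 then 2 * (Real.pi : ℂ) else 0 := by
  split_ifs with h
  · simp only [h, Int.cast_zero, zero_mul, exp_zero, intervalIntegral.integral_const]
    simp
    ring
  · have : ∀ θ : ℝ, exp (k * θ * I) = exp (k * I * θ) := fun θ => by ring_nf
    simp only [this]
    rw [integral_exp_mul_complex (by simp [h]), div_eq_zero_iff, sub_eq_zero]
    left
    rw [exp_eq_exp_iff_exists_int]
    exact ⟨k, by push_cast; ring⟩

/-- The coefficients of a Fourier series are integrals. -/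
theorem integral_trigSeries {c : ℕ → ℝ} (hc : Summable fun n => |c n|) (m : ℕ) :
    ∫ θ in (-Real.pi)..Real.pi, trigSeries c θ * exp (-(m * θ * I)) = 2 * Real.pi * c m := by
  have hexp : ∀ (n : ℕ) (θ : ℝ), (c n * exp (n * θ * I) : ℂ) * exp (-(m * θ * I)) =
      c n * exp (((n - m : ℤ) : ℂ) * θ * I) := fun n θ => by
    rw [mul_assoc, ← exp_add]; push_cast; ring_nf
  have h := intervalIntegral.hasSum_integral_of_dominated_convergence (μ := volume)
    (a := -Real.pi) (b := Real.pi)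
    (F := fun n θ => (c n * exp (n * θ * I) : ℂ) * exp (-(m * θ * I)))
    (f := fun θ => trigSeries c θ * exp (-(m * θ * I))) (fun n _ => |c n|)
    (fun n => Continuous.aestronglyMeasurable (by fun_prop))
    (fun n => .of_forall fun θ _ => by
      rw [hexp, norm_mul, norm_real, Real.norm_eq_abs, ← ofReal_intCast, ← ofReal_mul,
        norm_exp_ofReal_mul_I, mul_one])
    (.of_forall fun θ _ => hc) intervalIntegrable_const
    (.of_forall fun θ _ => (hasSum_trigSeries hc θ).mul_right _)
  refine h.unique ?_
  simp only [hexp, intervalIntegral.integral_const_mul, integral_exp_int_mul]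
  convert hasSum_single m fun n hn => ?_ using 1
  · simp; ring
  · rw [if_neg (by omega), mul_zero]

/-- The second-order Taylor expansion at zero of a characteristic function with mean one. -/
theorem tendsto_trigSeries {p : ℕ → ℝ} {v : ℝ} (hp : ∀ n, 0 ≤ p n) (h0 : HasSum p 1)
    (h1 : HasSum (fun n : ℕ => ((n : ℝ) - 1) * p n) 0)
    (h2 : HasSum (fun n : ℕ => ((n : ℝ) - 1) ^ 2 * p n) v) :
    Tendsto (fun θ : ℝ => (trigSeries p θ * exp (-(θ * I)) - 1) / (θ : ℂ) ^ 2) (𝓝[≠] 0)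
      (𝓝 (-(v / 2 : ℂ))) := by
  have hc : Summable fun n => |p n| := h0.summable.abs
  have hlim : -(v / 2 : ℂ) = ∑' n : ℕ, (p n : ℂ) * (-((n : ℂ) - 1) ^ 2 / 2) := by
    have := (hasSum_ofReal.2 h2).mul_right (-1 / 2 : ℂ)
    refine Eq.symm ((tsum_congr fun n => ?_).trans (this.tsum_eq.trans ?_))
    · push_cast; ring
    · ring
  have heq : ∀ θ : ℝ, (trigSeries p θ * exp (-(θ * I)) - 1) / (θ : ℂ) ^ 2 = ∑' n : ℕ,
      (p n : ℂ) * ((exp ((((n : ℝ) - 1) * θ : ℝ) * I) - 1 - (((n : ℝ) - 1) * θ : ℝ) * I) /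
        (θ : ℂ) ^ 2) := by
    intro θ
    have e1 := (hasSum_trigSeries hc θ).mul_right (exp (-(θ * I)))
    have e2 := (hasSum_ofReal.2 h1).mul_right (θ * I : ℂ)
    have e3 := ((e1.sub (hasSum_ofReal.2 h0)).sub e2).div_const ((θ : ℂ) ^ 2)
    refine Eq.symm ((tsum_congr fun n => ?_).trans (e3.tsum_eq.trans ?_))
    · rw [mul_assoc (p n : ℂ), ← exp_add]
      have : (n : ℂ) * θ * I + -(θ * I) = (((n : ℝ) - 1) * θ : ℝ) * I := by push_cast; ring
      rw [this]
      push_cast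
      ring
    · simp
  have hbound : ∀ x : ℝ, ‖exp (x * I) - 1 - x * I‖ ≤ 3 * x ^ 2 := by
    intro x
    have hx : ‖(x * I : ℂ)‖ = |x| := by simp
    rcases le_total |x| 1 with h | h
    · refine (norm_exp_sub_one_sub_id_le (by rw [hx]; exact h)).trans ?_
      rw [hx, sq_abs]
      nlinarith [sq_nonneg x]
    · have h3 : |x| ≤ x ^ 2 := by rw [← sq_abs]; nlinarith
      calc ‖exp (x * I) - 1 - x * I‖ ≤ ‖exp (x * I)‖ + ‖(1 : ℂ)‖ + ‖(x * I : ℂ)‖ :=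
            (norm_sub_le _ _).trans (add_le_add_left (norm_sub_le _ _) _)
        _ ≤ _ := by rw [norm_exp_ofReal_mul_I, hx, norm_one]; linarith
  rw [hlim]
  refine (tendsto_tsum_of_dominated_convergence
    (bound := fun n : ℕ => 3 * (((n : ℝ) - 1) ^ 2 * p n)) (h2.summable.mul_left 3)
    (fun n => Tendsto.const_mul _ ?_) ?_).congr fun θ => (heq θ).symm
  · -- Taylor's formula for a single exponential.
    set c : ℝ := (n : ℝ) - 1 with hcdef
    have hcc : (n : ℂ) - 1 = (c : ℂ) := by rw [hcdef]; push_cast; rfl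
    rw [hcc]
    refine tendsto_iff_norm_sub_tendsto_zero.2 ?_
    have hz : Tendsto (fun θ : ℝ => |c| ^ 3 * |θ|) (𝓝[≠] 0) (𝓝 0) := by
      have : Tendsto (fun θ : ℝ => |c| ^ 3 * |θ|) (𝓝 0) (𝓝 (|c| ^ 3 * |0|)) := by
        apply Continuous.tendsto; fun_prop
      rw [abs_zero, mul_zero] at this
      exact this.mono_left nhdsWithin_le_nhds
    have hev : ∀ᶠ θ : ℝ in 𝓝[≠] 0, |c * θ| < 1 := by
      have : Tendsto (fun θ : ℝ => |c * θ|) (𝓝 0) (𝓝 |c * 0|) := by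
        apply Continuous.tendsto; fun_prop
      rw [mul_zero, abs_zero] at this
      exact (this.mono_left nhdsWithin_le_nhds).eventually (gt_mem_nhds one_pos)
    refine squeeze_zero' (.of_forall fun _ => norm_nonneg _) ?_ hz
    filter_upwards [hev, self_mem_nhdsWithin] with θ hθ hθ0
    have hθ1 : (θ : ℂ) ≠ 0 := ofReal_ne_zero.2 hθ0
    have hx : ‖((c * θ : ℝ) * I : ℂ)‖ = |c * θ| := by
      rw [norm_mul, norm_I, mul_one, norm_real, Real.norm_eq_abs]
    have hb := exp_bound (x := (c * θ : ℝ) * I) (by rw [hx]; exact hθ.le) (n := 3) (by norm_num)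
    have e : (exp ((c * θ : ℝ) * I) - 1 - (c * θ : ℝ) * I) / (θ : ℂ) ^ 2 - -(c : ℂ) ^ 2 / 2 =
        (exp ((c * θ : ℝ) * I) - ∑ m ∈ Finset.range 3, ((c * θ : ℝ) * I) ^ m / m.factorial) /
          (θ : ℂ) ^ 2 := by
      rw [eq_div_iff (pow_ne_zero 2 hθ1), sub_mul, div_mul_cancel₀ _ (pow_ne_zero 2 hθ1)]
      simp only [Finset.sum_range_succ, Finset.sum_range_zero, mul_pow, I_sq]
      push_cast
      simp
      ring
    rw [e, norm_div, norm_pow, norm_real, Real.norm_eq_abs, div_le_iff₀ (pow_pos (abs_pos.2 hθ0) 2)]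
    refine hb.trans ?_
    rw [hx, abs_mul, mul_pow]
    have h18 : ((Nat.succ 3 : ℕ) : ℝ) * (((Nat.factorial 3 : ℕ) : ℝ) * (3 : ℕ))⁻¹ ≤ 1 := by
      norm_num [Nat.factorial]
    calc |c| ^ 3 * |θ| ^ 3 * _ ≤ |c| ^ 3 * |θ| ^ 3 * 1 := by gcongr
      _ = _ := by ring
  · filter_upwards [self_mem_nhdsWithin] with θ hθ n
    have hθ0 : (0 : ℝ) < θ ^ 2 := by have : θ ≠ 0 := hθ; positivity
    rw [norm_mul, norm_div, norm_real, Real.norm_of_nonneg (hp n), norm_pow, norm_real,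
      Real.norm_eq_abs, sq_abs]
    have := hbound (((n : ℝ) - 1) * θ)
    calc _ ≤ p n * (3 * (((n : ℝ) - 1) * θ) ^ 2 / θ ^ 2) := by
          have hpn := hp n
          gcongr
      _ = _ := by rw [mul_pow, ← mul_assoc, mul_div_assoc, div_self hθ0.ne']; ring

/-- Positivity of the first two coefficients rules out periodicity, and the modulus of the
characteristic function decays uniformly. -/
theorem norm_trigSeries_le_exp {p : ℕ → ℝ} (hp : ∀ n, 0 ≤ p n) (h : HasSum p 1) {θ : ℝ}
    (hθ : |θ| ≤ Real.pi) :
    ‖trigSeries p θ‖ ≤ Real.exp (-(2 * p 0 * p 1 / Real.pi ^ 2) * θ ^ 2) := by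
  have hc : Summable fun n => |p n| := h.summable.abs
  have hp0 := hp 0
  have hp1 := hp 1
  have hsplit := (hasSum_trigSeries hc θ).summable.sum_add_tsum_nat_add 2
  have hsplit' := h.summable.sum_add_tsum_nat_add 2
  rw [h.tsum_eq, Finset.sum_range_succ, Finset.sum_range_one] at hsplit'
  have htail : ‖∑' n : ℕ, ((p (n + 2) : ℂ) * exp ((n + 2 : ℕ) * θ * I))‖ ≤ ∑' n, p (n + 2) := by
    refine tsum_of_norm_bounded ((summable_nat_add_iff 2).2 h.summable).hasSum fun n => ?_
    rw [norm_trigSeries_term, abs_of_nonneg (hp _)]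
  have htail0 : 0 ≤ ∑' n, p (n + 2) := tsum_nonneg fun n => hp _
  have hS : p 0 + p 1 ≤ 1 := by linarith
  have hcos := Real.cos_le_one_sub_mul_cos_sq hθ
  set b := 2 * p 0 * p 1 / Real.pi ^ 2 with hb
  have hsq : ‖(p 0 : ℂ) + p 1 * exp (θ * I)‖ ^ 2 ≤ (p 0 + p 1) ^ 2 - 2 * (b * θ ^ 2) := by
    have : ‖(p 0 : ℂ) + p 1 * exp (θ * I)‖ ^ 2 =
        (p 0 + p 1) ^ 2 - 2 * p 0 * p 1 * (1 - Real.cos θ) := by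
      have h5 := Real.sin_sq_add_cos_sq θ
      rw [Complex.sq_norm, normSq_apply, exp_mul_I, ← ofReal_cos, ← ofReal_sin]
      generalize Real.cos θ = x at *
      generalize Real.sin θ = y at *
      simp only [add_re, add_im, mul_re, mul_im, ofReal_re, ofReal_im, I_re, I_im]
      linear_combination p 1 ^ 2 * h5
    rw [this]
    have h4 : 2 * (b * θ ^ 2) = 2 * p 0 * p 1 * (2 / Real.pi ^ 2 * θ ^ 2) := by rw [hb]; ring
    rw [h4]
    have : 0 ≤ 2 * p 0 * p 1 := by positivity
    nlinarith
  have hb0 : 0 ≤ b * θ ^ 2 := by positivity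
  have hhead : ‖(p 0 : ℂ) + p 1 * exp (θ * I)‖ ≤ p 0 + p 1 - b * θ ^ 2 := by
    set N := ‖(p 0 : ℂ) + p 1 * exp (θ * I)‖
    have hN : 0 ≤ N := norm_nonneg _
    have hN1 : N ≤ p 0 + p 1 := by
      refine (norm_add_le _ _).trans (le_of_eq ?_)
      rw [norm_mul, norm_exp_ofReal_mul_I, norm_real, norm_real, Real.norm_of_nonneg hp0,
        Real.norm_of_nonneg hp1, mul_one]
    -- `2 b θ² ≤ (S - N) (S + N) ≤ 2 (S - N)` with `S = p 0 + p 1 ≤ 1`.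
    nlinarith [mul_nonneg (sub_nonneg.2 hN1) (show 0 ≤ 2 - (p 0 + p 1 + N) by linarith)]
  have hφ : trigSeries p θ = ((p 0 : ℂ) + p 1 * exp (θ * I)) +
      ∑' n : ℕ, ((p (n + 2) : ℂ) * exp ((n + 2 : ℕ) * θ * I)) := by
    rw [trigSeries, ← hsplit, Finset.sum_range_succ, Finset.sum_range_one]
    simp
  calc ‖trigSeries p θ‖ ≤ (p 0 + p 1 - b * θ ^ 2) + ∑' n, p (n + 2) := by
        rw [hφ]; exact (norm_add_le _ _).trans (add_le_add hhead htail)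
    _ = -b * θ ^ 2 + 1 := by linarith
    _ ≤ _ := Real.add_one_le_exp _

end

section

open Complex Topology MeasureTheory

/-- **Local limit theorem** at the mean: if `p` is an aperiodic probability distribution with mean
one and variance `v`, and `c m` is the coefficient of `x ^ m` in `q(x) p(x) ^ m`, then `c m` decays
like `q(1) / √(2 π v m)`. -/
theorem tendsto_sqrt_mul_coeff {p q : ℕ → ℝ} {v : ℝ} (c : ℕ → ℕ → ℝ) (hp : ∀ n, 0 ≤ p n)
    (h0 : HasSum p 1) (h1 : HasSum (fun n : ℕ => ((n : ℝ) - 1) * p n) 0)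
    (h2 : HasSum (fun n : ℕ => ((n : ℝ) - 1) ^ 2 * p n) v) (hv : 0 < v) (hp0 : 0 < p 0)
    (hp1 : 0 < p 1) (hq : Summable fun n => |q n|) (hc : ∀ m, Summable fun n => |c m n|)
    (hcq : ∀ m θ, trigSeries (c m) θ = trigSeries q θ * trigSeries p θ ^ m) :
    Tendsto (fun m : ℕ => √m * c m m) atTop (𝓝 ((∑' n, q n) / √(2 * Real.pi * v))) := by
  have hpc : Summable fun n => |p n| := h0.summable.abs
  have hπ := Real.pi_pos
  set u : ℝ → ℂ := fun θ => trigSeries p θ * exp (-(θ * I)) with hu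
  have hucont : Continuous u := (continuous_trigSeries hpc).mul (by fun_prop)
  have hqcont := continuous_trigSeries hq
  set f : ℝ → ℕ → ℂ := fun θ m => trigSeries q θ * u θ ^ m with hf
  set S : ℕ → Set ℝ := fun m => Set.Ioc (-Real.pi * √m) (Real.pi * √m) with hS
  -- Rescaling the integral over the circle turns it into an integral over the line.
  have hint : ∀ m : ℕ, 0 < m → ((√m * c m m : ℝ) : ℂ) =
      (2 * Real.pi : ℂ)⁻¹ * ∫ s : ℝ, (S m).indicator (fun s => f (s / √m) m) s := by
    intro m hm
    have hsq : (0 : ℝ) < √m := Real.sqrt_pos.2 (Nat.cast_pos.2 hm)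
    rw [integral_indicator measurableSet_Ioc, ← intervalIntegral.integral_of_le (by nlinarith),
      intervalIntegral.integral_comp_div (fun θ => f θ m) hsq.ne',
      mul_div_cancel_right₀ _ hsq.ne', mul_div_cancel_right₀ _ hsq.ne']
    have : (fun θ : ℝ => f θ m) = fun θ : ℝ => trigSeries (c m) θ * exp (-(m * θ * I)) := by
      funext θ
      rw [hcq, hf, hu]
      simp only
      rw [mul_pow, ← exp_nat_mul, mul_assoc]
      ring_nf
    rw [this, integral_trigSeries (hc m), Complex.real_smul]
    push_cast
    field_simp
  set b := 2 * p 0 * p 1 / Real.pi ^ 2 with hb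
  have hb0 : 0 < b := by positivity
  have hlim : Tendsto (fun m : ℕ => ∫ s : ℝ, (S m).indicator (fun s => f (s / √m) m) s) atTop
      (𝓝 (∫ s : ℝ, ((∑' n, q n : ℝ) : ℂ) * (Real.exp (-(v / 2) * s ^ 2) : ℝ))) := by
    refine tendsto_integral_of_dominated_convergence
      (fun s => (∑' n, |q n|) * Real.exp (-b * s ^ 2)) ?_ ?_ ?_ ?_
    · intro m
      refine (Continuous.aestronglyMeasurable ?_).indicator measurableSet_Ioc
      have : Continuous fun s : ℝ => s / √m := by fun_prop
      exact (hqcont.comp this).mul ((hucont.comp this).pow m)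
    · exact (integrable_exp_neg_mul_sq hb0).const_mul _
    · intro m
      refine .of_forall fun s => ?_
      have hq0 : 0 ≤ ∑' n, |q n| := tsum_nonneg fun n => abs_nonneg _
      rw [Set.indicator_apply]
      split_ifs with hs
      · have hm : 0 < m := by
          rcases Nat.eq_zero_or_pos m with rfl | h
          · simp [hS] at hs
          · exact h
        have hsq : (0 : ℝ) < √m := Real.sqrt_pos.2 (Nat.cast_pos.2 hm)
        have hθ : |s / √m| ≤ Real.pi := by
          rw [abs_div, abs_of_pos hsq, div_le_iff₀ hsq, abs_le]
          exact ⟨by linarith [hs.1], hs.2⟩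
        have hnu : ‖u (s / √m)‖ ≤ Real.exp (-b * (s / √m) ^ 2) := by
          have : ‖exp (-((s / √m : ℝ) * I))‖ = 1 := by
            rw [← neg_mul, ← ofReal_neg, norm_exp_ofReal_mul_I]
          rw [hu]
          simp only
          rw [norm_mul, this, mul_one]
          exact norm_trigSeries_le_exp hp h0 hθ
        rw [hf]
        simp only
        rw [norm_mul, norm_pow]
        calc _ ≤ (∑' n, |q n|) * Real.exp (-b * (s / √m) ^ 2) ^ m := by
              gcongr
              exact norm_trigSeries_le hq _
          _ = _ := by
            rw [← Real.exp_nat_mul, div_pow, Real.sq_sqrt (Nat.cast_nonneg m)]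
            congr 2
            field_simp
      · rw [norm_zero]; positivity
    · refine .of_forall fun s => ?_
      have hsm : Tendsto (fun m : ℕ => s / √m) atTop (𝓝 0) :=
        tendsto_const_nhds.div_atTop (Real.tendsto_sqrt_atTop.comp tendsto_natCast_atTop_atTop)
      have hind : ∀ᶠ m : ℕ in atTop, s ∈ S m := by
        have : Tendsto (fun m : ℕ => Real.pi * √m) atTop atTop :=
          (Real.tendsto_sqrt_atTop.comp tendsto_natCast_atTop_atTop).const_mul_atTop hπ
        filter_upwards [this.eventually_gt_atTop |s|] with m hm
        rw [abs_lt] at hm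
        exact ⟨by linarith [hm.1], hm.2.le⟩
      have hq1 : Tendsto (fun m : ℕ => trigSeries q (s / √m)) atTop
          (𝓝 ((∑' n, q n : ℝ) : ℂ)) := by
        have h : trigSeries q 0 = ((∑' n, q n : ℝ) : ℂ) := by simp [trigSeries, ofReal_tsum]
        rw [← h]
        exact (hqcont.tendsto 0).comp hsm
      have hu1 : Tendsto (fun m : ℕ => u (s / √m) ^ m) atTop
          (𝓝 (Real.exp (-(v / 2) * s ^ 2) : ℝ)) := by
        rcases eq_or_ne s 0 with rfl | hs
        · have : u 0 = 1 := by
            rw [hu]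
            simp only [trigSeries]
            simp [← ofReal_tsum, h0.tsum_eq]
          simp [this]
        · have hne : Tendsto (fun m : ℕ => s / √m) atTop (𝓝[≠] 0) := by
            refine tendsto_nhdsWithin_iff.2 ⟨hsm, ?_⟩
            filter_upwards [eventually_gt_atTop 0] with m hm
            exact div_ne_zero hs (Real.sqrt_pos.2 (Nat.cast_pos.2 hm)).ne'
          have hk := ((tendsto_trigSeries hp h0 h1 h2).comp hne).const_mul ((s : ℂ) ^ 2)
          have hm : Tendsto (fun m : ℕ => (m : ℂ) * (u (s / √m) - 1)) atTop
              (𝓝 ((s : ℂ) ^ 2 * -(v / 2))) := by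
            refine hk.congr' ?_
            filter_upwards [eventually_gt_atTop 0] with m hm
            have hs' : (s : ℂ) ≠ 0 := ofReal_ne_zero.2 hs
            have hsq : ((√m : ℝ) : ℂ) ^ 2 = m := by
              rw [← ofReal_pow, Real.sq_sqrt (Nat.cast_nonneg m), ofReal_natCast]
            have hm0 : (m : ℂ) ≠ 0 := Nat.cast_ne_zero.2 hm.ne'
            simp only [Function.comp, hu]
            rw [ofReal_div, div_pow, hsq]
            field_simp
          have := tendsto_one_add_pow_exp_of_tendsto hm
          simp only [add_sub_cancel] at this
          convert this using 2
          push_cast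
          ring_nf
      refine (hq1.mul hu1).congr' ?_
      filter_upwards [hind] with m hm
      rw [Set.indicator_of_mem hm]
  have hgauss : ∫ s : ℝ, ((∑' n, q n : ℝ) : ℂ) * (Real.exp (-(v / 2) * s ^ 2) : ℝ) =
      (((∑' n, q n) * √(Real.pi / (v / 2)) : ℝ) : ℂ) := by
    rw [← integral_gaussian, ← integral_const_mul, ← integral_complex_ofReal]
    push_cast
    rfl
  have hfin : Tendsto (fun m : ℕ => ((√m * c m m : ℝ) : ℂ)) atTop
      (𝓝 (((∑' n, q n) / √(2 * Real.pi * v) : ℝ) : ℂ)) := by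
    have h := hlim.const_mul (2 * Real.pi : ℂ)⁻¹
    rw [hgauss] at h
    have he : (2 * Real.pi : ℂ)⁻¹ * (((∑' n, q n) * √(Real.pi / (v / 2)) : ℝ) : ℂ) =
        (((∑' n, q n) / √(2 * Real.pi * v) : ℝ) : ℂ) := by
      have h3 : √(Real.pi / (v / 2)) = 2 * Real.pi / √(2 * Real.pi * v) := by
        rw [eq_div_iff (by positivity), ← Real.sqrt_mul (by positivity)]
        have : Real.pi / (v / 2) * (2 * Real.pi * v) = (2 * Real.pi) ^ 2 := by field_simp
        rw [this, Real.sqrt_sq (by positivity)]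
      rw [h3]
      have : (Real.pi : ℂ) ≠ 0 := ofReal_ne_zero.2 hπ.ne'
      push_cast
      field_simp
    rw [he] at h
    refine h.congr' ?_
    filter_upwards [eventually_gt_atTop 0] with m hm
    exact (hint m hm).symm
  exact (Complex.continuous_re.tendsto _).comp hfin

end

namespace PowerSeries

open Topology

variable {τ : ℝ}

theorem coeff_X_mul_derivative (f : ℝ⟦X⟧) (n : ℕ) : coeff n (X * d⁄dX ℝ f) = n * coeff n f := by
  cases n with
  | zero => simp
  | succ n => rw [coeff_succ_X_mul, coeff_derivative]; push_cast; ring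

theorem norm_le_self_of_pos (hτ : 0 < τ) : ‖τ‖ ≤ τ := (Real.norm_of_nonneg hτ.le).le

theorem norm_mul_exp_le (hτ : 0 < τ) (θ : ℝ) : ‖(τ : ℂ) * Complex.exp (θ * Complex.I)‖ ≤ τ := by
  rw [norm_mul, Complex.norm_exp_ofReal_mul_I, Complex.norm_real, mul_one]
  exact norm_le_self_of_pos hτ

theorem hasSum_value_real (hτ : 0 < τ) (f : absConv τ) :
    HasSum (fun n => coeff n f.1 * τ ^ n) (value τ τ (norm_le_self_of_pos hτ) f) :=
  hasSum_value (norm_le_self_of_pos hτ) f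

theorem trigSeries_eq_value (hτ : 0 < τ) (f : absConv τ) (M θ : ℝ) :
    trigSeries (fun n => coeff n f.1 * τ ^ n / M) θ = value τ _ (norm_mul_exp_le hτ θ) f / M := by
  refine Eq.trans (tsum_congr fun n => ?_)
    ((hasSum_value (norm_mul_exp_le hτ θ) f).div_const (M : ℂ)).tsum_eq
  rw [Complex.real_smul, mul_pow, ← Complex.exp_nat_mul]
  push_cast
  ring_nf

/-- The local limit theorem for the coefficients of `g f ^ m`: the point `τ` is the saddle point,
where `τ f' / f = 1`. -/
theorem tendsto_coeff_mul_pow (hτ : 0 < τ) {v : ℝ} (hv : 0 < v) (f g df ddf : absConv τ)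
    (hdf : df.1 = X * d⁄dX ℝ f.1) (hddf : ddf.1 = X * d⁄dX ℝ df.1) (hf : ∀ n, 0 ≤ coeff n f.1)
    (hf0 : 0 < coeff 0 f.1) (hf1 : 0 < coeff 1 f.1)
    (hmean : value τ τ (norm_le_self_of_pos hτ) df = value τ τ (norm_le_self_of_pos hτ) f)
    (hvar : value τ τ (norm_le_self_of_pos hτ) ddf =
      (1 + v) * value τ τ (norm_le_self_of_pos hτ) f) :
    Tendsto (fun m : ℕ => √m * coeff m (g.1 * f.1 ^ m) /
        (value τ τ (norm_le_self_of_pos hτ) f / τ) ^ m) atTop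
      (𝓝 (value τ τ (norm_le_self_of_pos hτ) g / √(2 * Real.pi * v))) := by
  have hs := hasSum_value_real hτ f
  have hsd := hasSum_value_real hτ df
  have hsdd := hasSum_value_real hτ ddf
  have hsg := hasSum_value_real hτ g
  set M := value τ τ (norm_le_self_of_pos hτ) f
  have hM : 0 < M := by
    refine hf0.trans_le ?_
    have := hs.tsum_eq ▸ hs.summable.le_tsum 0 fun n _ => mul_nonneg (hf n) (pow_nonneg hτ.le n)
    simpa using this
  rw [hmean] at hsd
  rw [hvar] at hsdd
  rw [← hsg.tsum_eq]
  have h1 : HasSum (fun n => coeff n f.1 * τ ^ n / M) 1 := by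
    simpa [hM.ne'] using hs.div_const M
  have h2 : HasSum (fun n : ℕ => ((n : ℝ) - 1) * (coeff n f.1 * τ ^ n / M)) 0 := by
    have := (hsd.sub hs).div_const M
    rw [sub_self, zero_div] at this
    refine this.congr_fun fun n => ?_
    rw [hdf, coeff_X_mul_derivative]
    ring
  have h3 : HasSum (fun n : ℕ => ((n : ℝ) - 1) ^ 2 * (coeff n f.1 * τ ^ n / M)) v := by
    have := ((hsdd.sub (hsd.mul_left 2)).add hs).div_const M
    have hval : ((1 + v) * M - 2 * M + M) / M = v := by field_simp; ring
    rw [hval] at this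
    refine this.congr_fun fun n => ?_
    rw [hddf, coeff_X_mul_derivative, hdf, coeff_X_mul_derivative]
    ring
  have := tendsto_sqrt_mul_coeff (q := fun n => coeff n g.1 * τ ^ n)
    (fun m n => coeff n (g * f ^ m : absConv τ).1 * τ ^ n / M ^ m)
    (fun n => div_nonneg (mul_nonneg (hf n) (pow_nonneg hτ.le n)) hM.le) h1 h2 h3 hv
    (by simpa using div_pos hf0 hM) (by simpa using div_pos (mul_pos hf1 hτ) hM) g.2
    (fun m => ((g * f ^ m).2.div_const (M ^ m)).congr fun n => by
      rw [abs_div, abs_of_pos (pow_pos hM m)]; rfl)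
    (fun m θ => by
      have e1 := trigSeries_eq_value hτ (g * f ^ m) (M ^ m) θ
      have e2 := trigSeries_eq_value hτ f M θ
      have e3 := trigSeries_eq_value hτ g 1 θ
      simp only [div_one, Complex.ofReal_one] at e3
      rw [e1, e2, e3, map_mul, map_pow, div_pow, Complex.ofReal_pow, mul_div_assoc])
  refine this.congr fun m => ?_
  have : (g * f ^ m : absConv τ).1 = g.1 * f.1 ^ m := rfl
  rw [this, div_pow]
  field_simp

end PowerSeries

/-! ### Convergence of the parametrization -/

namespace PowerSeries

theorem sum_coeff_mul_le {f g : ℝ⟦X⟧} (hf : ∀ n, 0 ≤ coeff n f) (hg : ∀ n, 0 ≤ coeff n g) {ρ : ℝ}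
    (hρ : 0 ≤ ρ) (N : ℕ) : ∑ n ∈ Finset.range N, coeff n (f * g) * ρ ^ n ≤
      (∑ n ∈ Finset.range N, coeff n f * ρ ^ n) * ∑ n ∈ Finset.range N, coeff n g * ρ ^ n := by
  have h : ∀ n, coeff n (f * g) * ρ ^ n = ∑ kl ∈ Finset.HasAntidiagonal.antidiagonal n,
      coeff kl.1 f * ρ ^ kl.1 * (coeff kl.2 g * ρ ^ kl.2) := fun n => by
    rw [coeff_mul, Finset.sum_mul]
    refine Finset.sum_congr rfl fun kl hkl => ?_
    rw [← Finset.HasAntidiagonal.mem_antidiagonal.1 hkl, pow_add]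
    ring
  rw [Finset.sum_mul_sum, ← Finset.sum_product', Finset.sum_congr rfl fun n _ => h n,
    Finset.sum_sigma']
  refine (Finset.sum_nbij (t := ((Finset.range N).sigma fun n =>
    Finset.HasAntidiagonal.antidiagonal n).image fun x : (_ : ℕ) × ℕ × ℕ => x.2)
    (g := fun kl : ℕ × ℕ => coeff kl.1 f * ρ ^ kl.1 * (coeff kl.2 g * ρ ^ kl.2)) (fun x : (_ : ℕ) × ℕ × ℕ => x.2)
    (fun x hx => Finset.mem_image_of_mem _ hx) ?_ ?_ fun _ _ => rfl).trans_le ?_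
  · rintro ⟨n, kl⟩ hx ⟨m, kl'⟩ hy (rfl : kl = kl')
    simp only [Finset.coe_sigma, Set.mem_sigma_iff, Finset.mem_coe,
      Finset.HasAntidiagonal.mem_antidiagonal] at hx hy
    obtain rfl : n = m := hx.2.symm.trans hy.2
    rfl
  · rw [Finset.coe_image]
    exact Set.surjOn_image _ _
  · refine Finset.sum_le_sum_of_subset_of_nonneg ?_ fun kl _ _ =>
      mul_nonneg (mul_nonneg (hf _) (by positivity)) (mul_nonneg (hg _) (by positivity))
    intro kl hkl
    simp only [Finset.mem_image, Finset.mem_sigma, Finset.mem_range,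
      Finset.HasAntidiagonal.mem_antidiagonal] at hkl
    obtain ⟨⟨n, kl⟩, ⟨h1, h2⟩, rfl⟩ := hkl
    simp only at h1 h2
    simp only [Finset.mem_product, Finset.mem_range]
    omega

theorem mem_absConv_of_sum_le {f : ℝ⟦X⟧} (hf : ∀ n, 0 ≤ coeff n f) {ρ c : ℝ} (hρ : 0 ≤ ρ)
    (h : ∀ N, ∑ n ∈ Finset.range N, coeff n f * ρ ^ n ≤ c) : f ∈ absConv ρ := by
  refine (summable_of_sum_range_le (fun n => mul_nonneg (hf n) (pow_nonneg hρ n)) h).congr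
    fun n => ?_
  rw [Real.norm_of_nonneg (mul_nonneg (hf n) (pow_nonneg hρ n))]

end PowerSeries

open PowerSeries

theorem coeff_branch_nonneg (n : ℕ) : 0 ≤ coeff n branch := by
  rw [branch, coeff_mk]; exact Nat.cast_nonneg _

/-- The number `3 / 10` is a supersolution of the equation of `branch` at `1 / 5`. -/
theorem sum_branch_le (N : ℕ) : ∑ n ∈ Finset.range N, coeff n branch * (1 / 5) ^ n ≤ 3 / 10 := by
  induction N with
  | zero => norm_num
  | succ N ih =>
    have h0 : 0 ≤ ∑ n ∈ Finset.range N, coeff n branch * (1 / 5 : ℝ) ^ n :=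
      Finset.sum_nonneg fun n _ => mul_nonneg (coeff_branch_nonneg n) (by positivity)
    have hsq := sum_coeff_mul_le coeff_branch_nonneg coeff_branch_nonneg
      (by norm_num : (0 : ℝ) ≤ 1 / 5) N
    have hstep : ∀ n,
        coeff (n + 1) branch = coeff n 1 + coeff n X + 3 * coeff n (branch * branch) := by
      intro n
      have h3 : X + X ^ 2 + 3 * X * branch ^ 2 = X * (1 + X + C 3 * (branch * branch)) := by
        rw [map_ofNat]; ring
      conv_lhs => rw [branch_eq, h3]
      rw [coeff_succ_X_mul, map_add, map_add, coeff_C_mul]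
    have hpart : ∀ f : ℝ⟦X⟧, (∀ n, 0 ≤ coeff n f) → ∀ k, (∀ n, n ≠ k → coeff n f = 0) →
        ∑ n ∈ Finset.range N, coeff n f * (1 / 5 : ℝ) ^ n ≤ coeff k f * (1 / 5) ^ k := by
      intro f hf k hk
      refine (Finset.sum_le_sum_of_subset_of_nonneg
        (Finset.subset_union_left (s₂ := {k})) fun n _ _ =>
        mul_nonneg (hf n) (by positivity)).trans_eq ?_
      refine Finset.sum_eq_single k (fun n _ hn => by rw [hk n hn, zero_mul]) fun h => ?_
      simp at h
    have h1 := hpart 1 (fun n => by rw [coeff_one]; split_ifs <;> norm_num) 0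
      fun n hn => by rw [coeff_one, if_neg hn]
    have h2 := hpart X (fun n => by rw [coeff_X]; split_ifs <;> norm_num) 1
      fun n hn => by rw [coeff_X, if_neg hn]
    rw [coeff_zero_one] at h1
    rw [coeff_one_X] at h2
    rw [Finset.sum_range_succ', coeff_zero_eq_constantCoeff_apply, constantCoeff_branch]
    have e : ∑ n ∈ Finset.range N, coeff (n + 1) branch * (1 / 5 : ℝ) ^ (n + 1) =
        (∑ n ∈ Finset.range N, coeff n 1 * (1 / 5 : ℝ) ^ n +
        ∑ n ∈ Finset.range N, coeff n X * (1 / 5 : ℝ) ^ n +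
        3 * ∑ n ∈ Finset.range N, coeff n (branch * branch) * (1 / 5 : ℝ) ^ n) / 5 := by
      rw [Finset.mul_sum, ← Finset.sum_add_distrib, ← Finset.sum_add_distrib, Finset.sum_div]
      refine Finset.sum_congr rfl fun n _ => ?_
      rw [hstep]
      ring
    rw [e]
    nlinarith

theorem coeff_branchInv_nonneg (n : ℕ) : 0 ≤ coeff n branchInv := by
  induction n using Nat.strong_induction_on with
  | h n ih =>
    have h : branchInv = 1 + C 2 * (branch * branchInv) := by
      rw [map_ofNat]; linear_combination branchInv_mul
    rw [h, map_add, coeff_C_mul, coeff_mul]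
    refine add_nonneg (by rw [coeff_one]; split_ifs <;> norm_num)
      (mul_nonneg (by norm_num) (Finset.sum_nonneg fun kl hkl => ?_))
    rw [Finset.HasAntidiagonal.mem_antidiagonal] at hkl
    rcases Nat.eq_zero_or_pos kl.1 with h0 | h0
    · rw [h0, coeff_zero_eq_constantCoeff_apply, constantCoeff_branch, zero_mul]
    · exact mul_nonneg (coeff_branch_nonneg _) (ih _ (by omega))

theorem branch_mem_absConv : branch ∈ absConv (1 / 5) :=
  mem_absConv_of_sum_le coeff_branch_nonneg (by norm_num) sum_branch_le

theorem branchInv_mem_absConv : branchInv ∈ absConv (1 / 5) := by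
  refine mem_absConv_of_sum_le coeff_branchInv_nonneg (by norm_num) (c := 5 / 2) fun N => ?_
  have h : branchInv = 1 + C 2 * (branch * branchInv) := by
    rw [map_ofNat]; linear_combination branchInv_mul
  have h0 : 0 ≤ ∑ n ∈ Finset.range N, coeff n branchInv * (1 / 5 : ℝ) ^ n :=
    Finset.sum_nonneg fun n _ => mul_nonneg (coeff_branchInv_nonneg n) (by positivity)
  have hmul := sum_coeff_mul_le coeff_branch_nonneg coeff_branchInv_nonneg
    (by norm_num : (0 : ℝ) ≤ 1 / 5) N
  have e : ∑ n ∈ Finset.range N, coeff n branchInv * (1 / 5 : ℝ) ^ n =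
      ∑ n ∈ Finset.range N, coeff n (1 : ℝ⟦X⟧) * (1 / 5 : ℝ) ^ n +
      2 * ∑ n ∈ Finset.range N, coeff n (branch * branchInv) * (1 / 5 : ℝ) ^ n := by
    rw [Finset.mul_sum, ← Finset.sum_add_distrib]
    refine Finset.sum_congr rfl fun n _ => ?_
    conv_lhs => rw [h]
    rw [map_add, coeff_C_mul]
    ring
  have h1 : ∑ n ∈ Finset.range N, coeff n (1 : ℝ⟦X⟧) * (1 / 5 : ℝ) ^ n ≤ 1 := by
    rcases N with _ | N
    · simp
    · rw [Finset.sum_range_succ']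
      simp [coeff_one]
  nlinarith [sum_branch_le N]

theorem coeff_lagrangeSeries_nonneg (n : ℕ) : 0 ≤ coeff n lagrangeSeries := by
  have hmul : ∀ f : ℝ⟦X⟧, (∀ n, 0 ≤ coeff n f) → ∀ n, 0 ≤ coeff n ((1 + 3 * X) * f) := by
    intro f hf n
    have : (1 + 3 * X) * f = f + C 3 * (X * f) := by rw [map_ofNat]; ring
    rw [this, map_add, coeff_C_mul]
    cases n with
    | zero => simpa using hf 0
    | succ n =>
      rw [coeff_succ_X_mul]
      exact add_nonneg (hf _) (mul_nonneg (by norm_num) (hf n))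
  have : lagrangeSeries = (1 + 3 * X) * ((1 + 3 * X) * ((1 + 3 * X) * branchInv)) := by
    rw [lagrangeSeries]; ring
  rw [this]
  exact hmul _ (hmul _ (hmul _ coeff_branchInv_nonneg)) n

/-! ### The parametrization at a saddle point -/

open PowerSeries Topology

theorem PowerSeries.derivative_ofNat (n : ℕ) [n.AtLeastTwo] :
    d⁄dX ℝ (ofNat(n) : ℝ⟦X⟧) = 0 := by
  rw [← map_ofNat (C (R := ℝ)) n, derivative_C]

theorem derivative_branch_mul :
    d⁄dX ℝ branch * (1 - 6 * X * branch) = 1 + 2 * X + 3 * branch ^ 2 := by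
  have h := congrArg (d⁄dX ℝ) branch_eq
  simp only [map_add, Derivation.leibniz, Derivation.leibniz_pow, derivative_X, derivative_ofNat,
    smul_eq_mul, nsmul_eq_mul] at h
  push_cast at h
  linear_combination h

theorem derivative_derivative_branch_mul :
    d⁄dX ℝ (d⁄dX ℝ branch) * (1 - 6 * X * branch) =
      2 + 12 * branch * d⁄dX ℝ branch + 6 * X * (d⁄dX ℝ branch) ^ 2 := by
  have h := congrArg (d⁄dX ℝ) derivative_branch_mul
  simp only [map_add, map_sub, Derivation.leibniz, Derivation.leibniz_pow, derivative_X, derivative_one,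
    derivative_ofNat, smul_eq_mul, nsmul_eq_mul] at h
  push_cast at h
  linear_combination h

theorem derivative_branchInv : d⁄dX ℝ branchInv = 2 * branchInv ^ 2 * d⁄dX ℝ branch := by
  have h := congrArg (d⁄dX ℝ) branchInv_mul
  simp only [map_sub, Derivation.leibniz, derivative_one, derivative_ofNat, smul_eq_mul] at h
  linear_combination branchInv * h - d⁄dX ℝ branchInv * branchInv_mul

theorem derivative_lagrangeSeries : d⁄dX ℝ lagrangeSeries =
    9 * (1 + 3 * X) ^ 2 * branchInv +
      2 * (1 + 3 * X) ^ 3 * branchInv ^ 2 * d⁄dX ℝ branch := by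
  rw [lagrangeSeries]
  simp only [map_add, Derivation.leibniz, Derivation.leibniz_pow, derivative_X, derivative_one,
    derivative_ofNat, derivative_branchInv, smul_eq_mul, nsmul_eq_mul]
  push_cast
  ring

theorem derivative_derivative_lagrangeSeries : d⁄dX ℝ (d⁄dX ℝ lagrangeSeries) =
    54 * (1 + 3 * X) * branchInv + 36 * (1 + 3 * X) ^ 2 * branchInv ^ 2 * d⁄dX ℝ branch +
      (1 + 3 * X) ^ 3 * (8 * branchInv ^ 3 * (d⁄dX ℝ branch) ^ 2 +
        2 * branchInv ^ 2 * d⁄dX ℝ (d⁄dX ℝ branch)) := by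
  rw [derivative_lagrangeSeries]
  simp only [map_add, Derivation.leibniz, Derivation.leibniz_pow, derivative_X, derivative_one,
    derivative_ofNat, derivative_branchInv, smul_eq_mul, nsmul_eq_mul]
  push_cast
  ring

theorem derivative_outputSeries : d⁄dX ℝ outputSeries = 6 * (1 + branch * branchInv) +
    2 * (1 + 3 * X) * (d⁄dX ℝ branch * branchInv + 2 * branch * branchInv ^ 2 * d⁄dX ℝ branch) := by
  rw [outputSeries]
  simp only [map_add, Derivation.leibniz, derivative_X, derivative_one,
    derivative_ofNat, derivative_branchInv, smul_eq_mul]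
  ring

/-- The values at `τ` of the series of the parametrization and of their derivatives, and the
asymptotic behaviour of the coefficients if `τ` is a saddle point. -/
theorem exists_values {τ : ℝ} (h0 : 0 < τ) (h1 : τ < 1 / 10) : ∃ s i s₁ s₂ : ℝ,
    0 ≤ s ∧ s ≤ 3 / 10 ∧ s = τ + τ ^ 2 + 3 * τ * s ^ 2 ∧ i * (1 - 2 * s) = 1 ∧
    s₁ * (1 - 6 * τ * s) = 1 + 2 * τ + 3 * s ^ 2 ∧
    s₂ * (1 - 6 * τ * s) = 2 + 12 * s * s₁ + 6 * τ * s₁ ^ 2 ∧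
    ∀ v > 0,
      τ * (9 * (1 + 3 * τ) ^ 2 * i + 2 * (1 + 3 * τ) ^ 3 * i ^ 2 * s₁) = (1 + 3 * τ) ^ 3 * i →
      τ ^ 2 * (54 * (1 + 3 * τ) * i + 36 * (1 + 3 * τ) ^ 2 * i ^ 2 * s₁ +
        (1 + 3 * τ) ^ 3 * (8 * i ^ 3 * s₁ ^ 2 + 2 * i ^ 2 * s₂)) = v * ((1 + 3 * τ) ^ 3 * i) →
      Tendsto (fun m : ℕ => √m * coeff m (X * d⁄dX ℝ outputSeries * lagrangeSeries ^ m) /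
        ((1 + 3 * τ) ^ 3 * i / τ) ^ m) atTop
        (𝓝 (τ * (6 * (1 + s * i) + 2 * (1 + 3 * τ) * (s₁ * i + 2 * s * i ^ 2 * s₁)) /
          √(2 * Real.pi * v))) := by
  let x : absConv τ := ⟨X, X_mem_absConv τ⟩
  let b : absConv τ := ⟨branch, absConv_anti h0.le (by linarith) branch_mem_absConv⟩
  let j : absConv τ := ⟨branchInv, absConv_anti h0.le (by linarith) branchInv_mem_absConv⟩
  let b₁ : absConv τ := ⟨d⁄dX ℝ branch,
    derivative_mem_absConv h0 (by linarith) branch_mem_absConv⟩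
  let b₂ : absConv τ := ⟨d⁄dX ℝ (d⁄dX ℝ branch), derivative_mem_absConv h0 h1
    (derivative_mem_absConv (by norm_num) (by norm_num) branch_mem_absConv)⟩
  let ι := (absConv τ).subtype
  have hι : Function.Injective ι := Subring.subtype_injective _
  have hx : ι x = X := rfl
  have hb : ι b = branch := rfl
  have hj : ι j = branchInv := rfl
  have hb₁ : ι b₁ = d⁄dX ℝ branch := rfl
  have hb₂ : ι b₂ = d⁄dX ℝ (d⁄dX ℝ branch) := rfl
  have e1 : b = x + x ^ 2 + 3 * x * b ^ 2 := hι (by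
    simp only [map_add, map_mul, map_pow, map_ofNat, hx, hb]; exact branch_eq)
  have e2 : j * (1 - 2 * b) = 1 := hι (by
    simp only [map_sub, map_mul, map_one, map_ofNat, hj, hb]; exact branchInv_mul)
  have e3 : b₁ * (1 - 6 * x * b) = 1 + 2 * x + 3 * b ^ 2 := hι (by
    simp only [map_add, map_sub, map_mul, map_pow, map_one, map_ofNat, hx, hb, hb₁]
    exact derivative_branch_mul)
  have e4 : b₂ * (1 - 6 * x * b) = 2 + 12 * b * b₁ + 6 * x * b₁ ^ 2 := hι (by
    simp only [map_add, map_sub, map_mul, map_pow, map_one, map_ofNat, hx, hb, hb₁, hb₂]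
    exact derivative_derivative_branch_mul)
  let V := value τ τ (norm_le_self_of_pos h0)
  have hV : V x = τ := value_X _
  have k1 := congrArg V e1
  have k2 := congrArg V e2
  have k3 := congrArg V e3
  have k4 := congrArg V e4
  simp only [map_add, map_sub, map_mul, map_pow, map_one, map_ofNat, hV] at k1 k2 k3 k4
  have hVb := hasSum_value_real h0 b
  refine ⟨V b, V j, V b₁, V b₂, ?_, ?_, k1, k2, k3, k4, ?_⟩
  · exact hVb.nonneg fun n => mul_nonneg (coeff_branch_nonneg n) (by positivity)
  · refine le_of_tendsto' hVb.tendsto_sum_nat fun N => le_trans ?_ (sum_branch_le N)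
    refine Finset.sum_le_sum fun n _ => mul_le_mul_of_nonneg_left ?_ (coeff_branch_nonneg n)
    gcongr
    linarith
  · intro v hv hmean hvar
    let f : absConv τ := (1 + 3 * x) ^ 3 * j
    have hf : ι f = lagrangeSeries := by
      simp only [f, map_add, map_mul, map_pow, map_one, map_ofNat, hx, hj]; rfl
    let f₁ : absConv τ := 9 * (1 + 3 * x) ^ 2 * j + 2 * (1 + 3 * x) ^ 3 * j ^ 2 * b₁
    have hf₁ : ι f₁ = d⁄dX ℝ lagrangeSeries := by
      simp only [f₁, map_add, map_mul, map_pow, map_one, map_ofNat, hx, hj, hb₁]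
      exact derivative_lagrangeSeries.symm
    let f₂ : absConv τ := 54 * (1 + 3 * x) * j + 36 * (1 + 3 * x) ^ 2 * j ^ 2 * b₁ +
        (1 + 3 * x) ^ 3 * (8 * j ^ 3 * b₁ ^ 2 + 2 * j ^ 2 * b₂)
    have hf₂ : ι f₂ = d⁄dX ℝ (d⁄dX ℝ lagrangeSeries) := by
      simp only [f₂, map_add, map_mul, map_pow, map_one, map_ofNat, hx, hj, hb₁, hb₂]
      exact derivative_derivative_lagrangeSeries.symm
    let g : absConv τ := x * (6 * (1 + b * j) + 2 * (1 + 3 * x) * (b₁ * j + 2 * b * j ^ 2 * b₁))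
    have hg : ι g = X * d⁄dX ℝ outputSeries := by
      simp only [g, map_add, map_mul, map_pow, map_one, map_ofNat, hx, hj, hb, hb₁]
      rw [derivative_outputSeries]
    have hVf : V f = (1 + 3 * τ) ^ 3 * V j := by
      simp only [f, map_add, map_mul, map_pow, map_one, map_ofNat, hV]
    have hVf₁ : V (x * f₁) = V f := by
      rw [hVf, ← hmean]
      simp only [f₁, map_add, map_mul, map_pow, map_one, map_ofNat, hV]
    have hVf₂ : V (x * f₁ + x ^ 2 * f₂) = (1 + v) * V f := by
      rw [map_add, hVf₁, add_mul, one_mul, hVf, ← hvar]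
      simp only [f₂, map_add, map_mul, map_pow, map_one, map_ofNat, hV]
    have hVg : V g = τ * (6 * (1 + V b * V j) +
        2 * (1 + 3 * τ) * (V b₁ * V j + 2 * V b * V j ^ 2 * V b₁)) := by
      simp only [g, map_add, map_mul, map_pow, map_one, map_ofNat, hV]
    have hc0 : constantCoeff branchInv = 1 := by
      simpa [constantCoeff_branch] using congrArg constantCoeff branchInv_mul
    have hc1 : constantCoeff (d⁄dX ℝ branch) = 1 := by
      simpa [constantCoeff_branch] using congrArg constantCoeff derivative_branch_mul
    have := tendsto_coeff_mul_pow h0 hv f g (x * f₁) (x * f₁ + x ^ 2 * f₂)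
      (show ι (x * f₁) = X * d⁄dX ℝ (ι f) by rw [map_mul, hx, hf, hf₁])
      (show ι (x * f₁ + x ^ 2 * f₂) = X * d⁄dX ℝ (ι (x * f₁)) by
        simp only [map_add, map_mul, map_pow, hx, hf₁, hf₂, Derivation.leibniz, derivative_X,
          smul_eq_mul]
        ring)
      (show ∀ n, 0 ≤ coeff n (ι f) by rw [hf]; exact coeff_lagrangeSeries_nonneg)
      (show 0 < coeff 0 (ι f) by
        rw [hf, coeff_zero_eq_constantCoeff_apply, lagrangeSeries]
        simp [hc0])
      (show 0 < coeff 1 (ι f) by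
        have h : coeff 1 (ι f) = constantCoeff (d⁄dX ℝ lagrangeSeries) := by
          rw [hf, ← coeff_zero_eq_constantCoeff_apply, coeff_derivative]; simp
        rw [h, derivative_lagrangeSeries]
        simp only [map_add, map_mul, map_pow, map_one, map_ofNat, constantCoeff_X, hc0, hc1]
        norm_num)
      hVf₁ hVf₂
    rw [← hVg, ← hVf, ← hg, ← hf]
    exact this

/-! ### The saddle point -/

open PowerSeries Topology

theorem mul_mem_Icc {a b c d l u x y : ℝ} (hx : x ∈ Set.Icc a b) (hy : y ∈ Set.Icc c d)
    (h : 0 ≤ a ∧ 0 ≤ c ∧ l ≤ a * c ∧ b * d ≤ u) : x * y ∈ Set.Icc l u :=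
  ⟨h.2.2.1.trans (mul_le_mul hx.1 hy.1 h.2.1 (h.1.trans hx.1)),
    (mul_le_mul hx.2 hy.2 (h.2.1.trans hy.1) ((h.1.trans hx.1).trans hx.2)).trans h.2.2.2⟩

theorem mem_Icc_of_mul_eq {a b c d l u x y z : ℝ} (h : x * y = z) (hy : y ∈ Set.Icc a b)
    (hz : z ∈ Set.Icc c d) (hb : 0 < a ∧ 0 ≤ l ∧ 0 ≤ u ∧ l * b ≤ c ∧ d ≤ u * a) :
    x ∈ Set.Icc l u := by
  have hy0 : 0 < y := hb.1.trans_le hy.1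
  constructor
  · refine le_of_mul_le_mul_right ?_ hy0
    rw [h]
    exact ((mul_le_mul_of_nonneg_left hy.2 hb.2.1).trans hb.2.2.2.1).trans hz.1
  · refine le_of_mul_le_mul_right ?_ hy0
    rw [h]
    exact (hz.2.trans hb.2.2.2.2).trans (mul_le_mul_of_nonneg_left hy.1 hb.2.2.1)

/-- The polynomial whose root is the saddle point: eliminate `s` from the equation of the curve
with the saddle point equation, which is linear in `s`. -/
theorem exists_saddle_point : ∃ τ ∈ Set.Icc (0.09672515895 : ℝ) 0.09672515896,
    (1 - 10 * τ + 18 * τ ^ 2 + 18 * τ ^ 3) ^ 2 -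
      4 * (2 - 3 * τ) * (1 - 10 * τ + 18 * τ ^ 2 + 18 * τ ^ 3) +
      48 * τ ^ 2 * (1 + τ) * (2 - 3 * τ) ^ 2 = 0 := by
  have hcont : ContinuousOn (fun τ : ℝ => (1 - 10 * τ + 18 * τ ^ 2 + 18 * τ ^ 3) ^ 2 -
      4 * (2 - 3 * τ) * (1 - 10 * τ + 18 * τ ^ 2 + 18 * τ ^ 3) +
      48 * τ ^ 2 * (1 + τ) * (2 - 3 * τ) ^ 2) (Set.Icc 0.09672515895 0.09672515896) := by
    fun_prop
  obtain ⟨τ, hτ, h⟩ := intermediate_value_Icc (by norm_num) hcont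
    (show (0 : ℝ) ∈ Set.Icc _ _ by constructor <;> norm_num)
  exact ⟨τ, hτ, h⟩

/-- The growth rate is a root of the polynomial of degree six: substitute the rational
expression of the growth rate in the saddle point. -/
theorem growthRate_isRoot {τ C : ℝ} (hD : 22 * τ - 1 - 36 * (τ * τ) - 18 * (τ * τ * τ) ≠ 0)
    (hC : C * (22 * τ - 1 - 36 * (τ * τ) - 18 * (τ * τ * τ)) =
      (12 - 18 * τ) * ((1 + 3 * τ) * (1 + 3 * τ) * (1 + 3 * τ)))
    (h : (1 - 10 * τ + 18 * τ ^ 2 + 18 * τ ^ 3) ^ 2 -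
      4 * (2 - 3 * τ) * (1 - 10 * τ + 18 * τ ^ 2 + 18 * τ ^ 3) +
      48 * τ ^ 2 * (1 + τ) * (2 - 3 * τ) ^ 2 = 0) :
    1296 * C ^ 6 + 363232 * C ^ 5 - 16927248 * C ^ 4 + 438097032 * C ^ 3
      - 8977010004 * C ^ 2 + 28680825384 * C - 24111675 = 0 := by
  refine (mul_eq_zero.1 ?_).resolve_right (pow_ne_zero 6 hD)
  have key : ∀ D n : ℝ, C * D = n → (1296 * C ^ 6 + 363232 * C ^ 5 - 16927248 * C ^ 4 +
      438097032 * C ^ 3 - 8977010004 * C ^ 2 + 28680825384 * C - 24111675) * D ^ 6 =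
      1296 * n ^ 6 + 363232 * n ^ 5 * D - 16927248 * n ^ 4 * D ^ 2 + 438097032 * n ^ 3 * D ^ 3 -
      8977010004 * n ^ 2 * D ^ 4 + 28680825384 * n * D ^ 5 - 24111675 * D ^ 6 := by
    rintro D n rfl
    ring
  rw [key _ _ hC]
  -- The cofactor is the quotient of the two polynomials.
  linear_combination (404490350349 - 19591677420588 * τ + 353111070691908 * τ ^ 2 - 2601860711952600 * τ ^ 3 +
    1305030676388436 * τ ^ 4 - 258641445592008 * τ ^ 5 - 82444397124470184 * τ ^ 6 +
    774935296584117696 * τ ^ 7 - 293961050590940784 * τ ^ 8 - 5497293153250273824 * τ ^ 9 +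
    7343827067730078864 * τ ^ 10 + 3789621693649583712 * τ ^ 11 - 7818629598994267440 * τ ^ 12
    + 95180870659648896 * τ ^ 13 + 2716373009108119104 * τ ^ 14 - 1587818463576329088 * τ ^ 15
    - 551136428484873984 * τ ^ 16 + 476855535685381632 * τ ^ 17 + 52708129816230144 * τ ^ 18) * h

/-- The Taylor expansion of the polynomial at `28` has positive coefficients, except for the
constant one. -/
theorem growthRate_isGreatest {C : ℝ} (hC28 : 28 ≤ C)
    (hC : 1296 * C ^ 6 + 363232 * C ^ 5 - 16927248 * C ^ 4 + 438097032 * C ^ 3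
      - 8977010004 * C ^ 2 + 28680825384 * C - 24111675 = 0) :
    IsGreatest {x : ℝ | 1296 * x ^ 6 + 363232 * x ^ 5 - 16927248 * x ^ 4 + 438097032 * x ^ 3
        - 8977010004 * x ^ 2 + 28680825384 * x - 24111675 = 0} C := by
  refine ⟨hC, fun x hx => ?_⟩
  rw [Set.mem_ofPred_eq] at hx
  by_contra! h
  obtain ⟨u, rfl⟩ : ∃ u, C = 28 + u := ⟨C - 28, by ring⟩
  obtain ⟨t, rfl⟩ : ∃ t, x = 28 + t := ⟨x - 28, by ring⟩
  have hu : 0 ≤ u := by linarith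
  have hut : u < t := by linarith
  have hk : ∀ k : ℕ, u ^ k ≤ t ^ k := fun k => pow_le_pow_left₀ hu hut.le k
  linarith [hk 2, hk 3, hk 4, hk 5, hk 6]

/-- The asymptotic behaviour of the coefficients: `C = φ(τ) / τ` is the growth rate, the variance `v`
is `τ² φ''(τ) / φ(τ)`, and `K = τ h'(τ)`. The saddle point is known to eleven decimals, and enclosures
of all other quantities are obtained from it by interval arithmetic. -/
theorem exists_growthRate : ∃ C v K : ℝ, (28.43330 ≤ C ∧ C < 28.43331) ∧ 0 < v ∧ 0 < K ∧
    1752.101 ^ 2 * K ^ 2 ≤ (C ^ 2) ^ 2 * (2 * Real.pi * v) ∧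
    (C ^ 2) ^ 2 * (2 * Real.pi * v) < 1752.102 ^ 2 * K ^ 2 ∧
    1296 * C ^ 6 + 363232 * C ^ 5 - 16927248 * C ^ 4 + 438097032 * C ^ 3
      - 8977010004 * C ^ 2 + 28680825384 * C - 24111675 = 0 ∧
    Tendsto (fun m : ℕ => √m * coeff m (X * d⁄dX ℝ outputSeries * lagrangeSeries ^ m) / C ^ m)
      atTop (𝓝 (K / √(2 * Real.pi * v))) := by
  obtain ⟨τ, ht, hq0⟩ := exists_saddle_point
  have hτ : 0 < τ := lt_of_lt_of_le (by norm_num) ht.1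
  obtain ⟨s, i, s₁, s₂, hs0, hs3, k1, e3, k3, k4, hlim⟩ :=
    exists_values hτ (ht.2.trans_lt (by norm_num))
  have ht2 : τ * τ ∈ Set.Icc (0.00935575637 : ℝ) 0.00935575638 := mul_mem_Icc ht ht (by norm_num)
  have ht3 : τ * τ * τ ∈ Set.Icc (0.00090493702 : ℝ) 0.00090493703 :=
    mul_mem_Icc ht2 ht (by norm_num)
  have hN : 1 - 10 * τ + 18 * (τ * τ) + 18 * (τ * τ * τ) ∈
      Set.Icc (0.21744089142 : ℝ) 0.21744089188 :=
    ⟨by linarith [ht.1, ht.2, ht2.1, ht2.2, ht3.1, ht3.2],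
      by linarith [ht.1, ht.2, ht2.1, ht2.2, ht3.1, ht3.2]⟩
  have hd : 24 * τ - 36 * (τ * τ) ∈ Set.Icc (1.98459658512 : ℝ) 1.98459658572 :=
    ⟨by linarith [ht.1, ht.2, ht2.1, ht2.2], by linarith [ht.1, ht.2, ht2.1, ht2.2]⟩
  -- Both `s` and the closed form are the smaller root of the quadratic equation.
  have e1 : s * (24 * τ - 36 * (τ * τ)) =
      1 - 10 * τ + 18 * (τ * τ) + 18 * (τ * τ * τ) := by
    obtain ⟨y, hy⟩ : ∃ y, y * (24 * τ - 36 * (τ * τ)) =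
        1 - 10 * τ + 18 * (τ * τ) + 18 * (τ * τ * τ) :=
      ⟨_, div_mul_cancel₀ _ (lt_of_lt_of_le (by norm_num) hd.1).ne'⟩
    have hy1 : y ∈ Set.Icc (0 : ℝ) 0.2 := mem_Icc_of_mul_eq hy hd hN (by norm_num)
    have hd0 : 24 * τ - 36 * (τ * τ) ≠ 0 := (lt_of_lt_of_le (by norm_num) hd.1).ne'
    have hyq : y = τ + τ ^ 2 + 3 * τ * y ^ 2 := by
      refine mul_right_cancel₀ (pow_ne_zero 2 hd0) ?_
      linear_combination ((24 * τ - 36 * (τ * τ)) - 3 * τ * (y * (24 * τ - 36 * (τ * τ)) +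
        (1 - 10 * τ + 18 * (τ * τ) + 18 * (τ * τ * τ)))) * hy - 3 * τ * hq0
    have hsy : (s - y) * (1 - 3 * τ * (s + y)) = 0 := by linear_combination k1 - hyq
    have hne : 1 - 3 * τ * (s + y) ≠ 0 := by
      have : τ * (s + y) ≤ 0.1 * 0.5 :=
        mul_le_mul (ht.2.trans (by norm_num)) (by linarith [hy1.2]) (add_nonneg hs0 hy1.1)
          (by norm_num)
      intro h
      norm_num at this
      linarith
    rw [sub_eq_zero.1 ((mul_eq_zero.1 hsy).resolve_right hne), hy]
  have hs : s ∈ Set.Icc (0.10956427768 : ℝ) 0.10956427796 :=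
    mem_Icc_of_mul_eq e1 hd hN (by norm_num)
  have hu : 1 + 3 * τ ∈ Set.Icc (1.29017547685 : ℝ) 1.29017547688 :=
    ⟨by linarith [ht.1, ht.2], by linarith [ht.1, ht.2]⟩
  have hu2 : (1 + 3 * τ) * (1 + 3 * τ) ∈ Set.Icc (1.66455276106 : ℝ) 1.66455276115 :=
    mul_mem_Icc hu hu (by norm_num)
  have hu3 : (1 + 3 * τ) * (1 + 3 * τ) * (1 + 3 * τ) ∈ Set.Icc (2.14756515224 : ℝ) 2.14756515241 :=
    mul_mem_Icc hu2 hu (by norm_num)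
  have hr : 12 - 18 * τ ∈ Set.Icc (10.25894713872 : ℝ) 10.2589471389 :=
    ⟨by linarith [ht.1, ht.2], by linarith [ht.1, ht.2]⟩
  have hn : (12 - 18 * τ) * ((1 + 3 * τ) * (1 + 3 * τ) * (1 + 3 * τ)) ∈
      Set.Icc (22.03175737378 : ℝ) 22.03175737592 :=
    mul_mem_Icc hr hu3 (by norm_num)
  have hD : 22 * τ - 1 - 36 * (τ * τ) - 18 * (τ * τ * τ) ∈
      Set.Icc (0.77485740068 : ℝ) 0.77485740144 :=
    ⟨by linarith [ht.1, ht.2, ht2.1, ht2.2, ht3.1, ht3.2],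
      by linarith [ht.1, ht.2, ht2.1, ht2.2, ht3.1, ht3.2]⟩
  have hD0 : 22 * τ - 1 - 36 * (τ * τ) - 18 * (τ * τ * τ) ≠ 0 :=
    (lt_of_lt_of_le (by norm_num) hD.1).ne'
  obtain ⟨C, e2⟩ : ∃ C, C * (22 * τ - 1 - 36 * (τ * τ) - 18 * (τ * τ * τ)) =
      (12 - 18 * τ) * ((1 + 3 * τ) * (1 + 3 * τ) * (1 + 3 * τ)) := ⟨_, div_mul_cancel₀ _ hD0⟩
  have hC : C ∈ Set.Icc (28.4333057061 : ℝ) 28.43330573676 :=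
    mem_Icc_of_mul_eq e2 hD hn (by norm_num)
  have hC2 : C * C ∈ Set.Icc (808.45287337653 : ℝ) 808.45287512007 :=
    mul_mem_Icc hC hC (by norm_num)
  have hC4 : C * C * (C * C) ∈ Set.Icc (653596.04847076764 : ℝ) 653596.0512899075 :=
    mul_mem_Icc hC2 hC2 (by norm_num)
  have hss : s * s ∈ Set.Icc (0.01200433094 : ℝ) 0.01200433101 := mul_mem_Icc hs hs (by norm_num)
  have ha : 1 - 2 * s ∈ Set.Icc (0.78087144408 : ℝ) 0.78087144464 :=
    ⟨by linarith [hs.1, hs.2], by linarith [hs.1, hs.2]⟩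
  have hone : (1 : ℝ) ∈ Set.Icc 1 1 := ⟨le_rfl, le_rfl⟩
  have hi : i ∈ Set.Icc (1.28062052577 : ℝ) 1.2806205267 :=
    mem_Icc_of_mul_eq e3 ha hone (by norm_num)
  have hts : τ * s ∈ Set.Icc (0.01059762217 : ℝ) 0.01059762221 := mul_mem_Icc ht hs (by norm_num)
  have hb : 1 - 6 * (τ * s) ∈ Set.Icc (0.93641426674 : ℝ) 0.93641426698 :=
    ⟨by linarith [hts.1, hts.2], by linarith [hts.1, hts.2]⟩
  have hp : 1 + 2 * τ + 3 * (s * s) ∈ Set.Icc (1.22946331072 : ℝ) 1.22946331095 :=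
    ⟨by linarith [ht.1, ht.2, hss.1, hss.2], by linarith [ht.1, ht.2, hss.1, hss.2]⟩
  have e4 : s₁ * (1 - 6 * (τ * s)) = 1 + 2 * τ + 3 * (s * s) := by linear_combination k3
  have hq : s₁ ∈ Set.Icc (1.31294807658 : ℝ) 1.31294807717 :=
    mem_Icc_of_mul_eq e4 hb hp (by norm_num)
  have hsq : s * s₁ ∈ Set.Icc (0.14385220764 : ℝ) 0.14385220808 := mul_mem_Icc hs hq (by norm_num)
  have hqq : s₁ * s₁ ∈ Set.Icc (1.72383265179 : ℝ) 1.72383265335 := mul_mem_Icc hq hq (by norm_num)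
  have htqq : τ * (s₁ * s₁) ∈ Set.Icc (0.16673798724 : ℝ) 0.16673798742 :=
    mul_mem_Icc ht hqq (by norm_num)
  have hk : 2 + 12 * (s * s₁) + 6 * (τ * (s₁ * s₁)) ∈ Set.Icc (4.72665441512 : ℝ) 4.72665442148 :=
    ⟨by linarith [hsq.1, hsq.2, htqq.1, htqq.2], by linarith [hsq.1, hsq.2, htqq.1, htqq.2]⟩
  have e5 : s₂ * (1 - 6 * (τ * s)) = 2 + 12 * (s * s₁) + 6 * (τ * (s₁ * s₁)) := by
    linear_combination k4
  have hw : s₂ ∈ Set.Icc (5.04761042392 : ℝ) 5.04761043202 :=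
    mem_Icc_of_mul_eq e5 hb hk (by norm_num)
  have htw : τ * τ * s₂ ∈ Set.Icc (0.04722421337 : ℝ) 0.04722421351 :=
    mul_mem_Icc ht2 hw (by norm_num)
  have htwi : τ * τ * s₂ * i ∈ Set.Icc (0.06047629695 : ℝ) 0.06047629718 :=
    mul_mem_Icc htw hi (by norm_num)
  have hm : 1 - 6 * τ ∈ Set.Icc (0.41964904624 : ℝ) 0.4196490463 :=
    ⟨by linarith [ht.1, ht.2], by linarith [ht.1, ht.2]⟩
  -- The saddle point equation `τ φ'(τ) = φ(τ)`.
  have hcrit : 2 * τ * (1 + 3 * τ) * s₁ * i = 1 - 6 * τ := by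
    have ha0 : 1 - 2 * s ≠ 0 := (lt_of_lt_of_le (by norm_num) ha.1).ne'
    have hb0 : 1 - 6 * (τ * s) ≠ 0 := (lt_of_lt_of_le (by norm_num) hb.1).ne'
    refine mul_right_cancel₀ (mul_ne_zero ha0 hb0) ?_
    linear_combination 2 * τ * (1 + 3 * τ) * (1 + 2 * τ + 3 * (s * s)) * e3 +
      2 * τ * (1 + 3 * τ) * i * (1 - 2 * s) * e4 + (2 - 30 * τ) * k1 + e1
  -- In terms of `W` and `z = (τ / (1 + 3 τ)) ^ 2`, the logarithmic derivatives of `φ` are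
  -- `9 τ / (1 + 3 τ) + W = 1` and `-27 z + 2 τ ^ 2 s₂ i + W ^ 2 = v - 1`.
  obtain ⟨W, hWdef⟩ : ∃ W, W = 2 * τ * s₁ * i := ⟨_, rfl⟩
  have e6 : W * (1 + 3 * τ) = 1 - 6 * τ := by rw [hWdef, ← hcrit]; ring
  have hW : W ∈ Set.Icc (0.32526509281 : ℝ) 0.32526509288 :=
    mem_Icc_of_mul_eq e6 hu hm (by norm_num)
  have hWW : W * W ∈ Set.Icc (0.1057973806 : ℝ) 0.10579738065 := mul_mem_Icc hW hW (by norm_num)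
  obtain ⟨z, e7⟩ : ∃ z, z * ((1 + 3 * τ) * (1 + 3 * τ)) = τ * τ :=
    ⟨_, div_mul_cancel₀ _ (lt_of_lt_of_le (by norm_num) hu2.1).ne'⟩
  have hz : z ∈ Set.Icc (0.00562058265 : ℝ) 0.00562058266 :=
    mem_Icc_of_mul_eq e7 hu2 ht2 (by norm_num)
  have hv : 1 - 27 * z + 2 * (τ * τ * s₂ * i) + W * W ∈ Set.Icc (1.07499424268 : ℝ) 1.07499424346 :=
    ⟨by linarith [hz.1, hz.2, htwi.1, htwi.2, hWW.1, hWW.2],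
      by linarith [hz.1, hz.2, htwi.1, htwi.2, hWW.1, hWW.2]⟩
  have hti : τ * i ∈ Set.Icc (0.1238682239 : ℝ) 0.12386822402 := mul_mem_Icc ht hi (by norm_num)
  have hK : 3 * τ + i - 3 * (τ * i) ∈ Set.Icc (1.19919133056 : ℝ) 1.19919133188 :=
    ⟨by linarith [ht.1, ht.2, hi.1, hi.2, hti.1, hti.2],
      by linarith [ht.1, ht.2, hi.1, hi.2, hti.1, hti.2]⟩
  set v := 1 - 27 * z + 2 * (τ * τ * s₂ * i) + W * W with hvdef
  set K := 3 * τ + i - 3 * (τ * i) with hKdef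
  have hKK : K * K ∈ Set.Icc (1.43805984729 : ℝ) 1.43805985046 := mul_mem_Icc hK hK (by norm_num)
  have hv0 : 0 < v := lt_of_lt_of_le (by norm_num) hv.1
  have hK0 : 0 < K := lt_of_lt_of_le (by norm_num) hK.1
  have hπ : Real.pi ∈ Set.Icc (3.14159265 : ℝ) 3.14159266 :=
    ⟨(by norm_num : (3.14159265 : ℝ) ≤ 3.14159265358979323846).trans Real.pi_gt_d20.le,
      Real.pi_lt_d20.le.trans (by norm_num)⟩
  have hπv : Real.pi * v ∈
      Set.Icc (3.37719401159 : ℝ) 3.3771940248 := mul_mem_Icc hπ hv (by norm_num)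
  have hCπ : C * C * (C * C) * (Real.pi * v) ∈
      Set.Icc (2207320.66089436385 : ℝ) 2207320.67904914995 :=
    mul_mem_Icc hC4 hπv (by norm_num)
  have hlim' := hlim v hv0 (by linear_combination (1 + 3 * τ) ^ 2 * i * hcrit) (by
    rw [hvdef, hWdef]
    linear_combination (18 * τ * (1 + 3 * τ) * i + (1 + 3 * τ) * i *
      (2 * τ * (1 + 3 * τ) * s₁ * i + (1 - 6 * τ))) * hcrit + 27 * (1 + 3 * τ) * i * e7)
  refine ⟨C, v, K, ⟨le_trans (by norm_num) hC.1, lt_of_le_of_lt hC.2 (by norm_num)⟩, hv0, hK0, ?_,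
    ?_, growthRate_isRoot hD0 e2 hq0, ?_⟩
  · calc 1752.101 ^ 2 * K ^ 2 = 1752.101 ^ 2 * (K * K) := by ring
      _ ≤ 2 * (C * C * (C * C) * (Real.pi * v)) := by linarith [hKK.2, hCπ.1]
      _ = _ := by ring
  · calc (C ^ 2) ^ 2 * (2 * Real.pi * v) = 2 * (C * C * (C * C) * (Real.pi * v)) := by ring
      _ < 1752.102 ^ 2 * (K * K) := by linarith [hKK.1, hCπ.2]
      _ = _ := by ring
  · have hCτ : (1 + 3 * τ) ^ 3 * i / τ = C := by
      rw [div_eq_iff hτ.ne']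
      refine mul_right_cancel₀ hD0 ?_
      linear_combination (1 + 3 * τ) ^ 3 * (12 * τ - 18 * τ ^ 2) * e3 +
        (1 + 3 * τ) ^ 3 * i * e1 - τ * e2
    have hKτ : τ * (6 * (1 + s * i) + 2 * (1 + 3 * τ) * (s₁ * i + 2 * s * i ^ 2 * s₁)) = K := by
      rw [hKdef]
      linear_combination (1 + 2 * s * i) * hcrit - (1 - 3 * τ) * e3
    rwa [hCτ, hKτ] at hlim'

open PowerSeries Topology

/-- Transfer of the asymptotic behaviour from the coefficients of the Lagrange inversion formula,
whose index is shifted by two, to the numbers of tree-decorated triangulations. -/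
theorem ncard_apollonian_isEquivalent {C v K : ℝ} (hC : 0 < C) (hv : 0 < v) (hK : 0 < K)
    (h : Tendsto (fun m : ℕ => √m *
      coeff m (X * d⁄dX ℝ outputSeries * lagrangeSeries ^ m) / C ^ m) atTop
      (𝓝 (K / √(2 * Real.pi * v)))) :
    (fun n : ℕ => ((apollonian n).ncard : ℝ)) ~[atTop]
      (fun n : ℕ => C ^ n / (C ^ 2 * √(2 * Real.pi * v) / K * (n : ℝ) ^ (3 / 2 : ℝ))) := by
  have hπ := Real.pi_pos
  set S := √(2 * Real.pi * v)
  have hS : 0 < S := Real.sqrt_pos.2 (by positivity)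
  refine (isEquivalent_iff_tendsto_one ?_).2 ?_
  · filter_upwards [eventually_gt_atTop 0] with n hn
    have : (0 : ℝ) < n := Nat.cast_pos.2 hn
    positivity
  rw [← tendsto_add_atTop_iff_nat 3]
  have h1 := (tendsto_add_atTop_iff_nat 1).2 h
  have h2 : Tendsto (fun k : ℕ => (1 + 2 / ((k : ℝ) + 1)) ^ (3 / 2 : ℝ)) atTop (𝓝 1) := by
    have : Tendsto (fun k : ℕ => 1 + 2 / ((k : ℝ) + 1)) atTop (𝓝 (1 + 0)) :=
      tendsto_const_nhds.add (tendsto_const_nhds.div_atTop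
        (tendsto_atTop_add_const_right _ _ tendsto_natCast_atTop_atTop))
    rw [add_zero] at this
    simpa using this.rpow_const (p := (3 / 2 : ℝ)) (Or.inl one_ne_zero)
  have h3 := (h1.mul_const (S / K)).mul h2
  rw [div_mul_div_cancel₀ hS.ne', div_self hK.ne', mul_one] at h3
  refine h3.congr fun k => ?_
  have hcoeff := ncard_apollonian_eq_coeff k
  rw [← coeff_succ_X_mul, ← mul_assoc] at hcoeff
  rw [← hcoeff, Pi.div_apply]
  have hk : (0 : ℝ) < (k : ℝ) + 1 := by positivity
  have e : 1 + 2 / ((k : ℝ) + 1) = ((k + 3 : ℕ) : ℝ) / (k + 1) := by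
    rw [eq_div_iff hk.ne', add_mul, div_mul_cancel₀ _ hk.ne']; push_cast; ring
  have e2 : ((k : ℝ) + 1) ^ (3 / 2 : ℝ) = (k + 1) * √(k + 1) := by
    rw [Real.sqrt_eq_rpow, ← Real.rpow_one_add' hk.le (by norm_num)]; norm_num
  rw [e, Real.div_rpow (Nat.cast_nonneg _) hk.le, e2]
  have hk3 : (0 : ℝ) < ((k + 3 : ℕ) : ℝ) ^ (3 / 2 : ℝ) :=
    Real.rpow_pos_of_pos (Nat.cast_pos.2 (by omega)) _
  have hsq : 0 < √((k : ℝ) + 1) := Real.sqrt_pos.2 hk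
  push_cast
  push_cast at hk3
  field_simp
  ring

theorem mainTheorem9 :
    (∀ n : ℕ, (apollonian n).Finite) ∧
    IsAlgebraic (Polynomial ℚ) apollonianSeries ∧
    ∃ c C : ℝ,
      (1752.101 ≤ c ∧ c < 1752.102) ∧
      (28.43330 ≤ C ∧ C < 28.43331) ∧
      IsGreatest {x : ℝ | 1296 * x ^ 6 + 363232 * x ^ 5 - 16927248 * x ^ 4 + 438097032 * x ^ 3
        - 8977010004 * x ^ 2 + 28680825384 * x - 24111675 = 0} C ∧
      (fun n : ℕ => ((apollonian n).ncard : ℝ)) ~[atTop]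
        (fun n : ℕ => C ^ n / (c * (n : ℝ) ^ (3 / 2 : ℝ))) := by
  obtain ⟨C, v, K, hC, hv, hK, hlo, hhi, hroot, hlim⟩ := exists_growthRate
  refine ⟨TernaryTree.finite_apollonian, isAlgebraic_apollonianSeries, C ^ 2 * √(2 * Real.pi * v) / K,
    C, ⟨?_, ?_⟩, hC, growthRate_isGreatest (le_trans (by norm_num) hC.1) hroot,
    ncard_apollonian_isEquivalent (lt_of_lt_of_le (by norm_num) hC.1) hv hK hlim⟩
  · rw [le_div_iff₀ hK]
    refine le_of_sq_le_sq ?_ (by positivity)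
    rw [mul_pow, mul_pow, Real.sq_sqrt (by have := Real.pi_pos; positivity)]
    exact hlo
  · rw [div_lt_iff₀ hK]
    refine lt_of_pow_lt_pow_left₀ 2 (by positivity) ?_
    rw [mul_pow, mul_pow, Real.sq_sqrt (by have := Real.pi_pos; positivity)]
    exact hhi
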